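/- Let either $0<b<\infty$ or $b=\infty$, and let $q:(0,b)\to\mathbb R$ belong to one of the following cases. (1) $b<\infty$ and $q\in L^1((0,b))$; fix $h\in\mathbb R\cup\{\infty\}$ and consider the condition $u'(b_-)+h\,u(b_-)=0$ (for $h=\infty$: $u(b_-)=0$). For (2)–(4), $b=\infty$ and $\int_0^a|q(x)|\,dx<\infty$ for all $a<\infty$. (2) $\sup_{a>0}\int_a^{a+1}\max(-q(x),0)\,dx<\infty$; consider the condition that $u$ be $L^2$ near $\infty$. (3) $-\frac{d^2}{dx^2}+q$ is limit point at $\infty$, that is, for each $z$ with $\operatorname{Im} z>0$ the equation $-u''+qu=zu$ has, up to a multiplicative constant, exactly one nonzero solution that is $L^2$ near $\infty$; consider again the condition that $u$ be $L^2$ near $\infty$. (4) $-\frac{d^2}{dx^2}+q$ is limit circle at $\infty$, that is, for each $z$ with $\operatorname{Im} z>0$ every solution of $-u''+qu=zu$ is $L^2$ near $\infty$; fix a nonzero solution $u_0$ of $-u_0''+qu_0=iu_0$ that defines a self-adjoint boundary condition, i.e. $\lim_{x\to\infty}[u_0(x)\overline{u_0'(x)}-u_0'(x)\overline{u_0(x)}]=0$,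 and consider the condition $\lim_{x\to\infty}[u_0(x)u'(x)-u_0'(x)u(x)]=0$. Here solutions are functions $u$ with $u,u'$ locally absolutely continuous on $[0,b)$ that satisfy the equation almost everywhere. For $\operatorname{Im} z>0$ let $m(z)=u'(0_+)/u(0_+)$ be the Weyl–Titchmarsh $m$-function, where $u$ is a nonzero solution of $-u''+qu=zu$ on $[0,b)$ that satisfies the condition under consideration. Then there exists a function $A:[0,b)\to\mathbb R$ with $A\in L^1((0,a))$ for all $0<a<b$ such that, for all $0<a<b$ and all $\varepsilon>0$, $$m(-\kappa^2)=-\kappa-\int_0^a A(\alpha)e^{-2\alpha\kappa}\,d\alpha+\tilde O(e^{-2a\kappa})$$ as $|\kappa|\to\infty$ with $-\frac{\pi}{2}+\varepsilon<\arg\kappa<-\varepsilon$. Here $f=\tilde O(g)$ means that $g\to0$ and that $(f/g)|g|^{\delta}\to0$ for every $\delta>0$, as $|\kappa|\to\infty$ in the sector. Moreover, $A-q$ is continuous on $[0,b)$ and, for all $\alpha\in[0,b)$, $$|(A-q)(\alpha)|\le\Big[\int_0^\alpha|q(x)|\,dx\Big]^2\exp\Big(\alpha\int_0^\alpha|q(x)|\,dx\Big).$$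 -/

import Mathlib

open MeasureTheory Filter Topology Set

noncomputable section

namespace HalfLine

/-- The pair `(u, v)`, with `v = u'`, is a (Carathéodory) solution of `-u'' + q u = z u` on `[0, b)`:
both functions are continuous, `u' = v` and `v' = (q - z) u` in integrated form. Thus `u` and `u'`
are locally absolutely continuous on `[0, b)`, and `u (0+) = u 0`, `u' (0+) = v 0`. -/
structure IsSolution (q : ℝ → ℝ) (b : EReal) (z : ℂ) (u v : ℝ → ℂ) : Prop where
  continuousOn_fst : ContinuousOn u {x : ℝ | 0 ≤ x ∧ (x : EReal) < b}
  continuousOn_snd : ContinuousOn v {x : ℝ | 0 ≤ x ∧ (x : EReal) < b}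
  fst_eq : ∀ x : ℝ, 0 ≤ x → (x : EReal) < b → u x = u 0 + ∫ t in (0 : ℝ)..x, v t
  snd_eq : ∀ x : ℝ, 0 ≤ x → (x : EReal) < b →
    v x = v 0 + ∫ t in (0 : ℝ)..x, ((q t : ℂ) - z) * u t

/-- `u` does not vanish identically on `[0, b)`. -/
def IsNonzero (b : EReal) (u : ℝ → ℂ) : Prop :=
  ∃ x : ℝ, 0 ≤ x ∧ (x : EReal) < b ∧ u x ≠ 0

/-- `u` is square integrable near `∞`. -/
def IsL2AtTop (u : ℝ → ℂ) : Prop :=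
  ∃ R : ℝ, 0 ≤ R ∧ IntegrableOn (fun x => ‖u x‖ ^ 2) (Ioi R)

/-- `q` is integrable on every `(0, a)`, `a < ∞`. -/
def IsLocallyL1 (q : ℝ → ℝ) : Prop :=
  ∀ a : ℝ, 0 < a → IntegrableOn q (Ioo 0 a)

/-- `sup_{a > 0} ∫_a^{a+1} max (-q) 0 < ∞`. -/
def IsEssBddBelow (q : ℝ → ℝ) : Prop :=
  ∃ C : ℝ, ∀ a : ℝ, 0 < a → ∫ x in a..(a + 1), max (-q x) 0 ≤ C

/-- Limit point at `∞`: for each `z` in the open upper half-plane there is, up to a multiplicative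
constant, exactly one nonzero solution that is square integrable near `∞`. -/
def IsLimitPoint (q : ℝ → ℝ) : Prop :=
  ∀ z : ℂ, 0 < z.im → ∃ u v : ℝ → ℂ, IsSolution q ⊤ z u v ∧ IsNonzero ⊤ u ∧ IsL2AtTop u ∧
    ∀ u₁ v₁ : ℝ → ℂ, IsSolution q ⊤ z u₁ v₁ → IsL2AtTop u₁ →
      ∃ c : ℂ, ∀ x : ℝ, 0 ≤ x → u₁ x = c * u x

/-- Limit circle at `∞`: for each `z` in the open upper half-plane every solution is square
integrable near `∞`. -/
def IsLimitCircle (q : ℝ → ℝ) : Prop :=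
  ∀ z : ℂ, 0 < z.im → ∀ u v : ℝ → ℂ, IsSolution q ⊤ z u v → IsL2AtTop u

/-- The right endpoint together with the condition imposed there:
* `finite b h`: the endpoint is `b < ∞` and the condition is `u'(b-) + h u(b-) = 0`, where
  `h = ∞` stands for `u(b-) = 0`;
* `squareIntegrable`: the endpoint is `∞` and `u` has to be square integrable near `∞`;
* `limitCircle u₀ v₀`: the endpoint is `∞` and the Wronskian of `u₀` (with derivative `v₀`) and `u`
  has to vanish at `∞`. -/
inductive EndCondition where
  | finite (b : ℝ) (h : OnePoint ℝ)
  | squareIntegrable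
  | limitCircle (u₀ v₀ : ℝ → ℂ)

namespace EndCondition

/-- The right endpoint. -/
def endpoint : EndCondition → EReal
  | finite b _ => (b : EReal)
  | squareIntegrable => ⊤
  | limitCircle _ _ => ⊤

/-- The function `u` with derivative `v` satisfies the condition at the right endpoint. -/
def Holds : EndCondition → (ℝ → ℂ) → (ℝ → ℂ) → Prop
  | finite b (some h), u, v => Tendsto (fun x => v x + (h : ℂ) * u x) (𝓝[<] b) (𝓝 0)
  | finite b none, u, _ => Tendsto u (𝓝[<] b) (𝓝 0)
  | squareIntegrable, u, _ => IsL2AtTop u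
  | limitCircle u₀ v₀, u, v => Tendsto (fun x => u₀ x * v x - v₀ x * u x) atTop (𝓝 0)

/-- The potential `q` and the condition at the right endpoint fit together. In the limit circle case
`u₀` is a nonzero solution for `z = i` that defines a self-adjoint boundary condition, that is,
the Wronskian of `u₀` and its complex conjugate vanishes at `∞`. -/
def Admissible (q : ℝ → ℝ) : EndCondition → Prop
  | finite b _ => 0 < b ∧ IntegrableOn q (Ioo 0 b)
  | squareIntegrable => IsLocallyL1 q ∧ (IsEssBddBelow q ∨ IsLimitPoint q)
  | limitCircle u₀ v₀ => IsLocallyL1 q ∧ IsLimitCircle q ∧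
      IsSolution q ⊤ Complex.I u₀ v₀ ∧ IsNonzero ⊤ u₀ ∧
      Tendsto (fun x => u₀ x * star (v₀ x) - v₀ x * star (u₀ x)) atTop (𝓝 0)

end EndCondition

/-- `p = (u, u')` is a nonzero solution of `-u'' + q u = z u` that satisfies the condition at the
right endpoint. -/
def IsWeylSolution (q : ℝ → ℝ) (e : EndCondition) (z : ℂ) (p : (ℝ → ℂ) × (ℝ → ℂ)) : Prop :=
  IsSolution q e.endpoint z p.1 p.2 ∧ IsNonzero e.endpoint p.1 ∧ e.Holds p.1 p.2

open Classical in
/-- The Weyl-Titchmarsh function `m z = u'(0+) / u(0+)`, for a nonzero solution `u` that satisfies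
the condition at the right endpoint (with the value `0` if there is no such solution). -/
def weylM (q : ℝ → ℝ) (e : EndCondition) (z : ℂ) : ℂ :=
  if h : ∃ p, IsWeylSolution q e z p then h.choose.2 0 / h.choose.1 0 else 0

/-- The filter of `|κ| → ∞` with `-π/2 + ε < arg κ < -ε`. -/
def sectorAtInfinity (ε : ℝ) : Filter ℂ :=
  comap (fun κ : ℂ => ‖κ‖) atTop ⊓ 𝓟 {κ : ℂ | -(Real.pi / 2) + ε < κ.arg ∧ κ.arg < -ε}

/-- `f = Õ(g)` along `l`: `g → 0` and `(f / g) |g| ^ ε → 0` for all `ε > 0`. -/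
def IsOTilde (l : Filter ℂ) (f g : ℂ → ℂ) : Prop :=
  Tendsto g l (𝓝 0) ∧
    ∀ ε : ℝ, 0 < ε → Tendsto (fun κ => f κ / g κ * ((‖g κ‖ ^ ε : ℝ) : ℂ)) l (𝓝 0)

end HalfLine

end

/-! Up to an error of order `exp (-2 a Re κ)` the Weyl function sees `q` only on `[0, a]`, and for
the truncation of `q` to `[0, a]` it is an explicit Laplace transform.

Truncated potential, with `L¹` norm `Q`. Write the decaying solution normalized at `0` as `exp (-κ
x) f x`, so that `f x = 1 - ∫₀^∞ exp (-2 κ s) ∫_s^{x+s} q f dy ds`. The ansatz `f x = 1 + 2 ∫₀^∞ V x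
η exp (-2 κ η) dη` turns this into a Volterra equation for `V` that is free of `κ`. Its Neumann
series has terms bounded by `(Q / 2) (Q |η|)^n / n!`, so `V` grows at most exponentially and the
Laplace transforms converge for `2 Re κ > Q`. The derivative at `0` is `-κ - ∫₀^∞ exp (-2 κ s) q f
ds`, and the convolution theorem makes this `-κ - ∫₀^∞ A α exp (-2 κ α) dα` with `A α = q α + 2 ∫₀^α
q s V s (α - s) ds` (`exists_jost_solution`). Since `V x η` depends only on `q` on `[0, x + η]`
(`kernelTerm_congr`), `A α` depends only on `q` on `[0, α]`. Hence `A` does not depend on where `q`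
is truncated, and truncating at `α` itself gives the bound on `A - q`. Beyond `a` the same bound
controls the tail of the Laplace integral.

General potential. For a Weyl solution `u`, `Im (u' ū)` decreases at the rate `Im z |u|²`, and each
kind of end condition forces it to be nonnegative (`IsWeylSolution.im_nonneg`). In the sector this
yields `|κ u| ≤ L |u' - κ u|`. Inserted into the first order system for `u' ± κ u`, it shows that
`u' + κ u` is bounded by a constant times `u` on `[0, a]`, uniformly for large `κ`
(`IsSolution.norm_add_le_mul`), so `u a` is of order `exp (-a Re κ) u 0`. The Jost solution `ψ`
satisfies `ψ' a = -κ ψ a`. Constancy of the Wronskian on `[0, a]` then gives `u' 0 / u 0 - ψ' 0 = ψ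
a (u' a + κ u a) / u 0`, a product of two factors of order `exp (-a Re κ)` (`norm_div_sub_le`). -/

/-! ### Absolutely continuous functions -/

noncomputable section

namespace HalfLine

/-- `F` is an absolutely continuous function on `[0, X]` with derivative `f`. -/
structure IsPrimitiveOn (F f : ℝ → ℂ) (X : ℝ) : Prop where
  intervalIntegrable : IntervalIntegrable f volume 0 X
  eq_add : ∀ x ∈ Icc 0 X, F x = F 0 + ∫ t in (0 : ℝ)..x, f t

/-- Fubini on a square cut along its diagonal. This is integration by parts when the derivatives are
merely integrable. -/
theorem integral_mul_primitive_add {f g : ℝ → ℂ} {X : ℝ} (hX : 0 ≤ X)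
    (hf : IntervalIntegrable f volume 0 X) (hg : IntervalIntegrable g volume 0 X) :
    (∫ t in (0 : ℝ)..X, f t * ∫ s in (0 : ℝ)..t, g s) +
      (∫ t in (0 : ℝ)..X, (∫ s in (0 : ℝ)..t, f s) * g t) =
      (∫ t in (0 : ℝ)..X, f t) * ∫ t in (0 : ℝ)..X, g t := by
  rw [intervalIntegrable_iff_integrableOn_Ioc_of_le hX] at hf hg
  set μ := volume.restrict (Ioc 0 X) with hμ
  have hf : Integrable f μ := hf
  have hg : Integrable g μ := hg
  have key : ∀ h : ℝ → ℂ, ∀ t ∈ Ioc 0 X,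
      ∫ s in (0 : ℝ)..t, h s = ∫ s, (Iic t).indicator h s ∂μ := by
    intro h t ht
    rw [intervalIntegral.integral_of_le ht.1.le, integral_indicator measurableSet_Iic, hμ,
      Measure.restrict_restrict measurableSet_Iic]
    congr 2
    ext s; simp only [mem_Ioc, mem_inter_iff, mem_Iic]
    constructor
    · rintro ⟨h1, h2⟩; exact ⟨h2, h1, h2.trans ht.2⟩
    · rintro ⟨h1, h2, _⟩; exact ⟨h2, h1⟩
  -- The open half-line makes the second triangle exactly the complement of the first; the endpoint
  -- is a null set.
  have key' : ∀ h : ℝ → ℂ, ∀ t ∈ Ioc 0 X,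
      ∫ s in (0 : ℝ)..t, h s = ∫ s, (Iio t).indicator h s ∂μ := by
    intro h t ht
    rw [intervalIntegral.integral_of_le ht.1.le, integral_indicator measurableSet_Iio, hμ,
      Measure.restrict_restrict measurableSet_Iio, integral_Ioc_eq_integral_Ioo]
    congr 2
    ext s; simp only [mem_Ioo, mem_inter_iff, mem_Iio, mem_Ioc]
    constructor
    · rintro ⟨h1, h2⟩; exact ⟨h2, h1, (h2.trans_le ht.2).le⟩
    · rintro ⟨h1, h2, _⟩; exact ⟨h2, h1⟩
  let S : Set (ℝ × ℝ) := {p | p.2 ≤ p.1}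
  have hS : MeasurableSet S := measurableSet_le measurable_snd measurable_fst
  let h : ℝ × ℝ → ℂ := fun p => f p.1 * g p.2
  have hh : Integrable h (μ.prod μ) := hf.mul_prod hg
  have h1 : (∫ t in (0 : ℝ)..X, f t * ∫ s in (0 : ℝ)..t, g s) =
      ∫ p, S.indicator h p ∂(μ.prod μ) := by
    rw [integral_prod _ (hh.indicator hS), intervalIntegral.integral_of_le hX]
    refine setIntegral_congr_fun measurableSet_Ioc fun t ht => ?_
    rw [key g t ht, ← integral_const_mul]
    refine integral_congr_ae (Eventually.of_forall fun s => ?_)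
    by_cases hs : s ≤ t <;> simp [indicator, S, h, hs]
  have h2 : (∫ t in (0 : ℝ)..X, (∫ s in (0 : ℝ)..t, f s) * g t) =
      ∫ p, Sᶜ.indicator h p ∂(μ.prod μ) := by
    rw [integral_prod_symm _ (hh.indicator hS.compl), intervalIntegral.integral_of_le hX]
    refine setIntegral_congr_fun measurableSet_Ioc fun t ht => ?_
    rw [key' f t ht, ← integral_mul_const]
    refine integral_congr_ae (Eventually.of_forall fun s => ?_)
    by_cases hs : s < t
    · simp [indicator, S, h, hs, not_le.mpr hs]
    · simp [indicator, S, h, hs, not_lt.mp hs]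
  rw [h1, h2, ← integral_add (hh.indicator hS) (hh.indicator hS.compl),
    intervalIntegral.integral_of_le hX, intervalIntegral.integral_of_le hX,
    ← integral_prod_mul]
  exact integral_congr_ae (Eventually.of_forall fun p => congrFun (indicator_self_add_compl S h) p)

namespace IsPrimitiveOn

variable {F G f g : ℝ → ℂ} {X Y : ℝ}

theorem mono (h : IsPrimitiveOn F f X) (hY : 0 ≤ Y) (hYX : Y ≤ X) : IsPrimitiveOn F f Y where
  intervalIntegrable := h.intervalIntegrable.mono_set (by
    rw [uIcc_of_le hY, uIcc_of_le (hY.trans hYX)]; exact Icc_subset_Icc_right hYX)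
  eq_add x hx := h.eq_add x ⟨hx.1, hx.2.trans hYX⟩

theorem continuousOn (h : IsPrimitiveOn F f X) : ContinuousOn F (Icc 0 X) := by
  by_cases hX : 0 ≤ X
  · have h1 := intervalIntegral.continuousOn_primitive_interval (μ := volume) (f := f) (a := 0)
      (b := X) (by
        rw [uIcc_of_le hX, integrableOn_Icc_iff_integrableOn_Ioc]
        exact (intervalIntegrable_iff_integrableOn_Ioc_of_le hX).1 h.intervalIntegrable)
    rw [uIcc_of_le hX] at h1
    exact (continuousOn_const.add h1).congr h.eq_add
  · rw [Icc_eq_empty hX]; exact continuousOn_empty _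

theorem intervalIntegrable_of_mem (h : IsPrimitiveOn F f X) {x y : ℝ} (hx : x ∈ Icc 0 X)
    (hy : y ∈ Icc 0 X) : IntervalIntegrable f volume x y :=
  h.intervalIntegrable.mono_set (by
    rw [uIcc_of_le (hx.1.trans hx.2)]
    exact (ordConnected_Icc.uIcc_subset hx hy))

theorem sub_eq (h : IsPrimitiveOn F f X) {x y : ℝ} (hx : x ∈ Icc 0 X) (hy : y ∈ Icc 0 X) :
    F y - F x = ∫ t in x..y, f t := by
  have h0 : (0 : ℝ) ∈ Icc 0 X := ⟨le_rfl, hx.1.trans hx.2⟩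
  rw [h.eq_add y hy, h.eq_add x hx, ← intervalIntegral.integral_add_adjacent_intervals
    (h.intervalIntegrable_of_mem h0 hx) (h.intervalIntegrable_of_mem hx hy)]
  ring

theorem congr_right (h : IsPrimitiveOn F f X) (hX : 0 ≤ X) (hfg : ∀ x ∈ Icc 0 X, f x = g x) :
    IsPrimitiveOn F g X := by
  refine ⟨h.intervalIntegrable.congr fun x hx => ?_, fun x hx => ?_⟩
  · rw [uIoc_of_le hX] at hx
    exact hfg x ⟨hx.1.le, hx.2⟩
  · rw [h.eq_add x hx]
    congr 1
    refine intervalIntegral.integral_congr fun t ht => hfg t ?_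
    rw [uIcc_of_le hx.1] at ht
    exact ⟨ht.1, ht.2.trans hx.2⟩

theorem mul (hF : IsPrimitiveOn F f X) (hG : IsPrimitiveOn G g X) (hX : 0 ≤ X) :
    IsPrimitiveOn (fun x => F x * G x) (fun x => f x * G x + F x * g x) X := by
  have hFc := hF.continuousOn
  have hGc := hG.continuousOn
  have i1 : IntervalIntegrable (fun x => f x * G x) volume 0 X :=
    hF.intervalIntegrable.mul_continuousOn (by rwa [uIcc_of_le hX])
  have i2 : IntervalIntegrable (fun x => F x * g x) volume 0 X :=
    hG.intervalIntegrable.continuousOn_mul (by rwa [uIcc_of_le hX])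
  refine ⟨i1.add i2, fun x hx => ?_⟩
  have hF' := hF.mono hx.1 hx.2
  have hG' := hG.mono hx.1 hx.2
  have key := integral_mul_primitive_add hx.1 hF'.intervalIntegrable hG'.intervalIntegrable
  have hs : uIcc 0 x ⊆ uIcc 0 X := by
    rw [uIcc_of_le hX, uIcc_of_le hx.1]; exact Icc_subset_Icc_right hx.2
  rw [intervalIntegral.integral_add (i1.mono_set hs) (i2.mono_set hs)]
  have e1 : ∫ t in (0 : ℝ)..x, f t * G t =
      (∫ t in (0 : ℝ)..x, f t) * G 0 + ∫ t in (0 : ℝ)..x, f t * ∫ s in (0 : ℝ)..t, g s := by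
    rw [← intervalIntegral.integral_mul_const, ← intervalIntegral.integral_add]
    · refine intervalIntegral.integral_congr fun t ht => ?_
      rw [uIcc_of_le hx.1] at ht
      rw [hG'.eq_add t ht]; ring
    · exact hF'.intervalIntegrable.mul_const _
    · have : ∀ t ∈ Icc 0 x, f t * (G t - G 0) = f t * ∫ s in (0 : ℝ)..t, g s := fun t ht => by
        rw [hG'.eq_add t ht]; ring
      refine (hF'.intervalIntegrable.mul_continuousOn (g := fun t => G t - G 0) ?_).congr ?_
      · rw [uIcc_of_le hx.1]; exact hG'.continuousOn.sub continuousOn_const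
      · intro t ht; rw [uIoc_of_le hx.1] at ht; exact this t ⟨ht.1.le, ht.2⟩
  have e2 : ∫ t in (0 : ℝ)..x, F t * g t =
      F 0 * (∫ t in (0 : ℝ)..x, g t) + ∫ t in (0 : ℝ)..x, (∫ s in (0 : ℝ)..t, f s) * g t := by
    rw [← intervalIntegral.integral_const_mul, ← intervalIntegral.integral_add]
    · refine intervalIntegral.integral_congr fun t ht => ?_
      rw [uIcc_of_le hx.1] at ht
      rw [hF'.eq_add t ht]; ring
    · exact hG'.intervalIntegrable.const_mul _
    · have : ∀ t ∈ Icc 0 x, (F t - F 0) * g t = (∫ s in (0 : ℝ)..t, f s) * g t := fun t ht => by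
        rw [hF'.eq_add t ht]; ring
      refine (hG'.intervalIntegrable.continuousOn_mul (g := fun t => F t - F 0) ?_).congr ?_
      · rw [uIcc_of_le hx.1]; exact hF'.continuousOn.sub continuousOn_const
      · intro t ht; rw [uIoc_of_le hx.1] at ht; exact this t ⟨ht.1.le, ht.2⟩
  rw [e1, e2, hF.eq_add x hx, hG.eq_add x hx]
  linear_combination -key

theorem add (hF : IsPrimitiveOn F f X) (hG : IsPrimitiveOn G g X) :
    IsPrimitiveOn (fun x => F x + G x) (fun x => f x + g x) X := by
  refine ⟨hF.intervalIntegrable.add hG.intervalIntegrable, fun x hx => ?_⟩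
  rw [intervalIntegral.integral_add (hF.mono hx.1 hx.2).intervalIntegrable
    (hG.mono hx.1 hx.2).intervalIntegrable, hF.eq_add x hx, hG.eq_add x hx]
  ring

theorem const_mul (c : ℂ) (hF : IsPrimitiveOn F f X) :
    IsPrimitiveOn (fun x => c * F x) (fun x => c * f x) X := by
  refine ⟨hF.intervalIntegrable.const_mul c, fun x hx => ?_⟩
  rw [intervalIntegral.integral_const_mul, hF.eq_add x hx]
  ring

theorem sub (hF : IsPrimitiveOn F f X) (hG : IsPrimitiveOn G g X) :
    IsPrimitiveOn (fun x => F x - G x) (fun x => f x - g x) X := by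
  have := hF.add (hG.const_mul (-1))
  simpa only [neg_one_mul, ← sub_eq_add_neg] using this

theorem of_hasDerivAt (h : ∀ x, HasDerivAt F (f x) x) (hf : Continuous f) :
    IsPrimitiveOn F f X := by
  refine ⟨hf.intervalIntegrable _ _, fun x _ => ?_⟩
  rw [intervalIntegral.integral_eq_sub_of_hasDerivAt (fun t _ => h t) (hf.intervalIntegrable _ _)]
  ring

theorem exp_mul (hF : IsPrimitiveOn F f X) (hX : 0 ≤ X) (c : ℂ) :
    IsPrimitiveOn (fun x => Complex.exp (c * x) * F x)
      (fun x => Complex.exp (c * x) * (c * F x + f x)) X := by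
  have h : IsPrimitiveOn (fun x : ℝ => Complex.exp (c * x)) (fun x => Complex.exp (c * x) * c) X := by
    refine of_hasDerivAt (fun x => ?_) (by fun_prop)
    have := ((Complex.ofRealCLM.hasDerivAt (x := x)).const_mul c).cexp
    simpa using this
  refine (h.mul hF hX).congr_right hX fun x _ => ?_
  ring

end IsPrimitiveOn
end HalfLine

end

/-! ### Existence of solutions -/

noncomputable section

namespace HalfLine

section Picard

variable {q : ℝ → ℝ}

/-- The terms of the Picard series for the initial value problem at `0`. -/
def picard (q : ℝ → ℝ) (z : ℂ) (w : ℂ × ℂ) : ℕ → ℝ → ℂ × ℂ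
  | 0 => fun _ => w
  | n + 1 => fun x => (∫ t in (0 : ℝ)..x, (picard q z w n t).2,
      ∫ t in (0 : ℝ)..x, ((q t : ℂ) - z) * (picard q z w n t).1)

theorem intervalIntegrable_ofReal {p : ℝ → ℝ} {x y : ℝ} (hp : IntervalIntegrable p volume x y) :
    IntervalIntegrable (fun t => (p t : ℂ)) volume x y :=
  ⟨hp.1.ofReal, hp.2.ofReal⟩

theorem intervalIntegrable_ofReal_sub (hq : ∀ x y, IntervalIntegrable q volume x y) (z : ℂ)
    (x y : ℝ) : IntervalIntegrable (fun t => (q t : ℂ) - z) volume x y :=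
  (intervalIntegrable_ofReal (hq x y)).sub intervalIntegrable_const

theorem continuous_picard (hq : ∀ x y, IntervalIntegrable q volume x y) (z : ℂ) (w : ℂ × ℂ)
    (n : ℕ) : Continuous (picard q z w n) := by
  induction n with
  | zero => exact continuous_const
  | succ n ih =>
    refine Continuous.prodMk ?_ ?_
    · exact intervalIntegral.continuous_primitive
        (fun a b => (continuous_snd.comp ih).intervalIntegrable a b) 0
    · exact intervalIntegral.continuous_primitive
        (fun a b => (intervalIntegrable_ofReal_sub hq z a b).mul_continuousOn
          (continuous_fst.comp ih).continuousOn) 0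

/-- The power rule for a primitive of an integrable function, by induction from the product rule. It
produces the factorials in the Picard series. -/
theorem integral_mul_primitive_pow {p : ℝ → ℝ} (hp : ∀ x y, IntervalIntegrable p volume x y)
    (n : ℕ) {x : ℝ} (hx : 0 ≤ x) :
    ∫ t in (0 : ℝ)..x, p t * (∫ s in (0 : ℝ)..t, p s) ^ n =
      (∫ s in (0 : ℝ)..x, p s) ^ (n + 1) / (n + 1) := by
  have h1 : IsPrimitiveOn (fun x => ((∫ s in (0 : ℝ)..x, p s : ℝ) : ℂ)) (fun x => (p x : ℂ)) x := by
    refine ⟨intervalIntegrable_ofReal (hp 0 x), fun y _ => ?_⟩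
    simp [intervalIntegral.integral_ofReal]
  have h2 : ∀ n : ℕ, IsPrimitiveOn (fun x => ((∫ s in (0 : ℝ)..x, p s : ℝ) : ℂ) ^ (n + 1))
      (fun x => (n + 1) * (p x * ((∫ s in (0 : ℝ)..x, p s : ℝ) : ℂ) ^ n)) x := by
    intro n
    induction n with
    | zero => simpa using h1
    | succ n ih =>
      have := (ih.mul h1 hx).congr_right (g := fun x => ((n + 1 : ℕ) + 1) *
        (p x * ((∫ s in (0 : ℝ)..x, p s : ℝ) : ℂ) ^ (n + 1))) hx (fun y _ => by push_cast; ring)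
      simpa only [pow_succ] using this
  have h3 := (h2 n).eq_add x ⟨hx, le_rfl⟩
  rw [intervalIntegral.integral_const_mul] at h3
  have hn : (n + 1 : ℝ) ≠ 0 := by positivity
  rw [eq_div_iff hn]
  have h4 : ((∫ t in (0 : ℝ)..x, p t * (∫ s in (0 : ℝ)..t, p s) ^ n : ℝ) : ℂ) =
      ∫ t in (0 : ℝ)..x, (p t * ((∫ s in (0 : ℝ)..t, p s : ℝ) : ℂ) ^ n) := by
    rw [← intervalIntegral.integral_ofReal]; push_cast; rfl
  rw [← h4] at h3
  simp only [intervalIntegral.integral_same] at h3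
  have h5 : (((∫ s in (0 : ℝ)..x, p s) ^ (n + 1) : ℝ) : ℂ) = (((n + 1) *
      ∫ t in (0 : ℝ)..x, p t * (∫ s in (0 : ℝ)..t, p s) ^ n : ℝ) : ℂ) := by
    push_cast at h3 ⊢; rw [h3]; simp
  rw [Complex.ofReal_inj] at h5
  rw [h5]; ring

/-- In the sup norm on pairs, the single weight `1 + |q - z|` dominates the coefficients `1` and `q
- z` of both components. -/
theorem norm_picard_le (hq : ∀ x y, IntervalIntegrable q volume x y) (z : ℂ) (w : ℂ × ℂ)
    (n : ℕ) {x : ℝ} (hx : 0 ≤ x) :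
    ‖picard q z w n x‖ ≤ ‖w‖ * ((∫ t in (0 : ℝ)..x, (1 + ‖(q t : ℂ) - z‖)) ^ n / n.factorial) := by
  have hp : ∀ x y, IntervalIntegrable (fun t => 1 + ‖(q t : ℂ) - z‖) volume x y := fun x y =>
    intervalIntegrable_const.add (intervalIntegrable_ofReal_sub hq z x y).norm
  induction n generalizing x with
  | zero => simp [picard]
  | succ n ih =>
    have hc := continuous_picard hq z w n
    have hPc := intervalIntegral.continuous_primitive (μ := volume) hp 0
    have key : ∀ g : ℝ → ℂ, (∀ t, ‖g t‖ ≤ (1 + ‖(q t : ℂ) - z‖) * ‖picard q z w n t‖) →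
        ‖∫ t in (0 : ℝ)..x, g t‖ ≤
        ‖w‖ * ((∫ t in (0 : ℝ)..x, (1 + ‖(q t : ℂ) - z‖)) ^ (n + 1) / (n + 1).factorial) := by
      intro g hg
      calc ‖∫ t in (0 : ℝ)..x, g t‖ ≤ ∫ t in (0 : ℝ)..x, (1 + ‖(q t : ℂ) - z‖) *
          (‖w‖ * ((∫ s in (0 : ℝ)..t, (1 + ‖(q s : ℂ) - z‖)) ^ n / n.factorial)) := by
            refine intervalIntegral.norm_integral_le_of_norm_le hx (ae_of_all _ fun t ht => ?_) ?_
            · exact (hg t).trans (by gcongr; exact ih ht.1.le)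
            · exact (hp 0 x).mul_continuousOn (by fun_prop)
        _ = ‖w‖ / n.factorial * ∫ t in (0 : ℝ)..x, (1 + ‖(q t : ℂ) - z‖) *
          (∫ s in (0 : ℝ)..t, (1 + ‖(q s : ℂ) - z‖)) ^ n := by
            rw [← intervalIntegral.integral_const_mul]
            congr 1; ext t; ring
        _ = _ := by
            rw [integral_mul_primitive_pow hp n hx, Nat.factorial_succ]
            push_cast
            field_simp
    rw [Prod.norm_def]
    refine max_le (key _ fun t => ?_) (key _ fun t => ?_)
    · refine (norm_snd_le _).trans ?_
      have := norm_nonneg ((q t : ℂ) - z)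
      have := norm_nonneg (picard q z w n t)
      nlinarith
    · rw [norm_mul]
      gcongr
      · linarith
      · exact norm_fst_le _

theorem exists_isSolution_top (hq : ∀ x y, IntervalIntegrable q volume x y) (z : ℂ) (w : ℂ × ℂ) :
    ∃ u v : ℝ → ℂ, IsSolution q ⊤ z u v ∧ u 0 = w.1 ∧ v 0 = w.2 := by
  have hp : ∀ x y, IntervalIntegrable (fun t => 1 + ‖(q t : ℂ) - z‖) volume x y := fun x y =>
    intervalIntegrable_const.add (intervalIntegrable_ofReal_sub hq z x y).norm
  let c : ℝ → ℕ → ℝ := fun X n =>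
    ‖w‖ * ((∫ t in (0 : ℝ)..X, (1 + ‖(q t : ℂ) - z‖)) ^ n / n.factorial)
  have hc : ∀ X, Summable (c X) := fun X => (Real.summable_pow_div_factorial _).mul_left _
  have hb : ∀ X, ∀ x ∈ Icc 0 X, ∀ n, ‖picard q z w n x‖ ≤ c X n := by
    intro X x hx n
    refine (norm_picard_le hq z w n hx.1).trans ?_
    have h0 : 0 ≤ ∫ t in (0 : ℝ)..x, (1 + ‖(q t : ℂ) - z‖) :=
      intervalIntegral.integral_nonneg hx.1 fun t _ => by positivity
    have : ∫ t in (0 : ℝ)..x, (1 + ‖(q t : ℂ) - z‖) ≤ ∫ t in (0 : ℝ)..X, (1 + ‖(q t : ℂ) - z‖) :=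
      intervalIntegral.integral_mono_interval le_rfl hx.1 hx.2
        (ae_of_all _ fun t => by positivity) (hp 0 X)
    simp only [c]
    gcongr
  have hcont := continuous_picard hq z w
  obtain ⟨U, hUdef⟩ : ∃ U : ℝ → ℂ × ℂ, U = fun x => ∑' n, picard q z w n x := ⟨_, rfl⟩
  have hsum : ∀ x, 0 ≤ x → HasSum (fun n => picard q z w n x) (U x) := fun x hx => by
    rw [hUdef]
    exact (Summable.of_norm_bounded (hc x) (hb x x ⟨hx, le_rfl⟩)).hasSum
  have hUc : ∀ X, ContinuousOn U (Icc 0 X) := fun X => by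
    rw [hUdef]
    exact continuousOn_tsum (fun n => (hcont n).continuousOn) (hc X) (fun n x hx => hb X x hx n)
  have hUc' : ContinuousOn U {x : ℝ | 0 ≤ x ∧ (x : EReal) < ⊤} := by
    intro x hx
    refine ((hUc (x + 1)) x ⟨hx.1, by linarith⟩).mono_of_mem_nhdsWithin ?_
    have h2 : Iio (x + 1) ∈ 𝓝[{x : ℝ | 0 ≤ x ∧ (x : EReal) < ⊤}] x :=
      mem_nhdsWithin_of_mem_nhds (Iio_mem_nhds (by linarith))
    filter_upwards [h2, self_mem_nhdsWithin] with y hy hy'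
    exact ⟨hy'.1, le_of_lt hy⟩
  have hstep : ∀ x, 0 ≤ x → HasSum (fun n => picard q z w (n + 1) x)
      (∫ t in (0 : ℝ)..x, (U t).2, ∫ t in (0 : ℝ)..x, ((q t : ℂ) - z) * (U t).1) := by
    intro x hx
    refine HasSum.prodMk ?_ ?_
    · refine intervalIntegral.hasSum_integral_of_dominated_convergence (fun n _ => c x n) ?_ ?_ ?_ ?_ ?_
      · exact fun n => (continuous_snd.comp (hcont n)).aestronglyMeasurable
      · refine fun n => ae_of_all _ fun t ht => ?_
        rw [uIoc_of_le hx] at ht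
        exact (norm_snd_le _).trans (hb x t ⟨ht.1.le, ht.2⟩ n)
      · exact ae_of_all _ fun t _ => hc x
      · exact intervalIntegrable_const
      · refine ae_of_all _ fun t ht => ?_
        rw [uIoc_of_le hx] at ht
        exact (ContinuousLinearMap.snd ℂ ℂ ℂ).hasSum (hsum t ht.1.le)
    · refine intervalIntegral.hasSum_integral_of_dominated_convergence
        (fun n t => ‖(q t : ℂ) - z‖ * c x n) ?_ ?_ ?_ ?_ ?_
      · exact fun n => ((intervalIntegrable_ofReal_sub hq z 0 x).mul_continuousOn
          (continuous_fst.comp (hcont n)).continuousOn).aestronglyMeasurable_restrict_uIoc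
      · refine fun n => ae_of_all _ fun t ht => ?_
        rw [uIoc_of_le hx] at ht
        rw [norm_mul]
        gcongr
        exact (norm_fst_le _).trans (hb x t ⟨ht.1.le, ht.2⟩ n)
      · exact ae_of_all _ fun t _ => (hc x).mul_left _
      · simp_rw [tsum_mul_left]
        exact (intervalIntegrable_ofReal_sub hq z 0 x).norm.mul_const _
      · refine ae_of_all _ fun t ht => ?_
        rw [uIoc_of_le hx] at ht
        exact ((ContinuousLinearMap.fst ℂ ℂ ℂ).hasSum (hsum t ht.1.le)).mul_left _
  have hU : ∀ x, 0 ≤ x → U x = w +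
      (∫ t in (0 : ℝ)..x, (U t).2, ∫ t in (0 : ℝ)..x, ((q t : ℂ) - z) * (U t).1) := by
    intro x hx
    exact (hsum x hx).unique (HasSum.zero_add (f := fun n => picard q z w n x) (hstep x hx))
  have hU0 : U 0 = w := by rw [hU 0 le_rfl]; simp
  refine ⟨fun x => (U x).1, fun x => (U x).2, ⟨continuous_fst.comp_continuousOn hUc',
    continuous_snd.comp_continuousOn hUc', fun x hx _ => ?_, fun x hx _ => ?_⟩, congrArg Prod.fst hU0,
    congrArg Prod.snd hU0⟩
  · rw [hU0, hU x hx]; rfl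
  · rw [hU0, hU x hx]; rfl

end Picard
end HalfLine

end

/-! ### Wronskians and uniqueness -/

noncomputable section

namespace HalfLine

/-- `q` is integrable on every bounded interval in `(0, b)` that starts at `0`. -/
def IsIntegrableUpTo (q : ℝ → ℝ) (b : EReal) : Prop :=
  ∀ X : ℝ, IntegrableOn q {x : ℝ | 0 < x ∧ x < X ∧ (x : EReal) < b}

variable {q : ℝ → ℝ} {b : EReal} {z : ℂ} {u v : ℝ → ℂ}

theorem IsIntegrableUpTo.intervalIntegrable (hq : IsIntegrableUpTo q b) {X : ℝ} (hX : 0 ≤ X)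
    (hXb : (X : EReal) < b) : IntervalIntegrable q volume 0 X := by
  rw [intervalIntegrable_iff_integrableOn_Ioc_of_le hX]
  refine (hq (X + 1)).mono_set fun x hx => ⟨hx.1, by linarith [hx.2], lt_of_le_of_lt ?_ hXb⟩
  exact_mod_cast hx.2

/-- Extension by zero makes the initial value problem global, so that solutions on `[0, b)` continue
past a finite `b` and have limits there. -/
theorem IsIntegrableUpTo.intervalIntegrable_indicator (hq : IsIntegrableUpTo q b) (x y : ℝ) :
    IntervalIntegrable ({x : ℝ | 0 < x ∧ (x : EReal) < b}.indicator q) volume x y := by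
  have hm : MeasurableSet {x : ℝ | 0 < x ∧ (x : EReal) < b} :=
    (measurableSet_lt measurable_const measurable_id).inter
      (measurableSet_lt measurable_coe_real_ereal measurable_const)
  rw [intervalIntegrable_iff, integrableOn_indicator_iff hm]
  refine (hq (max x y + 1)).mono_set fun t ht => ⟨ht.1.1, ?_, ht.1.2⟩
  have : t ≤ max x y := ht.2.2
  linarith

namespace IsSolution

theorem primitive_fst (h : IsSolution q b z u v) {X : ℝ} (hX : 0 ≤ X) (hXb : (X : EReal) < b) :
    IsPrimitiveOn u v X := by
  have hlt : ∀ x : ℝ, x ≤ X → (x : EReal) < b := fun x hx =>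
    lt_of_le_of_lt (by exact_mod_cast hx) hXb
  refine ⟨ContinuousOn.intervalIntegrable ?_, fun x hx => h.fst_eq x hx.1 (hlt x hx.2)⟩
  rw [uIcc_of_le hX]
  exact h.continuousOn_snd.mono fun x hx => ⟨hx.1, hlt x hx.2⟩

theorem primitive_snd (h : IsSolution q b z u v) (hq : IsIntegrableUpTo q b) {X : ℝ} (hX : 0 ≤ X)
    (hXb : (X : EReal) < b) : IsPrimitiveOn v (fun t => ((q t : ℂ) - z) * u t) X := by
  have hlt : ∀ x : ℝ, x ≤ X → (x : EReal) < b := fun x hx =>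
    lt_of_le_of_lt (by exact_mod_cast hx) hXb
  refine ⟨IntervalIntegrable.mul_continuousOn ?_ ?_, fun x hx => h.snd_eq x hx.1 (hlt x hx.2)⟩
  · exact (intervalIntegrable_ofReal (hq.intervalIntegrable hX hXb)).sub intervalIntegrable_const
  · rw [uIcc_of_le hX]
    exact h.continuousOn_fst.mono fun x hx => ⟨hx.1, hlt x hx.2⟩

theorem hasDerivAt (h : IsSolution q b z u v) {x : ℝ} (hx : 0 < x) (hxb : (x : EReal) < b) :
    HasDerivAt u (v x) x := by
  obtain ⟨X, hxX, hXb⟩ := EReal.lt_iff_exists_real_btwn.1 hxb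
  have hxX : x < X := by exact_mod_cast hxX
  have hv : ContinuousOn v (Icc 0 X) := h.continuousOn_snd.mono fun y hy =>
    ⟨hy.1, lt_of_le_of_lt (by exact_mod_cast hy.2) hXb⟩
  have hp := h.primitive_fst (hx.le.trans hxX.le) hXb
  have hmem : Icc 0 X ∈ 𝓝 x := Icc_mem_nhds hx hxX
  have h1 : HasDerivAt (fun y => u 0 + ∫ t in (0 : ℝ)..y, v t) (v x) x := by
    refine HasDerivAt.const_add _ (intervalIntegral.integral_hasDerivAt_right ?_ ?_ ?_)
    · exact (hp.mono hx.le hxX.le).intervalIntegrable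
    · exact (hv.mono Ioo_subset_Icc_self).stronglyMeasurableAtFilter isOpen_Ioo x ⟨hx, hxX⟩
    · exact hv.continuousAt hmem
  refine h1.congr_of_eventuallyEq ?_
  filter_upwards [hmem] with y hy using hp.eq_add y hy

/-- The Wronskian of two solutions. -/
theorem wronskian (hq : IsIntegrableUpTo q b) {z₁ z₂ : ℂ} {u₁ v₁ u₂ v₂ : ℝ → ℂ}
    (h₁ : IsSolution q b z₁ u₁ v₁) (h₂ : IsSolution q b z₂ u₂ v₂) {X : ℝ} (hX : 0 ≤ X)
    (hXb : (X : EReal) < b) :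
    IsPrimitiveOn (fun x => u₁ x * v₂ x - v₁ x * u₂ x) (fun x => (z₁ - z₂) * (u₁ x * u₂ x)) X := by
  refine (((h₁.primitive_fst hX hXb).mul (h₂.primitive_snd hq hX hXb) hX).sub
    ((h₁.primitive_snd hq hX hXb).mul (h₂.primitive_fst hX hXb) hX)).congr_right hX fun x _ => ?_
  ring

theorem wronskian_eq (hq : IsIntegrableUpTo q b) {u₁ v₁ u₂ v₂ : ℝ → ℂ}
    (h₁ : IsSolution q b z u₁ v₁) (h₂ : IsSolution q b z u₂ v₂) {x : ℝ} (hx : 0 ≤ x)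
    (hxb : (x : EReal) < b) :
    u₁ x * v₂ x - v₁ x * u₂ x = u₁ 0 * v₂ 0 - v₁ 0 * u₂ 0 := by
  rw [(wronskian hq h₁ h₂ hx hxb).eq_add x ⟨hx, le_rfl⟩]
  simp

theorem conj (h : IsSolution q b z u v) : IsSolution q b (starRingEnd ℂ z)
    (fun x => starRingEnd ℂ (u x)) (fun x => starRingEnd ℂ (v x)) where
  continuousOn_fst := Complex.continuous_conj.comp_continuousOn h.continuousOn_fst
  continuousOn_snd := Complex.continuous_conj.comp_continuousOn h.continuousOn_snd
  fst_eq x hx hxb := by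
    rw [h.fst_eq x hx hxb, map_add, intervalIntegral.integral_of_le hx,
      intervalIntegral.integral_of_le hx, ← integral_conj]
  snd_eq x hx hxb := by
    rw [h.snd_eq x hx hxb, map_add, intervalIntegral.integral_of_le hx,
      intervalIntegral.integral_of_le hx, ← integral_conj]
    simp

theorem lincomb (hq : IsIntegrableUpTo q b) {u₁ v₁ u₂ v₂ : ℝ → ℂ} (h₁ : IsSolution q b z u₁ v₁)
    (h₂ : IsSolution q b z u₂ v₂) (c d : ℂ) :
    IsSolution q b z (fun x => c * u₁ x + d * u₂ x) (fun x => c * v₁ x + d * v₂ x) where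
  continuousOn_fst := (h₁.continuousOn_fst.const_smul c).add (h₂.continuousOn_fst.const_smul d)
  continuousOn_snd := (h₁.continuousOn_snd.const_smul c).add (h₂.continuousOn_snd.const_smul d)
  fst_eq x hx hxb := (((h₁.primitive_fst hx hxb).const_mul c).add
    ((h₂.primitive_fst hx hxb).const_mul d)).eq_add x ⟨hx, le_rfl⟩
  snd_eq x hx hxb := by
    refine ((((h₁.primitive_snd hq hx hxb).const_mul c).add
      ((h₂.primitive_snd hq hx hxb).const_mul d)).congr_right hx fun t _ => ?_).eq_add x ⟨hx, le_rfl⟩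
    ring

/-- The imaginary part of `u' ū` decreases at the rate `Im z |u|²`. -/
theorem im_sub (h : IsSolution q b z u v) (hq : IsIntegrableUpTo q b) {x y : ℝ} (hx : 0 ≤ x)
    (hxy : x ≤ y) (hyb : (y : EReal) < b) :
    (v x * starRingEnd ℂ (u x)).im - (v y * starRingEnd ℂ (u y)).im =
      z.im * ∫ t in x..y, ‖u t‖ ^ 2 := by
  have h1 := (wronskian hq h h.conj (hx.trans hxy) hyb).sub_eq ⟨hx, hxy⟩ ⟨hx.trans hxy, le_rfl⟩
  have h2 : ∀ t, (z - starRingEnd ℂ z) * (u t * starRingEnd ℂ (u t)) =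
      ((2 * z.im * ‖u t‖ ^ 2 : ℝ) : ℂ) * Complex.I := by
    intro t
    rw [Complex.mul_conj, Complex.sub_conj, Complex.normSq_eq_norm_sq]
    push_cast; ring
  simp_rw [h2] at h1
  rw [intervalIntegral.integral_mul_const, intervalIntegral.integral_ofReal,
    intervalIntegral.integral_const_mul] at h1
  have h3 := congrArg Complex.im h1
  simp only [Complex.sub_im, Complex.mul_im, Complex.conj_re, Complex.conj_im, Complex.ofReal_re,
    Complex.ofReal_im, Complex.I_re, Complex.I_im, mul_one, mul_zero] at h3 ⊢
  linarith

/-- Every initial value problem at `0` has a solution that is continuous up to the endpoint. -/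
theorem _root_.HalfLine.exists_isSolution (hq : IsIntegrableUpTo q b) (z : ℂ) (w : ℂ × ℂ) :
    ∃ u v : ℝ → ℂ, IsSolution q b z u v ∧ ContinuousOn u (Ici 0) ∧ ContinuousOn v (Ici 0) ∧
      u 0 = w.1 ∧ v 0 = w.2 := by
  obtain ⟨u, v, h, hu, hv⟩ := exists_isSolution_top hq.intervalIntegrable_indicator z w
  have huc : ContinuousOn u (Ici 0) := h.continuousOn_fst.mono fun x hx => ⟨hx, EReal.coe_lt_top x⟩
  have hvc : ContinuousOn v (Ici 0) := h.continuousOn_snd.mono fun x hx => ⟨hx, EReal.coe_lt_top x⟩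
  refine ⟨u, v, ⟨huc.mono fun x hx => hx.1, hvc.mono fun x hx => hx.1,
    fun x hx _ => h.fst_eq x hx (EReal.coe_lt_top x), fun x hx hxb => ?_⟩, huc, hvc, hu, hv⟩
  rw [h.snd_eq x hx (EReal.coe_lt_top x)]
  congr 1
  rw [intervalIntegral.integral_of_le hx, intervalIntegral.integral_of_le hx]
  refine setIntegral_congr_fun measurableSet_Ioc fun t ht => ?_
  have : t ∈ {x : ℝ | 0 < x ∧ (x : EReal) < b} :=
    ⟨ht.1, lt_of_le_of_lt (by exact_mod_cast ht.2) hxb⟩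
  simp only [indicator_of_mem this]

/-- The Wronskians with a fundamental system vanish at `0`, hence everywhere. That system has
Wronskian `1`, so Cramer's rule recovers `u` and `v` as zero. -/
theorem eq_zero (h : IsSolution q b z u v) (hq : IsIntegrableUpTo q b) (hu : u 0 = 0) (hv : v 0 = 0)
    {x : ℝ} (hx : 0 ≤ x) (hxb : (x : EReal) < b) : u x = 0 ∧ v x = 0 := by
  obtain ⟨c, c', hc, -, -, hc0, hc0'⟩ := exists_isSolution hq z (1, 0)
  obtain ⟨s, s', hs, -, -, hs0, hs0'⟩ := exists_isSolution hq z (0, 1)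
  have h1 := wronskian_eq hq hc hs hx hxb
  have h2 := wronskian_eq hq h hc hx hxb
  have h3 := wronskian_eq hq h hs hx hxb
  simp only [hc0, hc0', hs0, hs0', hu, hv] at h1 h2 h3
  constructor
  · linear_combination (-u x) * h1 + c x * h3 - s x * h2
  · linear_combination (-v x) * h1 + c' x * h3 - s' x * h2

/-- Solutions with initial values `c • w₁ + d • w₂` are linear combinations. -/
theorem eq_lincomb (hq : IsIntegrableUpTo q b) {u₁ v₁ u₂ v₂ : ℝ → ℂ} (h : IsSolution q b z u v)
    (h₁ : IsSolution q b z u₁ v₁) (h₂ : IsSolution q b z u₂ v₂) (c d : ℂ)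
    (hu : u 0 = c * u₁ 0 + d * u₂ 0) (hv : v 0 = c * v₁ 0 + d * v₂ 0) {x : ℝ} (hx : 0 ≤ x)
    (hxb : (x : EReal) < b) : u x = c * u₁ x + d * u₂ x ∧ v x = c * v₁ x + d * v₂ x := by
  have h0 := (lincomb hq h (lincomb hq h₁ h₂ c d) 1 (-1)).eq_zero hq
    (by rw [hu]; ring) (by rw [hv]; ring) hx hxb
  constructor
  · linear_combination h0.1
  · linear_combination h0.2

end IsSolution
end HalfLine

end

/-! ### Square integrable solutions -/

noncomputable section

namespace HalfLine

variable {q : ℝ → ℝ} {b : EReal} {z : ℂ} {u v : ℝ → ℂ}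

theorem exists_pair_ne_zero (l₁ l₂ : ℂ) : ∃ c d : ℂ, (c ≠ 0 ∨ d ≠ 0) ∧ c * l₁ + d * l₂ = 0 := by
  by_cases h : l₁ = 0
  · exact ⟨1, 0, Or.inl one_ne_zero, by simp [h]⟩
  · exact ⟨-l₂, l₁, Or.inr h, by ring⟩

namespace IsSolution

/-- If `u` vanished identically, its derivative `v` would vanish in the interior, and then at `0` by
continuity. -/
theorem isNonzero (h : IsSolution q b z u v) (hb : 0 < b) (h0 : u 0 ≠ 0 ∨ v 0 ≠ 0) :
    IsNonzero b u := by
  rcases h0 with h0 | h0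
  · exact ⟨0, le_rfl, by simpa using hb, h0⟩
  · by_contra hcon
    have hz : ∀ x : ℝ, 0 ≤ x → (x : EReal) < b → u x = 0 := by
      intro x hx hxb
      by_contra hne
      exact hcon ⟨x, hx, hxb, hne⟩
    obtain ⟨X, hX, hXb⟩ := EReal.lt_iff_exists_real_btwn.1 hb
    have hX : 0 < X := by exact_mod_cast hX
    have hlt : ∀ x : ℝ, x ≤ X → (x : EReal) < b := fun x hx =>
      lt_of_le_of_lt (by exact_mod_cast hx) hXb
    have hv : ∀ x ∈ Ioo 0 X, v x = 0 := by
      intro x hx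
      have h1 := h.hasDerivAt hx.1 (hlt x hx.2.le)
      have h2 : HasDerivAt u 0 x := by
        refine (hasDerivAt_const x (0 : ℂ)).congr_of_eventuallyEq ?_
        filter_upwards [Ioo_mem_nhds hx.1 hx.2] with y hy using hz y hy.1.le (hlt y hy.2.le)
      exact h1.unique h2
    have hc : Tendsto v (𝓝[Ioo 0 X] 0) (𝓝 (v 0)) :=
      (h.continuousOn_snd 0 ⟨le_rfl, hlt 0 hX.le⟩).mono fun x hx => ⟨hx.1.le, hlt x hx.2.le⟩
    have hc' : Tendsto v (𝓝[Ioo 0 X] 0) (𝓝 0) := by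
      refine tendsto_const_nhds.congr' ?_
      filter_upwards [self_mem_nhdsWithin] with x hx using (hv x hx).symm
    have : (𝓝[Ioo 0 X] (0 : ℝ)).NeBot := by
      rw [nhdsWithin_Ioo_eq_nhdsGT hX]; infer_instance
    exact h0 (tendsto_nhds_unique hc hc')

theorem initial_ne_zero (h : IsSolution q b z u v) (hq : IsIntegrableUpTo q b)
    (hu : IsNonzero b u) : u 0 ≠ 0 ∨ v 0 ≠ 0 := by
  by_contra hcon
  push Not at hcon
  obtain ⟨x, hx, hxb, hne⟩ := hu
  exact hne (h.eq_zero hq hcon.1 hcon.2 hx hxb).1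

theorem im_anti (h : IsSolution q b z u v) (hq : IsIntegrableUpTo q b) (hz : 0 < z.im) {x y : ℝ}
    (hx : 0 ≤ x) (hxy : x ≤ y) (hyb : (y : EReal) < b) :
    (v y * starRingEnd ℂ (u y)).im ≤ (v x * starRingEnd ℂ (u x)).im := by
  have h1 := h.im_sub hq hx hxy hyb
  have : 0 ≤ ∫ t in x..y, ‖u t‖ ^ 2 :=
    intervalIntegral.integral_nonneg hxy fun t _ => by positivity
  nlinarith

theorem continuousOn_Ici (h : IsSolution q ⊤ z u v) : ContinuousOn u (Ici 0) :=
  h.continuousOn_fst.mono fun x hx => ⟨hx, EReal.coe_lt_top x⟩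

theorem continuousOn_Ici' (h : IsSolution q ⊤ z u v) : ContinuousOn v (Ici 0) :=
  h.continuousOn_snd.mono fun x hx => ⟨hx, EReal.coe_lt_top x⟩

/-- By `im_sub`, nonnegativity at `X` bounds `Im z ∫₀^X |u|²` by the value of `Im (u' ū)` at `0`. -/
theorem isL2AtTop_of_im_nonneg (h : IsSolution q ⊤ z u v) (hq : IsIntegrableUpTo q ⊤)
    (hz : 0 < z.im) (hu : ∀ x, 0 ≤ x → 0 ≤ (v x * starRingEnd ℂ (u x)).im) : IsL2AtTop u := by
  refine ⟨0, le_rfl, ?_⟩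
  have hc := h.continuousOn_Ici
  refine integrableOn_Ioi_of_intervalIntegral_norm_bounded ((v 0 * starRingEnd ℂ (u 0)).im / z.im) 0
    (l := atTop) (b := fun x => x) (fun X => ?_) tendsto_id ?_
  · refine IntegrableOn.mono_set (t := Icc 0 X) ?_ Ioc_subset_Icc_self
    exact ((hc.mono Icc_subset_Ici_self).norm.pow 2).integrableOn_Icc
  · filter_upwards [eventually_ge_atTop 0] with X hX
    rw [le_div_iff₀ hz]
    have h1 := h.im_sub hq le_rfl hX (EReal.coe_lt_top X)
    simp only [norm_pow, norm_norm]
    linarith [hu X hX]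

theorem integrableOn_norm_sq (h : IsSolution q ⊤ z u v) (hu : IsL2AtTop u) :
    IntegrableOn (fun x => ‖u x‖ ^ 2) (Ioi 0) := by
  obtain ⟨R, hR, hi⟩ := hu
  have hc := h.continuousOn_Ici
  rw [← Ioc_union_Ioi_eq_Ioi hR]
  refine IntegrableOn.union ?_ hi
  refine IntegrableOn.mono_set (t := Icc 0 R) ?_ Ioc_subset_Icc_self
  exact ((hc.mono Icc_subset_Ici_self).norm.pow 2).integrableOn_Icc

/-- A solution that vanishes at `N` has `Im (u' ū) ≥ 0` on `[0, N]` by monotonicity. With initial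
data normalized to the unit sphere, a subsequence converges as `N → ∞`, and the limit keeps the sign
on the whole half-line. -/
theorem exists_isL2AtTop (hq : IsIntegrableUpTo q ⊤) (hz : 0 < z.im) :
    ∃ u v : ℝ → ℂ, IsSolution q ⊤ z u v ∧ IsNonzero ⊤ u ∧ IsL2AtTop u ∧
      ∀ x, 0 ≤ x → 0 ≤ (v x * starRingEnd ℂ (u x)).im := by
  obtain ⟨c, c', hc, -, -, hc0, hc0'⟩ := exists_isSolution hq z (1, 0)
  obtain ⟨s, s', hs, -, -, hs0, hs0'⟩ := exists_isSolution hq z (0, 1)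
  have key : ∀ N : ℕ, ∃ w ∈ Metric.sphere (0 : ℂ × ℂ) 1, w.1 * c N + w.2 * s N = 0 := by
    intro N
    obtain ⟨a, d, hne, h0⟩ := exists_pair_ne_zero (c N) (s N)
    have hw : ((a, d) : ℂ × ℂ) ≠ 0 := by
      intro hcon
      rw [Prod.mk_eq_zero] at hcon
      rcases hne with h | h
      · exact h hcon.1
      · exact h hcon.2
    have hw' : ‖((a, d) : ℂ × ℂ)‖ ≠ 0 := norm_ne_zero_iff.2 hw
    refine ⟨((‖((a, d) : ℂ × ℂ)‖⁻¹ : ℝ) : ℂ) • (a, d), ?_, ?_⟩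
    · rw [mem_sphere_zero_iff_norm, norm_smul, Complex.norm_real, norm_inv, norm_norm,
        inv_mul_cancel₀ hw']
    · simp only [Prod.smul_fst, Prod.smul_snd, smul_eq_mul]
      linear_combination ((‖((a, d) : ℂ × ℂ)‖⁻¹ : ℝ) : ℂ) * h0
  choose w hw hw0 using key
  obtain ⟨w₀, hw₀, φ, hφ, hlim⟩ := (isCompact_sphere (0 : ℂ × ℂ) 1).tendsto_subseq hw
  have hsol := fun w : ℂ × ℂ => lincomb hq hc hs w.1 w.2
  have him : ∀ x, 0 ≤ x → 0 ≤ ((w₀.1 * c' x + w₀.2 * s' x) *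
      starRingEnd ℂ (w₀.1 * c x + w₀.2 * s x)).im := by
    intro x hx
    have hcont : Continuous fun w : ℂ × ℂ => ((w.1 * c' x + w.2 * s' x) *
      starRingEnd ℂ (w.1 * c x + w.2 * s x)).im := by fun_prop
    refine ge_of_tendsto ((hcont.tendsto w₀).comp hlim) ?_
    filter_upwards [hφ.tendsto_atTop.eventually_ge_atTop ⌈x⌉₊] with n hn
    have hn : x ≤ (φ n : ℕ) := (Nat.le_ceil x).trans (by exact_mod_cast hn)
    have := (hsol (w (φ n))).im_anti hq hz hx hn (EReal.coe_lt_top _)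
    rw [hw0] at this
    simpa using this
  refine ⟨_, _, hsol w₀, (hsol w₀).isNonzero EReal.zero_lt_top ?_, ?_, him⟩
  · rw [hc0, hc0', hs0, hs0']
    by_contra hcon
    push Not at hcon
    have : w₀ = 0 := Prod.ext (by simpa using hcon.1) (by simpa using hcon.2)
    rw [this] at hw₀
    simp at hw₀
  · exact (hsol w₀).isL2AtTop_of_im_nonneg hq hz him

/-- By uniqueness, `u` is a multiple of the solution from `exists_isL2AtTop`, and a factor `c` only
multiplies `Im (u' ū)` by `|c|²`. -/
theorem im_nonneg_of_isLimitPoint (hlp : IsLimitPoint q) (hq : IsIntegrableUpTo q ⊤)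
    (h : IsSolution q ⊤ z u v) (hz : 0 < z.im) (hu : IsL2AtTop u) {x : ℝ} (hx : 0 ≤ x) :
    0 ≤ (v x * starRingEnd ℂ (u x)).im := by
  obtain ⟨u₁, v₁, h₁, hne, hL2, him⟩ := exists_isL2AtTop hq hz
  obtain ⟨u₂, v₂, -, -, -, huniq⟩ := hlp z hz
  obtain ⟨c, hc⟩ := huniq u v h hu
  obtain ⟨d, hd⟩ := huniq u₁ v₁ h₁ hL2
  have hd0 : d ≠ 0 := by
    rintro rfl
    obtain ⟨y, hy, -, hne⟩ := hne
    exact hne (by rw [hd y hy, zero_mul])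
  have hprop : ∀ y, 0 ≤ y → u y = c / d * u₁ y := fun y hy => by
    rw [hc y hy, hd y hy]; field_simp
  -- An interior point is needed to compare derivatives, as `x` may be `0`. Monotonicity carries the
  -- sign back from `y` to `x`.
  set y := x + 1
  have hy : 0 < y := by positivity
  have hv : v y = c / d * v₁ y := by
    have h1 := (h₁.hasDerivAt hy (EReal.coe_lt_top _)).const_mul (c / d)
    refine (h.hasDerivAt hy (EReal.coe_lt_top _)).unique (h1.congr_of_eventuallyEq ?_)
    filter_upwards [Ioi_mem_nhds hy] with t ht using hprop t (le_of_lt ht)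
  refine le_trans ?_ (h.im_anti hq hz hx (by simp [y] : x ≤ y) (EReal.coe_lt_top _))
  have e : v y * starRingEnd ℂ (u y) =
      ((‖c / d‖ ^ 2 : ℝ) : ℂ) * (v₁ y * starRingEnd ℂ (u₁ y)) := by
    rw [hv, hprop y hy.le, map_mul, ← Complex.normSq_eq_norm_sq, ← Complex.mul_conj]; ring
  rw [e, Complex.im_ofReal_mul]
  exact mul_nonneg (by positivity) (him y hy.le)

/-- The Wronskian of two square integrable solutions has a limit at infinity. -/
theorem exists_tendsto_wronskian (hq : IsIntegrableUpTo q ⊤) {z₁ z₂ : ℂ} {u₁ v₁ u₂ v₂ : ℝ → ℂ}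
    (h₁ : IsSolution q ⊤ z₁ u₁ v₁) (h₂ : IsSolution q ⊤ z₂ u₂ v₂) (hu₁ : IsL2AtTop u₁)
    (hu₂ : IsL2AtTop u₂) : ∃ l, Tendsto (fun x => u₁ x * v₂ x - v₁ x * u₂ x) atTop (𝓝 l) := by
  have hi : IntegrableOn (fun x => (z₁ - z₂) * (u₁ x * u₂ x)) (Ioi 0) := by
    refine Integrable.const_mul ?_ _
    refine Integrable.mono' ((h₁.integrableOn_norm_sq hu₁).add (h₂.integrableOn_norm_sq hu₂)) ?_
      (ae_of_all _ fun x => ?_)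
    · exact ((h₁.continuousOn_Ici.mul h₂.continuousOn_Ici).mono Ioi_subset_Ici_self).aestronglyMeasurable
        measurableSet_Ioi
    · rw [norm_mul, Pi.add_apply]
      nlinarith [sq_nonneg (‖u₁ x‖ - ‖u₂ x‖), sq_nonneg (‖u₁ x‖ + ‖u₂ x‖)]
  have ht := (intervalIntegral_tendsto_integral_Ioi 0 hi tendsto_id).const_add
    (u₁ 0 * v₂ 0 - v₁ 0 * u₂ 0)
  refine ⟨_, ht.congr' ?_⟩
  filter_upwards [eventually_ge_atTop 0] with x hx
  exact ((wronskian hq h₁ h₂ hx (EReal.coe_lt_top x)).eq_add x ⟨hx, le_rfl⟩).symm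

/-- The condition on `u` and the self-adjointness of `u₀` together make the Wronskian of `u` and `ū`
vanish at infinity. Thus `Im (u' ū)` decreases to `0`. -/
theorem im_nonneg_of_limitCircle (hlc : IsLimitCircle q) (hq : IsIntegrableUpTo q ⊤)
    {u₀ v₀ : ℝ → ℂ} (h₀ : IsSolution q ⊤ Complex.I u₀ v₀) (hne : IsNonzero ⊤ u₀)
    (hsa : Tendsto (fun x => u₀ x * star (v₀ x) - v₀ x * star (u₀ x)) atTop (𝓝 0))
    (h : IsSolution q ⊤ z u v) (hz : 0 < z.im)
    (hu : Tendsto (fun x => u₀ x * v x - v₀ x * u x) atTop (𝓝 0)) {x : ℝ} (hx : 0 ≤ x) :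
    0 ≤ (v x * starRingEnd ℂ (u x)).im := by
  have hn := h₀.initial_ne_zero hq hne
  set N : ℝ := ‖u₀ 0‖ ^ 2 + ‖v₀ 0‖ ^ 2 with hN
  have hN0 : (N : ℂ) ≠ 0 := by
    rw [Complex.ofReal_ne_zero]
    rcases hn with hn | hn
    · have := norm_pos_iff.2 hn; positivity
    · have := norm_pos_iff.2 hn; positivity
  -- The initial data of `w` are the conjugate data of `u₀` rotated by a quarter turn and scaled to
  -- give Wronskian `1` with `u₀`.
  obtain ⟨w, w', hw, -, -, hw0, hw0'⟩ := exists_isSolution hq Complex.I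
    (-starRingEnd ℂ (v₀ 0) / N, starRingEnd ℂ (u₀ 0) / N)
  have hW : ∀ x, 0 ≤ x → u₀ x * w' x - v₀ x * w x = 1 := by
    intro x hx
    rw [wronskian_eq hq h₀ hw hx (EReal.coe_lt_top x), hw0, hw0']
    simp only
    have e1 := Complex.mul_conj (u₀ 0)
    have e2 := Complex.mul_conj (v₀ 0)
    rw [Complex.normSq_eq_norm_sq] at e1 e2
    field_simp
    rw [hN]; push_cast at e1 e2 ⊢
    linear_combination e1 + e2
  have hIm : (0 : ℝ) < Complex.I.im := by simp
  have hL2 := hlc z hz u v h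
  have hL2' : IsL2AtTop fun x => starRingEnd ℂ (u x) := by
    simpa only [IsL2AtTop, RCLike.norm_conj] using hL2
  have hL20 := hlc _ hIm u₀ v₀ h₀
  have hL20' : IsL2AtTop fun x => starRingEnd ℂ (u₀ x) := by
    simpa only [IsL2AtTop, RCLike.norm_conj] using hL20
  have hL2w := hlc _ hIm w w' hw
  obtain ⟨l₁, hl₁⟩ := exists_tendsto_wronskian hq h.conj hw hL2' hL2w
  obtain ⟨l₂, hl₂⟩ := exists_tendsto_wronskian hq h hw hL2 hL2w
  obtain ⟨l₃, hl₃⟩ := exists_tendsto_wronskian hq h₀.conj hw hL20' hL2w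
  -- Plücker identity: `W(u, ū₀) W(u₀, w) = -W(u₀, u) W(ū₀, w) + W(u, w) W(u₀, ū₀)`. Each product on
  -- the right has one factor tending to `0` and one that converges by square integrability. The
  -- same identity with `ū` for `ū₀` gives `t2`.
  have t1 : Tendsto (fun x => u x * starRingEnd ℂ (v₀ x) - v x * starRingEnd ℂ (u₀ x)) atTop (𝓝 0) := by
    have := (hu.neg.mul hl₃).add (hl₂.mul hsa)
    rw [neg_zero, zero_mul, mul_zero, add_zero] at this
    refine this.congr' ?_
    filter_upwards [eventually_ge_atTop 0] with x hx
    have := hW x hx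
    simp only [RCLike.star_def]
    linear_combination (u x * starRingEnd ℂ (v₀ x) - v x * starRingEnd ℂ (u₀ x)) * this
  have t2 : Tendsto (fun x => u x * starRingEnd ℂ (v x) - v x * starRingEnd ℂ (u x)) atTop (𝓝 0) := by
    have hconj := (Complex.continuous_conj.tendsto 0).comp t1
    rw [map_zero] at hconj
    have := (hu.neg.mul hl₁).sub (hl₂.mul hconj)
    rw [neg_zero, zero_mul, mul_zero, sub_zero] at this
    refine this.congr' ?_
    filter_upwards [eventually_ge_atTop 0] with x hx
    have := hW x hx
    simp only [Function.comp_apply, map_sub, map_mul, Complex.conj_conj]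
    linear_combination (u x * starRingEnd ℂ (v x) - v x * starRingEnd ℂ (u x)) * this
  have t3 : Tendsto (fun x => (v x * starRingEnd ℂ (u x)).im) atTop (𝓝 0) := by
    have := ((Complex.continuous_im.tendsto 0).comp t2).const_mul (-1 / 2)
    rw [Complex.zero_im, mul_zero] at this
    refine this.congr fun x => ?_
    simp only [Function.comp_apply, Complex.sub_im, Complex.mul_im, Complex.conj_re, Complex.conj_im]
    ring
  refine le_of_tendsto t3 ?_
  filter_upwards [eventually_ge_atTop x] with y hy
  exact h.im_anti hq hz hx hy (EReal.coe_lt_top y)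

end IsSolution
end HalfLine

end

/-! ### Potentials that are essentially bounded below -/

noncomputable section

namespace HalfLine

variable {q : ℝ → ℝ} {b : EReal} {z : ℂ} {u v : ℝ → ℂ}

namespace IsSolution

theorem intervalIntegrable_norm_sq_fst (h : IsSolution q ⊤ z u v) {x y : ℝ} (hx : 0 ≤ x)
    (hy : 0 ≤ y) : IntervalIntegrable (fun t => ‖u t‖ ^ 2) volume x y :=
  ContinuousOn.intervalIntegrable ((h.continuousOn_Ici.mono
    (ordConnected_Ici.uIcc_subset hx hy)).norm.pow 2)

theorem intervalIntegrable_norm_sq_snd (h : IsSolution q ⊤ z u v) {x y : ℝ} (hx : 0 ≤ x)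
    (hy : 0 ≤ y) : IntervalIntegrable (fun t => ‖v t‖ ^ 2) volume x y :=
  ContinuousOn.intervalIntegrable ((h.continuousOn_Ici'.mono
    (ordConnected_Ici.uIcc_subset hx hy)).norm.pow 2)

theorem norm_sq_sub (h : IsSolution q ⊤ z u v) {x y : ℝ} (hx : 0 ≤ x) (hy : 0 ≤ y) :
    ‖u y‖ ^ 2 - ‖u x‖ ^ 2 = ∫ t in x..y, 2 * (v t * starRingEnd ℂ (u t)).re := by
  set X := max x y
  have hX : 0 ≤ X := hx.trans (le_max_left _ _)
  have h1 := ((h.primitive_fst hX (EReal.coe_lt_top X)).mul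
    (h.conj.primitive_fst hX (EReal.coe_lt_top X)) hX).sub_eq ⟨hx, le_max_left x y⟩
    ⟨hy, le_max_right x y⟩
  have h2 : ∀ t, v t * starRingEnd ℂ (u t) + u t * starRingEnd ℂ (v t) =
      ((2 * (v t * starRingEnd ℂ (u t)).re : ℝ) : ℂ) := by
    intro t
    rw [← Complex.add_conj, map_mul, Complex.conj_conj]; ring
  simp_rw [h2, Complex.mul_conj, Complex.normSq_eq_norm_sq] at h1
  rw [intervalIntegral.integral_ofReal] at h1
  exact_mod_cast h1

theorem re_sub (h : IsSolution q ⊤ z u v) (hq : IsIntegrableUpTo q ⊤) {x y : ℝ} (hx : 0 ≤ x)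
    (hxy : x ≤ y) :
    (v y * starRingEnd ℂ (u y)).re - (v x * starRingEnd ℂ (u x)).re =
      (∫ t in x..y, ‖v t‖ ^ 2) + (∫ t in x..y, q t * ‖u t‖ ^ 2) - z.re * ∫ t in x..y, ‖u t‖ ^ 2 := by
  have hy := hx.trans hxy
  have hp := ((h.primitive_snd hq hy (EReal.coe_lt_top y)).mul
    (h.conj.primitive_fst hy (EReal.coe_lt_top y)) hy)
  have h1 := hp.sub_eq ⟨hx, hxy⟩ ⟨hy, le_rfl⟩
  have h2 := congrArg Complex.re h1
  have h3 := Complex.reCLM.intervalIntegral_comp_comm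
    (hp.intervalIntegrable_of_mem (x := x) (y := y) ⟨hx, hxy⟩ ⟨hy, le_rfl⟩)
  simp only [Complex.reCLM_apply] at h3
  rw [← h3, Complex.sub_re] at h2
  rw [h2, ← intervalIntegral.integral_const_mul, ← intervalIntegral.integral_add,
    ← intervalIntegral.integral_sub]
  · refine intervalIntegral.integral_congr fun t _ => ?_
    have e1 := Complex.mul_conj (u t)
    have e2 := Complex.mul_conj (v t)
    rw [Complex.normSq_eq_norm_sq] at e1 e2
    have e : ((q t : ℂ) - z) * u t * starRingEnd ℂ (u t) + v t * starRingEnd ℂ (v t) =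
        ((q t * ‖u t‖ ^ 2 + ‖v t‖ ^ 2 : ℝ) : ℂ) - z * ((‖u t‖ ^ 2 : ℝ) : ℂ) := by
      push_cast at e1 e2 ⊢
      linear_combination ((q t : ℂ) - z) * e1 + e2
    simp only [e, Complex.sub_re, Complex.ofReal_re, Complex.re_mul_ofReal]
    ring
  · refine (h.intervalIntegrable_norm_sq_snd hx hy).add ?_
    refine IntervalIntegrable.mul_continuousOn ?_ ?_
    · exact (hq.intervalIntegrable hy (EReal.coe_lt_top y)).mono_set
        (by rw [uIcc_of_le hxy, uIcc_of_le hy]; exact Icc_subset_Icc_left hx)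
    · exact ((h.continuousOn_Ici.mono (ordConnected_Ici.uIcc_subset hx hy)).norm.pow 2)
  · exact (h.intervalIntegrable_norm_sq_fst hx hy).const_mul _
  · exact h.intervalIntegrable_norm_sq_snd hx hy
  · refine IntervalIntegrable.mul_continuousOn ?_ ?_
    · exact (hq.intervalIntegrable hy (EReal.coe_lt_top y)).mono_set
        (by rw [uIcc_of_le hxy, uIcc_of_le hy]; exact Icc_subset_Icc_left hx)
    · exact ((h.continuousOn_Ici.mono (ordConnected_Ici.uIcc_subset hx hy)).norm.pow 2)

/-- A Sobolev inequality on unit intervals. -/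
theorem norm_sq_le (h : IsSolution q ⊤ z u v) {ε s t : ℝ} (hε : 0 < ε) (hs : 0 ≤ s)
    (ht : t ∈ Icc s (s + 1)) :
    ‖u t‖ ^ 2 ≤ (1 + ε⁻¹) * (∫ t in s..s + 1, ‖u t‖ ^ 2) + ε * ∫ t in s..s + 1, ‖v t‖ ^ 2 := by
  have hs1 : s ≤ s + 1 := by linarith
  have hs1' : 0 ≤ s + 1 := by linarith
  have hc : ContinuousOn (fun t => ‖u t‖ ^ 2) (Icc s (s + 1)) :=
    (h.continuousOn_Ici.mono fun x hx => hs.trans hx.1).norm.pow 2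
  -- At the minimum point `r`, `|u|²` is at most its mean. The increment from `r` to `t` is
  -- controlled by `2 |v| |u| ≤ ε⁻¹ |u|² + ε |v|²`.
  obtain ⟨r, hr, hmin⟩ := isCompact_Icc.exists_isMinOn (nonempty_Icc.2 hs1) hc
  have hr0 : 0 ≤ r := hs.trans hr.1
  have ht0 : 0 ≤ t := hs.trans ht.1
  have iu := h.intervalIntegrable_norm_sq_fst hs hs1'
  have iv := h.intervalIntegrable_norm_sq_snd hs hs1'
  have h1 : ‖u r‖ ^ 2 ≤ ∫ t in s..s + 1, ‖u t‖ ^ 2 := by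
    have : ∫ _ in s..s + 1, ‖u r‖ ^ 2 ≤ ∫ t in s..s + 1, ‖u t‖ ^ 2 :=
      intervalIntegral.integral_mono_on hs1 intervalIntegrable_const iu fun x hx => hmin hx
    simpa using this
  have h2 := h.norm_sq_sub hr0 ht0
  have h3 : ∫ t in r..t, 2 * (v t * starRingEnd ℂ (u t)).re ≤
      ∫ t in s..s + 1, (ε⁻¹ * ‖u t‖ ^ 2 + ε * ‖v t‖ ^ 2) := by
    have hsub : uIoc r t ⊆ uIoc s (s + 1) := by
      rw [uIoc_of_le hs1]
      exact fun x hx => ⟨(le_min hr.1 ht.1).trans_lt hx.1, hx.2.trans (max_le hr.2 ht.2)⟩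
    have ii := (iu.const_mul ε⁻¹).add (iv.const_mul ε)
    calc _ ≤ ‖∫ t in r..t, 2 * (v t * starRingEnd ℂ (u t)).re‖ := le_abs_self _
      _ ≤ ∫ t in uIoc r t, ‖2 * (v t * starRingEnd ℂ (u t)).re‖ :=
          intervalIntegral.norm_integral_le_integral_norm_uIoc
      _ ≤ ∫ t in uIoc r t, (ε⁻¹ * ‖u t‖ ^ 2 + ε * ‖v t‖ ^ 2) := by
          refine integral_mono_of_nonneg (ae_of_all _ fun x => norm_nonneg _)
            ((intervalIntegrable_iff.1 ii).mono_set hsub) (ae_of_all _ fun x => ?_)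
          have e : |(v x * starRingEnd ℂ (u x)).re| ≤ ‖v x‖ * ‖u x‖ := by
            simpa using Complex.abs_re_le_norm (v x * starRingEnd ℂ (u x))
          beta_reduce
          rw [norm_mul, Real.norm_eq_abs, Real.norm_eq_abs, abs_two]
          refine (mul_le_mul_of_nonneg_left e zero_le_two).trans ?_
          have : 0 ≤ ε * (ε⁻¹ * ‖u x‖ - ‖v x‖) ^ 2 := by positivity
          have e' : ε * (ε⁻¹ * ‖u x‖ - ‖v x‖) ^ 2 =
              ε⁻¹ * ‖u x‖ ^ 2 + ε * ‖v x‖ ^ 2 - 2 * (‖v x‖ * ‖u x‖) := by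
            field_simp; ring
          linarith
      _ ≤ ∫ t in uIoc s (s + 1), (ε⁻¹ * ‖u t‖ ^ 2 + ε * ‖v t‖ ^ 2) :=
          setIntegral_mono_set (intervalIntegrable_iff.1 ii)
            (ae_of_all _ fun x => by positivity) (LE.le.eventuallyLE hsub)
      _ = _ := by rw [uIoc_of_le hs1, intervalIntegral.integral_of_le hs1]
  rw [← h2, intervalIntegral.integral_add (iu.const_mul _) (iv.const_mul _),
    intervalIntegral.integral_const_mul, intervalIntegral.integral_const_mul] at h3
  linarith

/-- The Sobolev inequality summed over unit intervals, going backwards from `Y`. Condition `hn`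
keeps all left ends positive, where `hC` applies. -/
theorem integral_neg_part_le (h : IsSolution q ⊤ z u v) (hq : IsIntegrableUpTo q ⊤) {C : ℝ}
    (hC : ∀ a : ℝ, 0 < a → ∫ x in a..(a + 1), max (-q x) 0 ≤ C) {ε Y : ℝ} (hε : 0 < ε) (n : ℕ)
    (hn : 0 < Y - n) :
    ∫ t in (Y - n)..Y, max (-q t) 0 * ‖u t‖ ^ 2 ≤
      C * ((1 + ε⁻¹) * (∫ t in (Y - n)..Y, ‖u t‖ ^ 2) + ε * ∫ t in (Y - n)..Y, ‖v t‖ ^ 2) := by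
  have hqi : ∀ {x y : ℝ}, 0 ≤ x → 0 ≤ y → IntervalIntegrable (fun t => max (-q t) 0) volume x y := by
    intro x y hx hy
    have hX : 0 ≤ max x y := hx.trans (le_max_left _ _)
    have h1 := (hq.intervalIntegrable hX (EReal.coe_lt_top (max x y))).mono_set
      (c := x) (d := y) (by
        rw [uIcc_of_le hX]
        exact ordConnected_Icc.uIcc_subset ⟨hx, le_max_left _ _⟩ ⟨hy, le_max_right _ _⟩)
    exact ⟨h1.neg.1.sup (integrable_const _), h1.neg.2.sup (integrable_const _)⟩
  have hqu : ∀ {x y : ℝ}, 0 ≤ x → 0 ≤ y →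
      IntervalIntegrable (fun t => max (-q t) 0 * ‖u t‖ ^ 2) volume x y := fun hx hy =>
    (hqi hx hy).mul_continuousOn
      ((h.continuousOn_Ici.mono (ordConnected_Ici.uIcc_subset hx hy)).norm.pow 2)
  induction n with
  | zero => simp
  | succ n ih =>
    push_cast at hn ⊢
    have hs : 0 < Y - n := by linarith
    have ih := ih hs
    set s := Y - (n + 1) with hsdef
    have hs1 : Y - n = s + 1 := by rw [hsdef]; ring
    rw [hs1] at ih hs
    have hle : s ≤ s + 1 := by linarith
    have hY : 0 ≤ Y := by
      have : (0 : ℝ) ≤ n := by positivity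
      linarith
    rw [← intervalIntegral.integral_add_adjacent_intervals (hqu hn.le hs.le) (hqu hs.le hY),
      ← intervalIntegral.integral_add_adjacent_intervals
        (h.intervalIntegrable_norm_sq_fst hn.le hs.le) (h.intervalIntegrable_norm_sq_fst hs.le hY),
      ← intervalIntegral.integral_add_adjacent_intervals
        (h.intervalIntegrable_norm_sq_snd hn.le hs.le) (h.intervalIntegrable_norm_sq_snd hs.le hY)]
    set B := (1 + ε⁻¹) * (∫ t in s..s + 1, ‖u t‖ ^ 2) + ε * ∫ t in s..s + 1, ‖v t‖ ^ 2 with hB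
    have hB0 : 0 ≤ B := by
      have i1 : 0 ≤ ∫ t in s..s + 1, ‖u t‖ ^ 2 :=
        intervalIntegral.integral_nonneg hle fun _ _ => by positivity
      have i2 : 0 ≤ ∫ t in s..s + 1, ‖v t‖ ^ 2 :=
        intervalIntegral.integral_nonneg hle fun _ _ => by positivity
      positivity
    have hunit : ∫ t in s..s + 1, max (-q t) 0 * ‖u t‖ ^ 2 ≤ C * B := by
      calc _ ≤ ∫ t in s..s + 1, max (-q t) 0 * B :=
            intervalIntegral.integral_mono_on hle (hqu hn.le hs.le)
              ((hqi hn.le hs.le).mul_const _) fun t ht =>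
                mul_le_mul_of_nonneg_left (h.norm_sq_le hε hn.le ht) (le_max_right _ _)
        _ = (∫ t in s..s + 1, max (-q t) 0) * B := intervalIntegral.integral_mul_const _ _
        _ ≤ C * B := mul_le_mul_of_nonneg_right (hC s hn) hB0
    rw [hB] at hunit
    linarith

/-- Square integrability of `u` forces that of `u'`: the negative part of `q` is absorbed by half of
`∫ |u'|²`. If `Im (u' ū)` were negative somewhere, monotonicity would keep `|u| |u'|` bounded away
from `0` from there on, contradicting the integrability of `|u|² + |u'|²`. -/
theorem im_nonneg_of_isEssBddBelow (hbd : IsEssBddBelow q) (hq : IsIntegrableUpTo q ⊤)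
    (h : IsSolution q ⊤ z u v) (hz : 0 < z.im) (hu : IsL2AtTop u) {x : ℝ} (hx : 0 ≤ x) :
    0 ≤ (v x * starRingEnd ℂ (u x)).im := by
  obtain ⟨C, hC⟩ := hbd
  have hC0 : 0 ≤ C := (intervalIntegral.integral_nonneg (by norm_num)
    fun _ _ => le_max_right _ _).trans (hC 1 one_pos)
  have hint := h.integrableOn_norm_sq hu
  set B := ∫ t in Ioi 0, ‖u t‖ ^ 2 with hBdef
  have hB : ∀ s t : ℝ, 0 ≤ s → s ≤ t → ∫ t in s..t, ‖u t‖ ^ 2 ≤ B := by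
    intro s t hs hst
    rw [intervalIntegral.integral_of_le hst]
    exact setIntegral_mono_set hint (ae_of_all _ fun x => by positivity)
      (LE.le.eventuallyLE fun y hy => hs.trans_lt hy.1)
  have hB0 : 0 ≤ B := integral_nonneg fun _ => by positivity
  -- The boundary term `Re (u' ū)` is half the derivative of `|u|²`. If it stayed above `1`, then
  -- `|u|²` would grow linearly.
  have hfreq : ∀ T : ℝ, 0 ≤ T → ∃ Y, T ≤ Y ∧ (v Y * starRingEnd ℂ (u Y)).re ≤ 1 := by
    intro T hT
    by_contra hcon
    push Not at hcon
    have h1 : ∀ Y, T ≤ Y → 2 * (Y - T) ≤ ‖u Y‖ ^ 2 := by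
      intro Y hY
      have h2 := h.norm_sq_sub hT (hT.trans hY)
      have h3 : ∫ _ in T..Y, (2 : ℝ) ≤ ∫ t in T..Y, 2 * (v t * starRingEnd ℂ (u t)).re := by
        refine intervalIntegral.integral_mono_on hY intervalIntegrable_const ?_ fun t ht => ?_
        · refine ContinuousOn.intervalIntegrable ?_
          have hs := ordConnected_Ici.uIcc_subset (s := Ici (0 : ℝ)) hT (hT.trans hY)
          refine continuousOn_const.mul (Complex.continuous_re.comp_continuousOn ?_)
          exact (h.continuousOn_Ici'.mono hs).mul
            (Complex.continuous_conj.comp_continuousOn (h.continuousOn_Ici.mono hs))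
        · linarith [hcon t ht.1]
      rw [intervalIntegral.integral_const, smul_eq_mul] at h3
      nlinarith [sq_nonneg ‖u T‖]
    -- On an interval of length `B + 1` the linear lower bound integrates to `(B + 1)²`, which
    -- exceeds `B`.
    set Y := T + (B + 1) with hY
    have hTY : T ≤ Y := by linarith
    have h4 : ∫ t in T..Y, 2 * (t - T) ≤ B := by
      refine le_trans (intervalIntegral.integral_mono_on hTY ?_
        (h.intervalIntegrable_norm_sq_fst hT (hT.trans hTY)) fun t ht => h1 t ht.1) (hB T Y hT hTY)
      exact Continuous.intervalIntegrable (by fun_prop) _ _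
    have h5 : ∫ t in T..Y, 2 * (t - T) = (B + 1) ^ 2 := by
      rw [intervalIntegral.integral_const_mul, intervalIntegral.integral_sub (by simp) (by simp),
        integral_id, intervalIntegral.integral_const, smul_eq_mul, hY]
      ring
    nlinarith
  obtain ⟨K, hK⟩ : ∃ K, ∀ t ∈ Icc (1 : ℝ) 2, ‖(v t * starRingEnd ℂ (u t))‖ ≤ K := by
    have hs : Icc (1 : ℝ) 2 ⊆ Ici 0 := fun t ht => by have := ht.1; simp only [mem_Ici]; linarith
    exact isCompact_Icc.exists_bound_of_continuousOn ((h.continuousOn_Ici'.mono hs).mul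
      (Complex.continuous_conj.comp_continuousOn (h.continuousOn_Ici.mono hs)))
  -- Chosen so that `C ε ≤ 1/2`; adding `1` keeps it meaningful when `C = 0`.
  set ε : ℝ := (2 * (C + 1))⁻¹ with hε
  have hε0 : 0 < ε := by positivity
  have hCε : C * ε ≤ 1 / 2 := by
    rw [hε, ← div_eq_mul_inv, div_le_div_iff₀ (by positivity) (by norm_num)]; linarith
  set D := 1 + K + |z.re| * B + C * ((1 + ε⁻¹) * B) with hD
  have hv : ∀ Y, 3 ≤ Y → (v Y * starRingEnd ℂ (u Y)).re ≤ 1 → ∫ t in (2 : ℝ)..Y, ‖v t‖ ^ 2 ≤ 2 * D := by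
    intro Y hY hre
    -- Unit steps back from `Y` end in `[1, 2]`, a fixed compact set on which the left boundary term
    -- is bounded by `K`.
    obtain ⟨n, hn1, hn2⟩ : ∃ n : ℕ, 1 ≤ Y - n ∧ Y - n ≤ 2 := by
      refine ⟨⌊Y - 1⌋₊, ?_, ?_⟩
      · have := Nat.floor_le (show 0 ≤ Y - 1 by linarith); linarith
      · have := Nat.lt_floor_add_one (Y - 1); linarith
    set X := Y - n with hX
    have hX0 : 0 ≤ X := by linarith
    have hXY : X ≤ Y := by rw [hX]; simp
    have hY0 : 0 ≤ Y := by linarith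
    have e1 := h.re_sub hq hX0 hXY
    have e2 := h.integral_neg_part_le hq hC hε0 (Y := Y) n (by linarith)
    rw [← hX] at e2
    have e3 : -(∫ t in X..Y, max (-q t) 0 * ‖u t‖ ^ 2) ≤ ∫ t in X..Y, q t * ‖u t‖ ^ 2 := by
      have hqi : IntervalIntegrable q volume X Y :=
        (hq.intervalIntegrable hY0 (EReal.coe_lt_top Y)).mono_set
          (by rw [uIcc_of_le hXY, uIcc_of_le hY0]; exact Icc_subset_Icc_left hX0)
      have hmi : IntervalIntegrable (fun t => max (-q t) 0) volume X Y :=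
        ⟨hqi.neg.1.sup (integrable_const _), hqi.neg.2.sup (integrable_const _)⟩
      have hcu : ContinuousOn (fun t => ‖u t‖ ^ 2) (uIcc X Y) :=
        (h.continuousOn_Ici.mono (ordConnected_Ici.uIcc_subset hX0 hY0)).norm.pow 2
      rw [← intervalIntegral.integral_neg]
      refine intervalIntegral.integral_mono_on hXY (hmi.mul_continuousOn hcu).neg
        (hqi.mul_continuousOn hcu) fun t _ => ?_
      rw [← neg_mul]
      refine mul_le_mul_of_nonneg_right ?_ (by positivity)
      linarith [le_max_left (-q t) 0]
    have e4 := hB X Y hX0 hXY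
    have e5 : 0 ≤ ∫ t in X..Y, ‖u t‖ ^ 2 :=
      intervalIntegral.integral_nonneg hXY fun _ _ => by positivity
    have e6 : 0 ≤ ∫ t in X..Y, ‖v t‖ ^ 2 :=
      intervalIntegral.integral_nonneg hXY fun _ _ => by positivity
    have e7 : z.re * ∫ t in X..Y, ‖u t‖ ^ 2 ≤ |z.re| * B :=
      (mul_le_mul_of_nonneg_right (le_abs_self _) e5).trans
        (mul_le_mul_of_nonneg_left e4 (abs_nonneg _))
    have e8 : -(v X * starRingEnd ℂ (u X)).re ≤ K :=
      (neg_le_abs _).trans ((Complex.abs_re_le_norm _).trans (hK X ⟨hn1, hn2⟩))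
    have e9 : C * ((1 + ε⁻¹) * (∫ t in X..Y, ‖u t‖ ^ 2) + ε * ∫ t in X..Y, ‖v t‖ ^ 2) ≤
        C * ((1 + ε⁻¹) * B) + 1 / 2 * ∫ t in X..Y, ‖v t‖ ^ 2 := by
      rw [mul_add, ← mul_assoc C ε]
      gcongr
    have e10 : ∫ t in (2 : ℝ)..Y, ‖v t‖ ^ 2 ≤ ∫ t in X..Y, ‖v t‖ ^ 2 := by
      refine intervalIntegral.integral_mono_interval hn2 (by linarith) le_rfl
        (ae_of_all _ fun _ => by positivity) (h.intervalIntegrable_norm_sq_snd hX0 hY0)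
    rw [hD]
    linarith
  by_contra hcon
  push Not at hcon
  set x₀ := max x 2 with hx₀
  have hx₀2 : 2 ≤ x₀ := le_max_right _ _
  have hx₀0 : 0 ≤ x₀ := by linarith
  set δ := -(v x₀ * starRingEnd ℂ (u x₀)).im with hδ
  have hδ0 : 0 < δ := by
    have := h.im_anti hq hz hx (le_max_left x 2) (EReal.coe_lt_top _)
    rw [hδ]; linarith
  -- Past `x₀` the integrand `|u|² + |v|²` is at least `2 δ`, while its integral is at most `B + 2
  -- D`. An interval longer than `(B + 2 |D|) / δ` is impossible.
  obtain ⟨Y, hY, hre⟩ := hfreq (x₀ + 1 + (B + 2 * |D|) / δ) (by positivity)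
  have hY' : x₀ + 1 ≤ Y := by
    have : 0 ≤ (B + 2 * |D|) / δ := by positivity
    linarith
  have hx₀Y : x₀ ≤ Y := by linarith
  have hY0 : 0 ≤ Y := by linarith
  have f1 := hv Y (by linarith) hre
  have f2 : ∫ t in x₀..Y, ‖v t‖ ^ 2 ≤ ∫ t in (2 : ℝ)..Y, ‖v t‖ ^ 2 :=
    intervalIntegral.integral_mono_interval hx₀2 hx₀Y le_rfl
      (ae_of_all _ fun _ => by positivity) (h.intervalIntegrable_norm_sq_snd zero_le_two hY0)
  have f3 := hB x₀ Y hx₀0 hx₀Y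
  have f4 : ∫ _ in x₀..Y, 2 * δ ≤ ∫ t in x₀..Y, (‖u t‖ ^ 2 + ‖v t‖ ^ 2) := by
    refine intervalIntegral.integral_mono_on hx₀Y intervalIntegrable_const
      ((h.intervalIntegrable_norm_sq_fst hx₀0 hY0).add
        (h.intervalIntegrable_norm_sq_snd hx₀0 hY0)) fun t ht => ?_
    have g1 := h.im_anti hq hz hx₀0 ht.1 (EReal.coe_lt_top t)
    have g2 : |(v t * starRingEnd ℂ (u t)).im| ≤ ‖v t‖ * ‖u t‖ := by
      simpa using Complex.abs_im_le_norm (v t * starRingEnd ℂ (u t))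
    have g3 := neg_le_abs (v t * starRingEnd ℂ (u t)).im
    nlinarith [sq_nonneg (‖u t‖ - ‖v t‖)]
  rw [intervalIntegral.integral_const, smul_eq_mul, intervalIntegral.integral_add
    (h.intervalIntegrable_norm_sq_fst hx₀0 hY0) (h.intervalIntegrable_norm_sq_snd hx₀0 hY0)] at f4
  have f5 : (B + 2 * |D|) / δ < Y - x₀ := by linarith
  rw [div_lt_iff₀ hδ0] at f5
  have := le_abs_self D
  nlinarith [abs_nonneg D]

end IsSolution
end HalfLine

end

/-! ### Weyl solutions -/

noncomputable section

namespace HalfLine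

variable {q : ℝ → ℝ} {z : ℂ} {u v : ℝ → ℂ}

theorem IsLocallyL1.isIntegrableUpTo (hq : IsLocallyL1 q) : IsIntegrableUpTo q ⊤ := fun X =>
  (hq (max X 1) (by positivity)).mono_set fun _ hx => ⟨hx.1, hx.2.1.trans_le (le_max_left _ _)⟩

namespace EndCondition

theorem Admissible.isIntegrableUpTo {e : EndCondition} (he : e.Admissible q) :
    IsIntegrableUpTo q e.endpoint := by
  cases e with
  | finite b h => exact fun X => he.2.mono_set fun x hx => ⟨hx.1, EReal.coe_lt_coe_iff.1 hx.2.2⟩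
  | squareIntegrable => exact IsLocallyL1.isIntegrableUpTo he.1
  | limitCircle u₀ v₀ => exact IsLocallyL1.isIntegrableUpTo he.1

theorem Admissible.endpoint_pos {e : EndCondition} (he : e.Admissible q) : 0 < e.endpoint := by
  cases e with
  | finite b h => exact EReal.coe_lt_coe_iff.2 he.1
  | squareIntegrable => exact EReal.zero_lt_top
  | limitCircle u₀ v₀ => exact EReal.zero_lt_top

end EndCondition

theorem tendsto_nhdsLT_of_continuousOn_Ici {f : ℝ → ℂ} (hf : ContinuousOn f (Ici 0)) {b : ℝ}
    (hb : 0 < b) : Tendsto f (𝓝[<] b) (𝓝 (f b)) :=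
  (hf.continuousAt (Ici_mem_nhds hb)).mono_left nhdsWithin_le_nhds

/-- A solution on `[0, b)` of an equation that is regular at `b` has limits at `b`. -/
theorem IsSolution.exists_tendsto {b : ℝ} (hb : 0 < b) (hq : IsIntegrableUpTo q b)
    (h : IsSolution q b z u v) :
    ∃ l l' : ℂ, Tendsto u (𝓝[<] b) (𝓝 l) ∧ Tendsto v (𝓝[<] b) (𝓝 l') := by
  obtain ⟨u₁, v₁, h₁, hu₁, hv₁, hu0, hv0⟩ := exists_isSolution hq z (u 0, v 0)
  have heq : ∀ᶠ x in 𝓝[<] b, u₁ x = u x ∧ v₁ x = v x := by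
    filter_upwards [Ioo_mem_nhdsLT hb] with x hx
    have := h₁.eq_lincomb hq h h 1 0 (by simp [hu0]) (by simp [hv0]) hx.1.le
      (by exact_mod_cast hx.2)
    simpa using this
  exact ⟨_, _, (tendsto_nhdsLT_of_continuousOn_Ici hu₁ hb).congr' (heq.mono fun x hx => hx.1),
    (tendsto_nhdsLT_of_continuousOn_Ici hv₁ hb).congr' (heq.mono fun x hx => hx.2)⟩

/-- As `h` is real or infinite, the boundary condition makes `u' ū` real at `b`; its imaginary part
decreases to `0` there. -/
theorem IsSolution.im_nonneg_of_finite {b : ℝ} (hb : 0 < b) (hq : IsIntegrableUpTo q b)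
    {c : OnePoint ℝ} (h : IsSolution q b z u v) (hz : 0 < z.im)
    (hu : (EndCondition.finite b c).Holds u v) {x : ℝ} (hx : 0 ≤ x) (hxb : x < b) :
    0 ≤ (v x * starRingEnd ℂ (u x)).im := by
  obtain ⟨l, l', hl, hl'⟩ := h.exists_tendsto hb hq
  have ht : Tendsto (fun y => (v y * starRingEnd ℂ (u y)).im) (𝓝[<] b)
      (𝓝 (l' * starRingEnd ℂ l).im) :=
    (Complex.continuous_im.tendsto _).comp
      (hl'.mul ((Complex.continuous_conj.tendsto l).comp hl))
  have h0 : (l' * starRingEnd ℂ l).im = 0 := by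
    rcases c with _ | c
    · have : l = 0 := tendsto_nhds_unique hl hu
      simp [this]
    · have h1 : l' + c * l = 0 := tendsto_nhds_unique (hl'.add (hl.const_mul (c : ℂ))) hu
      have h2 : l' = -(c * l) := by linear_combination h1
      rw [h2, neg_mul, mul_assoc, Complex.mul_conj, ← Complex.ofReal_mul, ← Complex.ofReal_neg,
        Complex.ofReal_im]
  rw [h0] at ht
  refine le_of_tendsto ht ?_
  filter_upwards [Ioo_mem_nhdsLT hxb] with y hy
  exact h.im_anti hq hz hx hy.1.le (by exact_mod_cast hy.2)

/-- At a finite or limit circle endpoint the condition is one linear equation on a two-dimensional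
solution space. The square integrable case is `exists_isL2AtTop`. -/
theorem exists_isWeylSolution {e : EndCondition} (he : e.Admissible q) (hz : 0 < z.im) :
    ∃ p, IsWeylSolution q e z p := by
  have hq := he.isIntegrableUpTo
  have hpos := he.endpoint_pos
  obtain ⟨c, c', hc, hcc, hcc', hc0, hc0'⟩ := exists_isSolution hq z (1, 0)
  obtain ⟨s, s', hs, hsc, hsc', hs0, hs0'⟩ := exists_isSolution hq z (0, 1)
  have hnz : ∀ {α β : ℂ}, (α ≠ 0 ∨ β ≠ 0) →
      IsNonzero e.endpoint (fun x => α * c x + β * s x) := fun {α β} hαβ =>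
    (IsSolution.lincomb hq hc hs α β).isNonzero hpos (by simpa [hc0, hc0', hs0, hs0'] using hαβ)
  cases e with
  | finite b h =>
    have hb : 0 < b := he.1
    rcases h with _ | h
    · obtain ⟨α, β, hαβ, h0⟩ := exists_pair_ne_zero (c b) (s b)
      refine ⟨(_, _), IsSolution.lincomb hq hc hs α β, hnz hαβ, ?_⟩
      have := tendsto_nhdsLT_of_continuousOn_Ici
        ((hcc.const_smul α).add (hsc.const_smul β)) hb
      simp only [Pi.add_apply, Pi.smul_apply, smul_eq_mul, h0] at this
      exact this
    · obtain ⟨α, β, hαβ, h0⟩ := exists_pair_ne_zero (c' b + h * c b) (s' b + h * s b)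
      refine ⟨(_, _), IsSolution.lincomb hq hc hs α β, hnz hαβ, ?_⟩
      have := tendsto_nhdsLT_of_continuousOn_Ici (((hcc'.const_smul α).add (hsc'.const_smul β)).add
        (((hcc.const_smul α).add (hsc.const_smul β)).const_smul (h : ℂ))) hb
      simp only [Pi.add_apply, Pi.smul_apply, smul_eq_mul] at this
      rw [show α * c' b + β * s' b + (h : ℂ) * (α * c b + β * s b) = 0 by
        linear_combination h0] at this
      exact this
  | squareIntegrable =>
    obtain ⟨u, v, h, hne, hL2, -⟩ := IsSolution.exists_isL2AtTop hq hz
    exact ⟨(u, v), h, hne, hL2⟩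
  | limitCircle u₀ v₀ =>
    obtain ⟨-, hlc, h₀, -, -⟩ := he
    have hI := hlc Complex.I (by simp) u₀ v₀ h₀
    obtain ⟨l, hl⟩ := IsSolution.exists_tendsto_wronskian hq h₀ hc hI (hlc z hz _ _ hc)
    obtain ⟨l', hl'⟩ := IsSolution.exists_tendsto_wronskian hq h₀ hs hI (hlc z hz _ _ hs)
    obtain ⟨α, β, hαβ, h0⟩ := exists_pair_ne_zero l l'
    refine ⟨(_, _), IsSolution.lincomb hq hc hs α β, hnz hαβ, ?_⟩
    have := (hl.const_mul α).add (hl'.const_mul β)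
    rw [h0] at this
    refine this.congr fun x => ?_
    ring

theorem IsWeylSolution.im_nonneg {e : EndCondition} (he : e.Admissible q) (hz : 0 < z.im)
    {p : (ℝ → ℂ) × (ℝ → ℂ)} (hp : IsWeylSolution q e z p) {x : ℝ} (hx : 0 ≤ x)
    (hxb : (x : EReal) < e.endpoint) : 0 ≤ (p.2 x * starRingEnd ℂ (p.1 x)).im := by
  have hq := he.isIntegrableUpTo
  obtain ⟨h, hne, hh⟩ := hp
  cases e with
  | finite b c => exact h.im_nonneg_of_finite he.1 hq hz hh hx (EReal.coe_lt_coe_iff.1 hxb)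
  | squareIntegrable =>
    rcases he.2 with hbd | hlp
    · exact IsSolution.im_nonneg_of_isEssBddBelow hbd hq h hz hh hx
    · exact IsSolution.im_nonneg_of_isLimitPoint hlp hq h hz hh hx
  | limitCircle u₀ v₀ =>
    obtain ⟨-, hlc, h₀, hne₀, hsa⟩ := he
    exact IsSolution.im_nonneg_of_limitCircle hlc hq h₀ hne₀ hsa h hz hh hx

end HalfLine

end

/-! ### A priori bounds -/

noncomputable section

namespace HalfLine

variable {q : ℝ → ℝ} {b : EReal} {κ : ℂ} {u v : ℝ → ℂ}

theorem norm_exp_mul_ofReal (κ : ℂ) (x : ℝ) : ‖Complex.exp (κ * x)‖ = Real.exp (κ.re * x) := by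
  rw [Complex.norm_exp, Complex.re_mul_ofReal]

namespace IsSolution

theorem hasDerivWithinAt_Ici {z : ℂ} (h : IsSolution q b z u v) {x : ℝ} (hx : 0 ≤ x)
    (hxb : (x : EReal) < b) : HasDerivWithinAt u (v x) (Ici x) x := by
  obtain ⟨X, hxX, hXb⟩ := EReal.lt_iff_exists_real_btwn.1 hxb
  have hxX : x < X := by exact_mod_cast hxX
  have hv : ContinuousOn v (Icc 0 X) := h.continuousOn_snd.mono fun y hy =>
    ⟨hy.1, lt_of_le_of_lt (by exact_mod_cast hy.2) hXb⟩
  have hp := h.primitive_fst (hx.trans hxX.le) hXb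
  have hsub : Ioo x X ⊆ Icc 0 X := fun y hy => ⟨hx.trans hy.1.le, hy.2.le⟩
  have h1 : HasDerivWithinAt (fun y => u 0 + ∫ t in (0 : ℝ)..y, v t) (v x) (Ici x) x := by
    refine HasDerivWithinAt.const_add _
      (intervalIntegral.integral_hasDerivWithinAt_right (t := Ioi x) ?_ ?_ ?_)
    · exact (hp.mono hx hxX.le).intervalIntegrable
    · rw [← nhdsWithin_Ioo_eq_nhdsGT hxX]
      exact ⟨Ioo x X, self_mem_nhdsWithin, (hv.mono hsub).aestronglyMeasurable measurableSet_Ioo⟩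
    · rw [ContinuousWithinAt, ← nhdsWithin_Ioo_eq_nhdsGT hxX]
      exact (hv x ⟨hx, hxX.le⟩).mono hsub
  refine h1.congr_of_eventuallyEq ?_ (hp.eq_add x ⟨hx, hxX.le⟩)
  filter_upwards [Ico_mem_nhdsGE hxX] with y hy using hp.eq_add y ⟨hx.trans hy.1, hy.2.le⟩

theorem primitive_exp_neg (h : IsSolution q b (-κ ^ 2) u v) (hq : IsIntegrableUpTo q b) {X : ℝ}
    (hX : 0 ≤ X) (hXb : (X : EReal) < b) :
    IsPrimitiveOn (fun x => Complex.exp (-κ * x) * (v x + κ * u x))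
      (fun x => Complex.exp (-κ * x) * (q x * u x)) X := by
  refine (((h.primitive_snd hq hX hXb).add ((h.primitive_fst hX hXb).const_mul κ)).exp_mul
    hX (-κ)).congr_right hX fun x _ => ?_
  ring

theorem primitive_exp (h : IsSolution q b (-κ ^ 2) u v) (hq : IsIntegrableUpTo q b) {X : ℝ}
    (hX : 0 ≤ X) (hXb : (X : EReal) < b) :
    IsPrimitiveOn (fun x => Complex.exp (κ * x) * (v x - κ * u x))
      (fun x => Complex.exp (κ * x) * (q x * u x)) X := by
  refine (((h.primitive_snd hq hX hXb).sub ((h.primitive_fst hX hXb).const_mul κ)).exp_mul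
    hX κ).congr_right hX fun x _ => ?_
  ring

/-- Since `Im ((w - κ y) ȳ) ≥ -Im κ |y|²`, the vector `w - κ y` cannot be small compared with `y`.
The constant `L` measures the distance of `κ` from the real axis. -/
theorem norm_le_of_im_nonneg {w y : ℂ} {L : ℝ} (hL : ‖κ‖ ≤ L * -κ.im) (hκ : κ.im < 0)
    (him : 0 ≤ (w * starRingEnd ℂ y).im) : ‖κ‖ * ‖y‖ ≤ L * ‖w - κ * y‖ := by
  have hL0 : 0 ≤ L := by
    by_contra hcon
    push Not at hcon
    nlinarith [norm_nonneg κ]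
  rcases eq_or_ne y 0 with rfl | hy
  · simp; positivity
  have hy' := norm_pos_iff.2 hy
  have h1 : ((w - κ * y) * starRingEnd ℂ y).im =
      (w * starRingEnd ℂ y).im - κ.im * ‖y‖ ^ 2 := by
    rw [sub_mul, mul_assoc, Complex.mul_conj, Complex.normSq_eq_norm_sq, Complex.sub_im,
      Complex.im_mul_ofReal]
  have h2 : ((w - κ * y) * starRingEnd ℂ y).im ≤ ‖w - κ * y‖ * ‖y‖ := by
    refine (le_abs_self _).trans ((Complex.abs_im_le_norm _).trans ?_)
    rw [norm_mul, RCLike.norm_conj]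
  have h3 : -κ.im * ‖y‖ ≤ ‖w - κ * y‖ := by
    have : (-κ.im * ‖y‖) * ‖y‖ ≤ ‖w - κ * y‖ * ‖y‖ := by nlinarith
    exact le_of_mul_le_mul_right this hy'
  calc ‖κ‖ * ‖y‖ ≤ L * -κ.im * ‖y‖ := by gcongr
    _ = L * (-κ.im * ‖y‖) := by ring
    _ ≤ _ := by gcongr

/-- A solution with `Im (u' ū) ≥ 0` is nearly proportional to `exp (-κ x)`. -/
theorem norm_add_le_mul (h : IsSolution q b (-κ ^ 2) u v) (hq : IsIntegrableUpTo q b)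
    {a c L : ℝ} (ha : 0 ≤ a) (hac : a < c) (hcb : (c : EReal) < b)
    (him : ∀ x ∈ Icc 0 c, 0 ≤ (v x * starRingEnd ℂ (u x)).im)
    (hL : 0 < L) (hL₁ : ‖κ‖ ≤ L * -κ.im) (hL₂ : ‖κ‖ ≤ L * κ.re)
    (hκ : 2 * ((1 + 2 * L) * L / (c - a) + 2 * L * ∫ t in (0 : ℝ)..c, |q t|) ≤ ‖κ‖) :
    ∀ x ∈ Icc 0 a, ‖v x + κ * u x‖ ≤
      4 * ((1 + 2 * L) * L / (c - a) + 2 * L * ∫ t in (0 : ℝ)..c, |q t|) * ‖u x‖ := by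
  have hc0 : 0 ≤ c := ha.trans hac.le
  have hδ : 0 < c - a := by linarith
  have hqi := hq.intervalIntegrable hc0 hcb
  set Q := ∫ t in (0 : ℝ)..c, |q t| with hQ
  have hQ0 : 0 ≤ Q := intervalIntegral.integral_nonneg hc0 fun _ _ => abs_nonneg _
  set E := (1 + 2 * L) * L / (c - a) + 2 * L * Q with hE
  have hE0 : 0 < E := by positivity
  have hκ0 : 0 < ‖κ‖ := by linarith
  have hre : 0 < κ.re := pos_of_mul_pos_right (hκ0.trans_le hL₂) hL.le
  have him0 : κ.im < 0 := neg_pos.1 (pos_of_mul_pos_right (hκ0.trans_le hL₁) hL.le)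
  set K := L * Q / ‖κ‖ with hK
  have hK0 : 0 ≤ K := by positivity
  have hK2 : K ≤ 1 / 2 := by
    rw [hK, div_le_iff₀ hκ0]
    have : 0 ≤ (1 + 2 * L) * L / (c - a) := by positivity
    nlinarith
  have hu : ∀ x ∈ Icc 0 c, ‖u x‖ ≤ L / ‖κ‖ * ‖v x - κ * u x‖ := by
    intro x hx
    rw [div_mul_eq_mul_div, le_div_iff₀ hκ0, mul_comm]
    exact norm_le_of_im_nonneg hL₁ him0 (him x hx)
  have hpn : ∀ x ∈ Icc 0 c, ‖v x + κ * u x‖ ≤ (1 + 2 * L) * ‖v x - κ * u x‖ := by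
    intro x hx
    have e : v x + κ * u x = (v x - κ * u x) + 2 * (κ * u x) := by ring
    have h1 := norm_le_of_im_nonneg hL₁ him0 (him x hx)
    calc ‖v x + κ * u x‖ ≤ ‖v x - κ * u x‖ + ‖2 * (κ * u x)‖ := by rw [e]; exact norm_add_le _ _
      _ = ‖v x - κ * u x‖ + 2 * (‖κ‖ * ‖u x‖) := by rw [norm_mul, norm_mul]; norm_num
      _ ≤ _ := by linarith
  have hqint : ∀ x ∈ Icc 0 c, ∀ y ∈ Icc 0 c, x ≤ y → ∫ t in x..y, |q t| ≤ Q := by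
    intro x hx y hy hxy
    exact intervalIntegral.integral_mono_interval hx.1 hxy hy.2
      (ae_of_all _ fun _ => abs_nonneg _) hqi.abs
  have hbound : ∀ x ∈ Icc 0 c, ∀ y ∈ Icc 0 c, x ≤ y → ∀ (g : ℝ → ℂ) (B : ℝ), 0 ≤ B →
      (∀ t ∈ Icc x y, ‖g t‖ ≤ |q t| * (L / ‖κ‖ * B)) → ‖∫ t in x..y, g t‖ ≤ K * B := by
    intro x hx y hy hxy g B hB hg
    have hi : IntervalIntegrable (fun t => |q t| * (L / ‖κ‖ * B)) volume x y :=
      (hqi.abs.mono_set (by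
        rw [uIcc_of_le hc0]; exact ordConnected_Icc.uIcc_subset hx hy)).mul_const _
    calc ‖∫ t in x..y, g t‖ ≤ ∫ t in x..y, |q t| * (L / ‖κ‖ * B) :=
          intervalIntegral.norm_integral_le_of_norm_le hxy
            (ae_of_all _ fun t ht => hg t ⟨ht.1.le, ht.2⟩) hi
      _ = (∫ t in x..y, |q t|) * (L / ‖κ‖ * B) := intervalIntegral.integral_mul_const _ _
      _ ≤ Q * (L / ‖κ‖ * B) := by gcongr; exact hqint x hx y hy hxy
      _ = K * B := by rw [hK]; ring
  have hP := h.primitive_exp_neg hq hc0 hcb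
  have hN := h.primitive_exp hq hc0 hcb
  -- The component `v - κ u` decays like `exp (-κ t)`: up to the maximum point of `exp (Re κ t) |v -
  -- κ u|` on `[x, c]` the increment is at most `K ≤ 1/2` times the maximum, so the maximum is at
  -- most twice the value at `x`.
  have hn : ∀ x ∈ Icc 0 c, ∀ t ∈ Icc x c, Real.exp (κ.re * t) * ‖v t - κ * u t‖ ≤
      2 * (Real.exp (κ.re * x) * ‖v x - κ * u x‖) := by
    intro x hx
    have hcont : ContinuousOn (fun t : ℝ => ‖Complex.exp (κ * t) * (v t - κ * u t)‖) (Icc x c) :=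
      (hN.continuousOn.mono (Icc_subset_Icc_left hx.1)).norm
    obtain ⟨m, hm, hmax⟩ := isCompact_Icc.exists_isMaxOn (nonempty_Icc.2 hx.2) hcont
    have hm0 : m ∈ Icc 0 c := ⟨hx.1.trans hm.1, hm.2⟩
    simp only [IsMaxOn, IsMaxFilter, eventually_principal, norm_mul, norm_exp_mul_ofReal] at hmax
    have h1 := hN.sub_eq hx hm0
    have h2 := hbound x hx m hm0 hm.1 (fun t => Complex.exp (κ * t) * (q t * u t))
      (Real.exp (κ.re * m) * ‖v m - κ * u m‖) (by positivity) (by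
        intro t ht
        have ht0 : t ∈ Icc 0 c := ⟨hx.1.trans ht.1, ht.2.trans hm.2⟩
        rw [norm_mul, norm_mul, norm_exp_mul_ofReal, Complex.norm_real, Real.norm_eq_abs]
        have h3 := hmax t ⟨ht.1, ht.2.trans hm.2⟩
        calc Real.exp (κ.re * t) * (|q t| * ‖u t‖)
            ≤ Real.exp (κ.re * t) * (|q t| * (L / ‖κ‖ * ‖v t - κ * u t‖)) := by
              gcongr; exact hu t ht0
          _ = |q t| * (L / ‖κ‖ * (Real.exp (κ.re * t) * ‖v t - κ * u t‖)) := by ring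
          _ ≤ _ := by gcongr)
    rw [← h1] at h2
    have h4 := norm_sub_norm_le (Complex.exp (κ * m) * (v m - κ * u m))
      (Complex.exp (κ * x) * (v x - κ * u x))
    rw [norm_mul, norm_mul, norm_exp_mul_ofReal, norm_exp_mul_ofReal] at h4
    intro t ht
    have h5 := hmax t ht
    have h6 : 0 ≤ Real.exp (κ.re * m) * ‖v m - κ * u m‖ := by positivity
    nlinarith
  -- The growing component `v + κ u` is integrated backwards from `c`, where it is comparable with
  -- `v - κ u`, which is already small there.
  have hp : ∀ x ∈ Icc 0 a, ‖v x + κ * u x‖ ≤ E / ‖κ‖ * ‖v x - κ * u x‖ := by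
    intro x hx
    have hx' : x ∈ Icc 0 c := ⟨hx.1, hx.2.trans hac.le⟩
    have hc' : c ∈ Icc 0 c := ⟨hc0, le_rfl⟩
    have h1 := hP.sub_eq hx' hc'
    have hexp : ∀ t, Real.exp (-κ.re * t) * Real.exp (κ.re * t) = 1 := fun t => by
      rw [← Real.exp_add]; simp
    have h2 := hbound x hx' c hc' hx'.2 (fun t => Complex.exp (-κ * t) * (q t * u t))
      (2 * (Real.exp (-κ.re * x) * ‖v x - κ * u x‖)) (by positivity) (by
        intro t ht
        have ht0 : t ∈ Icc 0 c := ⟨hx.1.trans ht.1, ht.2⟩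
        rw [norm_mul, norm_mul, norm_exp_mul_ofReal, Complex.norm_real, Real.norm_eq_abs,
          Complex.neg_re]
        have h3 := hn x hx' t ht
        have hmono : Real.exp (-κ.re * t) ≤ Real.exp (-κ.re * x) :=
          Real.exp_le_exp.2 (by nlinarith [ht.1])
        have h4 : Real.exp (-κ.re * t) * ‖v t - κ * u t‖ ≤
            2 * (Real.exp (-κ.re * x) * ‖v x - κ * u x‖) := by
          have e1 : ‖v t - κ * u t‖ = Real.exp (-κ.re * t) *
              (Real.exp (κ.re * t) * ‖v t - κ * u t‖) := by rw [← mul_assoc, hexp, one_mul]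
          calc Real.exp (-κ.re * t) * ‖v t - κ * u t‖
              = Real.exp (-κ.re * t) * (Real.exp (-κ.re * t) *
                (Real.exp (κ.re * t) * ‖v t - κ * u t‖)) := by rw [← e1]
            _ ≤ Real.exp (-κ.re * x) * (Real.exp (-κ.re * x) *
                (2 * (Real.exp (κ.re * x) * ‖v x - κ * u x‖))) := by gcongr
            _ = Real.exp (-κ.re * x) * (2 * ‖v x - κ * u x‖) *
                (Real.exp (-κ.re * x) * Real.exp (κ.re * x)) := by ring
            _ = _ := by rw [hexp]; ring
        calc Real.exp (-κ.re * t) * (|q t| * ‖u t‖)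
            ≤ Real.exp (-κ.re * t) * (|q t| * (L / ‖κ‖ * ‖v t - κ * u t‖)) := by
              gcongr; exact hu t ht0
          _ = |q t| * (L / ‖κ‖ * (Real.exp (-κ.re * t) * ‖v t - κ * u t‖)) := by ring
          _ ≤ _ := by gcongr)
    rw [← h1] at h2
    have h3 := norm_sub_norm_le (Complex.exp (-κ * x) * (v x + κ * u x))
      (Complex.exp (-κ * c) * (v c + κ * u c))
    rw [norm_sub_rev, norm_mul, norm_mul, norm_exp_mul_ofReal, norm_exp_mul_ofReal,
      Complex.neg_re] at h3
    have h4 := hn x hx' c ⟨hx'.2, le_rfl⟩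
    have h5 := hpn c hc'
    set w := ‖v x - κ * u x‖ with hw
    have hw0 : 0 ≤ w := norm_nonneg _
    have h6 : Real.exp (-κ.re * c) * ‖v c + κ * u c‖ ≤
        Real.exp (-κ.re * x) * (2 * (1 + 2 * L) * Real.exp (-(2 * κ.re * (c - x))) * w) := by
      have e1 : ‖v c - κ * u c‖ ≤ Real.exp (-κ.re * c) * (2 * (Real.exp (κ.re * x) * w)) := by
        calc ‖v c - κ * u c‖ = Real.exp (-κ.re * c) *
              (Real.exp (κ.re * c) * ‖v c - κ * u c‖) := by rw [← mul_assoc, hexp, one_mul]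
          _ ≤ _ := by gcongr
      have e2 : Real.exp (-(2 * κ.re * (c - x))) * Real.exp (-κ.re * x) =
          Real.exp (-κ.re * c) * Real.exp (-κ.re * c) * Real.exp (κ.re * x) := by
        rw [← Real.exp_add, ← Real.exp_add, ← Real.exp_add]; congr 1; ring
      calc Real.exp (-κ.re * c) * ‖v c + κ * u c‖
          ≤ Real.exp (-κ.re * c) * ((1 + 2 * L) *
            (Real.exp (-κ.re * c) * (2 * (Real.exp (κ.re * x) * w)))) := by
            gcongr; exact h5.trans (by gcongr)
        _ = 2 * (1 + 2 * L) * w * (Real.exp (-κ.re * c) * Real.exp (-κ.re * c) *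
            Real.exp (κ.re * x)) := by ring
        _ = _ := by rw [← e2]; ring
    -- The room between `a` and `c` enters here: `t exp (-t) ≤ 1` with `t = 2 Re κ (c - x)` trades
    -- the exponential for a factor `1 / |κ|`.
    have h7 : Real.exp (-(2 * κ.re * (c - x))) ≤ L / (2 * (c - a) * ‖κ‖) := by
      have hy : 0 < 2 * κ.re * (c - x) := by
        have := hx.2
        have : 0 < c - x := by linarith
        positivity
      have e1 : 2 * κ.re * (c - x) * Real.exp (-(2 * κ.re * (c - x))) ≤ 1 := by
        have := Real.add_one_le_exp (2 * κ.re * (c - x))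
        rw [Real.exp_neg, ← div_eq_mul_inv, div_le_one (Real.exp_pos _)]
        linarith
      rw [le_div_iff₀ (by positivity)]
      set r := Real.exp (-(2 * κ.re * (c - x)))
      have hr : 0 < r := Real.exp_pos _
      calc r * (2 * (c - a) * ‖κ‖) ≤ r * (2 * (c - x) * (L * κ.re)) := by
            have := hx.2
            have : 0 ≤ 2 * (c - x) := by linarith
            gcongr
        _ = L * (2 * κ.re * (c - x) * r) := by ring
        _ ≤ L * 1 := by gcongr
        _ = L := mul_one L
    have h8 : Real.exp (-κ.re * x) * ‖v x + κ * u x‖ ≤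
        Real.exp (-κ.re * x) * (E / ‖κ‖ * w) := by
      have e1 : 2 * (1 + 2 * L) * Real.exp (-(2 * κ.re * (c - x))) * w ≤
          2 * (1 + 2 * L) * (L / (2 * (c - a) * ‖κ‖)) * w := by gcongr
      have e2 : E / ‖κ‖ * w = 2 * (1 + 2 * L) * (L / (2 * (c - a) * ‖κ‖)) * w + 2 * K * w := by
        rw [hE, hK]; field_simp
      have e3 := mul_le_mul_of_nonneg_left e1 (Real.exp_pos (-κ.re * x)).le
      rw [e2]
      linarith
    exact le_of_mul_le_mul_left h8 (Real.exp_pos _)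
  intro x hx
  have h1 := hp x hx
  have h2 : ‖v x - κ * u x‖ ≤ ‖v x + κ * u x‖ + 2 * (‖κ‖ * ‖u x‖) := by
    have e : v x - κ * u x = (v x + κ * u x) - 2 * (κ * u x) := by ring
    rw [e]
    refine (norm_sub_le _ _).trans (le_of_eq ?_)
    rw [norm_mul, norm_mul]; norm_num
  -- With this, the `v + κ u` part of `v - κ u = (v + κ u) - 2 κ u` can be absorbed on the left.
  have h3 : E / ‖κ‖ ≤ 1 / 2 := by rw [div_le_iff₀ hκ0]; linarith
  have h4 : E / ‖κ‖ * ‖v x - κ * u x‖ ≤ 1 / 2 * ‖v x + κ * u x‖ + E / ‖κ‖ * (2 * (‖κ‖ * ‖u x‖)) := by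
    calc _ ≤ E / ‖κ‖ * (‖v x + κ * u x‖ + 2 * (‖κ‖ * ‖u x‖)) := by gcongr
      _ = E / ‖κ‖ * ‖v x + κ * u x‖ + E / ‖κ‖ * (2 * (‖κ‖ * ‖u x‖)) := by ring
      _ ≤ _ := by gcongr
  have h5 : E / ‖κ‖ * (2 * (‖κ‖ * ‖u x‖)) = 2 * E * ‖u x‖ := by field_simp
  linarith

/-- Gronwall for `exp (κ x) u`, whose derivative is `exp (κ x) (v + κ u)`. -/
theorem norm_le_mul_exp {z : ℂ} (h : IsSolution q b z u v) {a M : ℝ} (ha : 0 ≤ a)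
    (hab : (a : EReal) < b) (hM : ∀ x ∈ Icc 0 a, ‖v x + κ * u x‖ ≤ M * ‖u x‖) :
    ‖u a‖ ≤ ‖u 0‖ * Real.exp ((M - κ.re) * a) := by
  have hlt : ∀ x : ℝ, x ≤ a → (x : EReal) < b := fun x hx =>
    lt_of_le_of_lt (by exact_mod_cast hx) hab
  have hc : ContinuousOn (fun x : ℝ => Complex.exp (κ * x) * u x) (Icc 0 a) :=
    (by fun_prop : Continuous fun x : ℝ => Complex.exp (κ * x)).continuousOn.mul
      (h.primitive_fst ha hab).continuousOn
  have hd : ∀ x ∈ Ico 0 a, HasDerivWithinAt (fun x : ℝ => Complex.exp (κ * x) * u x)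
      (Complex.exp (κ * x) * (v x + κ * u x)) (Ici x) x := by
    intro x hx
    have h1 := ((Complex.ofRealCLM.hasDerivAt (x := x)).const_mul κ).cexp.hasDerivWithinAt (s := Ici x)
    have h2 := h1.mul (h.hasDerivWithinAt_Ici hx.1 (hlt x hx.2.le))
    refine h2.congr_deriv ?_
    simp
    ring
  have := norm_le_gronwallBound_of_norm_deriv_right_le (δ := ‖u 0‖) (K := M) (ε := 0) hc hd
    (by simp) (fun x hx => by
      rw [norm_mul, norm_mul, add_zero]
      have := hM x ⟨hx.1, hx.2.le⟩
      calc _ ≤ ‖Complex.exp (κ * x)‖ * (M * ‖u x‖) := by gcongr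
        _ = _ := by ring) a ⟨ha, le_rfl⟩
  rw [gronwallBound_ε0, norm_mul, norm_exp_mul_ofReal, sub_zero] at this
  rw [sub_mul, Real.exp_sub, ← mul_div_assoc, le_div_iff₀ (Real.exp_pos _), mul_comm]
  exact this

end IsSolution
end HalfLine

end

/-! ### The transformation kernel and the A-function -/

noncomputable section

namespace HalfLine

section Kernel

variable {q : ℝ → ℝ}

/-- The weight `q` is only integrable, so continuity comes from local boundedness of `Φ` and
dominated convergence. -/
theorem continuous_integral_mul {X : Type*} [TopologicalSpace X] [FirstCountableTopology X]
    [LocallyCompactSpace X] (hq : Integrable q) {Φ : X → ℝ → ℝ} (hΦ : Continuous (Function.uncurry Φ))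
    {l r : X → ℝ} (hl : Continuous l) (hr : Continuous r) :
    Continuous fun p => ∫ y in l p..r p, q y * Φ p y := by
  have hΦp : ∀ p, Continuous (Φ p) := fun p => hΦ.comp (by fun_prop : Continuous fun y => (p, y))
  have key : Continuous fun w : X × ℝ => ∫ y in (0 : ℝ)..w.2, q y * Φ w.1 y := by
    rw [continuous_iff_continuousAt]
    rintro ⟨p₀, r₀⟩
    obtain ⟨K, hK, hKp⟩ := exists_compact_mem_nhds p₀
    set R := |r₀| + 1
    have hr₀ := abs_lt.1 (by simp [R] : |r₀| < R)
    have hR : 0 < R := by positivity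
    obtain ⟨C, hC⟩ := (hK.prod (isCompact_Icc (a := -R) (b := R))).exists_bound_of_continuousOn
      hΦ.continuousOn
    refine intervalIntegral.continuousAt_parametric_primitive_of_dominated
      (F := fun p y => q y * Φ p y) (fun y => |q y| * C) (-R) R
      (fun p => (hq.aestronglyMeasurable.mul (hΦp p).aestronglyMeasurable).restrict) ?_
      (hq.abs.mul_const C).intervalIntegrable ?_ ⟨by linarith, hR⟩ hr₀ (by simp)
    · filter_upwards [hKp] with p hp
      rw [ae_restrict_iff' measurableSet_uIoc]
      refine ae_of_all _ fun y hy => ?_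
      rw [uIoc_of_le (by linarith)] at hy
      rw [norm_mul, Real.norm_eq_abs]
      gcongr
      exact hC (p, y) ⟨hp, hy.1.le, hy.2⟩
    · refine ae_of_all _ fun y => ContinuousAt.mul continuousAt_const ?_
      exact (hΦ.comp (by fun_prop : Continuous fun p : X => (p, y))).continuousAt
  have hi : ∀ p a b, IntervalIntegrable (fun y => q y * Φ p y) volume a b := fun p a b =>
    hq.intervalIntegrable.mul_continuousOn (hΦp p).continuousOn
  have e : (fun p => ∫ y in l p..r p, q y * Φ p y) = fun p =>
      (∫ y in (0 : ℝ)..r p, q y * Φ p y) - ∫ y in (0 : ℝ)..l p, q y * Φ p y := by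
    funext p
    rw [intervalIntegral.integral_interval_sub_left (hi _ _ _) (hi _ _ _)]
  rw [e]
  exact (key.comp (by fun_prop : Continuous fun p => (p, r p))).sub
    (key.comp (by fun_prop : Continuous fun p => (p, l p)))

theorem abs_integral_mul_le (hq : Integrable q) {g : ℝ → ℝ} {x y B : ℝ} (hB : 0 ≤ B)
    (hg : ∀ t ∈ uIoc x y, |g t| ≤ B) : |∫ t in x..y, q t * g t| ≤ (∫ t, |q t|) * B := by
  rw [← Real.norm_eq_abs]
  calc ‖∫ t in x..y, q t * g t‖ ≤ ∫ t in uIoc x y, ‖q t * g t‖ :=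
        intervalIntegral.norm_integral_le_integral_norm_uIoc
    _ ≤ ∫ t in uIoc x y, |q t| * B := by
        refine integral_mono_of_nonneg (ae_of_all _ fun t => norm_nonneg _)
          (hq.abs.mul_const B).integrableOn
          (ae_restrict_of_forall_mem measurableSet_uIoc fun t ht => ?_)
        beta_reduce
        rw [norm_mul, Real.norm_eq_abs, Real.norm_eq_abs]
        gcongr
        exact hg t ht
    _ ≤ ∫ t, |q t| * B := setIntegral_le_integral (hq.abs.mul_const B)
        (ae_of_all _ fun t => by positivity)
    _ = _ := integral_mul_const _ _

/-- The terms of the Neumann series of the transformation kernel. -/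
def kernelTerm (q : ℝ → ℝ) : ℕ → ℝ → ℝ → ℝ
  | 0 => fun x η => -(1 / 2) * ∫ y in η..(x + η), q y
  | n + 1 => fun x η => -∫ s in (0 : ℝ)..η, ∫ y in s..(x + s), q y * kernelTerm q n y (η - s)

theorem continuous_inner_integral (hq : Integrable q) {V : ℝ → ℝ → ℝ}
    (hV : Continuous (Function.uncurry V)) :
    Continuous fun w : (ℝ × ℝ) × ℝ => ∫ y in w.2..(w.1.1 + w.2), q y * V y (w.1.2 - w.2) :=
  continuous_integral_mul hq (Φ := fun (w : (ℝ × ℝ) × ℝ) y => V y (w.1.2 - w.2))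
    (hV.comp (by fun_prop : Continuous fun p : ((ℝ × ℝ) × ℝ) × ℝ => (p.2, p.1.1.2 - p.1.2)))
    (by fun_prop) (by fun_prop)

theorem continuous_kernelTerm (hq : Integrable q) (n : ℕ) :
    Continuous (Function.uncurry (kernelTerm q n)) := by
  induction n with
  | zero =>
    have := continuous_integral_mul (X := ℝ × ℝ) hq (Φ := fun _ _ => 1) continuous_const
      (l := fun p => p.2) (r := fun p => p.1 + p.2) (by fun_prop) (by fun_prop)
    simp only [mul_one] at this
    exact continuous_const.mul this
  | succ n ih =>
    exact (intervalIntegral.continuous_parametric_intervalIntegral_of_continuous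
      (f := fun (w : ℝ × ℝ) s => ∫ y in s..(w.1 + s), q y * kernelTerm q n y (w.2 - s))
      (continuous_inner_integral hq ih) continuous_snd).neg

/-- Each iteration costs a factor `Q` from the `y` integral and one integration of `|η - s|^n`,
which supplies the factorial. The bound is uniform in `x`. -/
theorem abs_kernelTerm_le (hq : Integrable q) (n : ℕ) (x η : ℝ) :
    |kernelTerm q n x η| ≤ (∫ t, |q t|) / 2 * (((∫ t, |q t|) * |η|) ^ n / n.factorial) := by
  have hQ : 0 ≤ ∫ t, |q t| := integral_nonneg fun _ => abs_nonneg _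
  induction n generalizing x η with
  | zero =>
    have := abs_integral_mul_le hq (g := fun _ => 1) (x := η) (y := x + η) zero_le_one
      (fun t _ => by simp)
    simp only [mul_one] at this
    simp only [kernelTerm, abs_mul, abs_neg]
    norm_num
    linarith
  | succ n ih =>
    set Q := ∫ t, |q t| with hQdef
    simp only [kernelTerm, abs_neg]
    calc _ ≤ ∫ s in uIoc 0 η, ‖∫ y in s..(x + s), q y * kernelTerm q n y (η - s)‖ :=
          intervalIntegral.norm_integral_le_integral_norm_uIoc
      _ ≤ ∫ s in uIoc η 0, Q * Q / 2 * (Q ^ n / n.factorial) * |s - η| ^ n := by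
          rw [uIoc_comm]
          refine integral_mono_of_nonneg (ae_of_all _ fun s => norm_nonneg _) ?_
            (ae_of_all _ fun s => ?_)
          · refine (Continuous.intervalIntegrable ?_ η 0).def'
            fun_prop
          · have := abs_integral_mul_le hq (g := fun y => kernelTerm q n y (η - s)) (x := s)
              (y := x + s) (by positivity) (fun t _ => ih t (η - s))
            refine this.trans (le_of_eq ?_)
            rw [abs_sub_comm, mul_pow]
            ring
      _ = Q * Q / 2 * (Q ^ n / n.factorial) * (|η| ^ (n + 1) / (n + 1)) := by
          rw [integral_const_mul, integral_pow_abs_sub_uIoc, zero_sub, abs_neg]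
      _ = _ := by
          rw [Nat.factorial_succ, mul_pow]
          push_cast
          field_simp
          ring

/-- The kernel `V` for which `exp (-κ x) (1 + 2 ∫₀^∞ V x η exp (-2 κ η) dη)` is the solution of
`-u'' + q u = -κ² u` that is normalized at `0` and decays at infinity. -/
def transKernel (q : ℝ → ℝ) (x η : ℝ) : ℝ := ∑' n, kernelTerm q n x η

theorem hasSum_kernelTerm (hq : Integrable q) (x η : ℝ) :
    HasSum (fun n => kernelTerm q n x η) (transKernel q x η) :=
  (Summable.of_norm_bounded ((Real.summable_pow_div_factorial _).mul_left _)
    (fun n => abs_kernelTerm_le hq n x η)).hasSum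

theorem abs_transKernel_le (hq : Integrable q) (x η : ℝ) :
    |transKernel q x η| ≤ (∫ t, |q t|) / 2 * Real.exp ((∫ t, |q t|) * |η|) := by
  have h1 : HasSum (fun n : ℕ => ((∫ t, |q t|) * |η|) ^ n / n.factorial)
      (Real.exp ((∫ t, |q t|) * |η|)) := by
    rw [Real.exp_eq_exp_ℝ]; exact NormedSpace.expSeries_div_hasSum_exp _
  rw [← Real.norm_eq_abs]
  exact tsum_of_norm_bounded (h1.mul_left _) fun n => abs_kernelTerm_le hq n x η

theorem continuous_transKernel (hq : Integrable q) :
    Continuous (Function.uncurry (transKernel q)) := by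
  have hQ : 0 ≤ ∫ t, |q t| := integral_nonneg fun _ => abs_nonneg _
  rw [continuous_iff_continuousAt]
  rintro ⟨x, η⟩
  have hs : {p : ℝ × ℝ | |p.2| < |η| + 1} ∈ 𝓝 (x, η) :=
    (isOpen_lt (by fun_prop) continuous_const).mem_nhds (by simp)
  refine ContinuousOn.continuousAt (s := {p : ℝ × ℝ | |p.2| < |η| + 1}) ?_ hs
  refine continuousOn_tsum (f := fun n => Function.uncurry (kernelTerm q n))
    (fun n => (continuous_kernelTerm hq n).continuousOn)
    ((Real.summable_pow_div_factorial ((∫ t, |q t|) * (|η| + 1))).mul_left ((∫ t, |q t|) / 2))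
    fun n p hp => (abs_kernelTerm_le hq n p.1 p.2).trans ?_
  have : |p.2| ≤ |η| + 1 := le_of_lt hp
  gcongr

theorem transKernel_eq (hq : Integrable q) (x η : ℝ) :
    transKernel q x η = -(1 / 2) * (∫ y in η..(x + η), q y) -
      ∫ s in (0 : ℝ)..η, ∫ y in s..(x + s), q y * transKernel q y (η - s) := by
  have hQ : 0 ≤ ∫ t, |q t| := integral_nonneg fun _ => abs_nonneg _
  set Q := ∫ t, |q t| with hQdef
  have hsum : Summable fun n : ℕ => Q / 2 * ((Q * |η|) ^ n / n.factorial) :=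
    (Real.summable_pow_div_factorial _).mul_left _
  have hb : ∀ s ∈ uIoc 0 η, ∀ n y, |kernelTerm q n y (η - s)| ≤
      Q / 2 * ((Q * |η|) ^ n / n.factorial) := by
    intro s hs n y
    refine (abs_kernelTerm_le hq n y (η - s)).trans ?_
    have : |η - s| ≤ |η| := by
      simpa [abs_sub_comm] using abs_sub_right_of_mem_uIcc (uIoc_subset_uIcc hs)
    gcongr
  have inner : ∀ s ∈ uIoc 0 η, HasSum
      (fun n => ∫ y in s..(x + s), q y * kernelTerm q n y (η - s))
      (∫ y in s..(x + s), q y * transKernel q y (η - s)) := by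
    intro s hs
    refine intervalIntegral.hasSum_integral_of_dominated_convergence
      (fun n y => |q y| * (Q / 2 * ((Q * |η|) ^ n / n.factorial))) ?_ ?_ ?_ ?_ ?_
    · intro n
      have : Continuous fun y => kernelTerm q n y (η - s) :=
        (continuous_kernelTerm hq n).comp (by fun_prop : Continuous fun y : ℝ => (y, η - s))
      exact (hq.aestronglyMeasurable.mul this.aestronglyMeasurable).restrict
    · refine fun n => ae_of_all _ fun y _ => ?_
      rw [norm_mul, Real.norm_eq_abs]
      gcongr
      exact hb s hs n y
    · exact ae_of_all _ fun y _ => hsum.mul_left _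
    · simp_rw [tsum_mul_left]
      exact (hq.abs.mul_const _).intervalIntegrable
    · exact ae_of_all _ fun y _ => (hasSum_kernelTerm hq y (η - s)).mul_left _
  have outer : HasSum (fun n => ∫ s in (0 : ℝ)..η, ∫ y in s..(x + s), q y * kernelTerm q n y (η - s))
      (∫ s in (0 : ℝ)..η, ∫ y in s..(x + s), q y * transKernel q y (η - s)) := by
    refine intervalIntegral.hasSum_integral_of_dominated_convergence
      (fun n _ => Q * (Q / 2 * ((Q * |η|) ^ n / n.factorial))) ?_ ?_ ?_ ?_ ?_
    · intro n
      exact ((continuous_inner_integral hq (continuous_kernelTerm hq n)).comp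
        (by fun_prop : Continuous fun s : ℝ => ((x, η), s))).aestronglyMeasurable
    · exact fun n => ae_of_all _ fun s hs => abs_integral_mul_le hq (by positivity)
        fun y _ => hb s hs n y
    · exact ae_of_all _ fun s _ => hsum.mul_left _
    · exact intervalIntegrable_const
    · exact ae_of_all _ fun s hs => inner s hs
  have := HasSum.zero_add (f := fun n => kernelTerm q n x η) outer.neg
  rw [(hasSum_kernelTerm hq x η).unique this, sub_eq_add_neg]
  rfl

/-- Finite propagation: in the recursion `y ≤ x + s`, so the new arguments satisfy `y + (η - s) ≤ x
+ η`. -/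
theorem kernelTerm_congr {q' : ℝ → ℝ} {a : ℝ} (h : ∀ y ∈ Icc 0 a, q y = q' y) (n : ℕ) {x η : ℝ}
    (hx : 0 ≤ x) (hη : 0 ≤ η) (hxη : x + η ≤ a) : kernelTerm q n x η = kernelTerm q' n x η := by
  induction n generalizing x η with
  | zero =>
    simp only [kernelTerm]
    congr 1
    refine intervalIntegral.integral_congr fun y hy => h y ?_
    rw [uIcc_of_le (by linarith)] at hy
    exact ⟨hη.trans hy.1, hy.2.trans hxη⟩
  | succ n ih =>
    simp only [kernelTerm]
    congr 1
    refine intervalIntegral.integral_congr fun s hs => ?_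
    rw [uIcc_of_le hη] at hs
    refine intervalIntegral.integral_congr fun y hy => ?_
    rw [uIcc_of_le (by linarith)] at hy
    have h1 := hs.1
    have h2 := hs.2
    have h3 := hy.1
    have h4 := hy.2
    rw [h y ⟨by linarith, by linarith⟩, ih (by linarith) (by linarith) (by linarith)]

/-- The `A`-function of an integrable potential. -/
def amplitude (q : ℝ → ℝ) (α : ℝ) : ℝ := q α + 2 * ∫ s in (0 : ℝ)..α, q s * transKernel q s (α - s)

/-- The kernel is evaluated only on the line `s + (α - s) = α`, so finite propagation applies. -/
theorem amplitude_congr {q' : ℝ → ℝ} {a α : ℝ} (h : ∀ y ∈ Icc 0 a, q y = q' y) (hα : 0 ≤ α)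
    (hαa : α ≤ a) : amplitude q α = amplitude q' α := by
  simp only [amplitude]
  rw [h α ⟨hα, hαa⟩]
  congr 2
  refine intervalIntegral.integral_congr fun s hs => ?_
  rw [uIcc_of_le hα] at hs
  simp only [transKernel]
  rw [h s ⟨hs.1, hs.2.trans hαa⟩]
  congr 1
  refine tsum_congr fun n => kernelTerm_congr h n hs.1 (by linarith [hs.2]) (by linarith)

theorem continuous_amplitude_sub (hq : Integrable q) : Continuous fun α => amplitude q α - q α := by
  simp only [amplitude, add_sub_cancel_left]
  refine continuous_const.mul (continuous_integral_mul hq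
    (Φ := fun α s => transKernel q s (α - s)) ?_ continuous_const continuous_id)
  exact (continuous_transKernel hq).comp (by fun_prop : Continuous fun p : ℝ × ℝ => (p.2, p.1 - p.2))

theorem abs_amplitude_sub_le (hq : Integrable q) {α : ℝ} (hα : 0 ≤ α) :
    |amplitude q α - q α| ≤ (∫ t, |q t|) ^ 2 * Real.exp (α * ∫ t, |q t|) := by
  have hQ : 0 ≤ ∫ t, |q t| := integral_nonneg fun _ => abs_nonneg _
  simp only [amplitude, add_sub_cancel_left]
  rw [abs_mul, abs_two]
  have := abs_integral_mul_le hq (g := fun s => transKernel q s (α - s)) (x := 0) (y := α)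
    (B := (∫ t, |q t|) / 2 * Real.exp (α * ∫ t, |q t|)) (by positivity) (fun s hs => by
      refine (abs_transKernel_le hq s (α - s)).trans ?_
      rw [uIoc_of_le hα] at hs
      rw [abs_of_nonneg (by linarith [hs.2]), mul_comm α]
      gcongr
      linarith [hs.1])
  nlinarith

end Kernel
end HalfLine

end

/-! ### Laplace transforms -/

noncomputable section

namespace HalfLine

section Laplace

variable {q : ℝ → ℝ} {c : ℂ}

/-- Fubini after the measure preserving shear `(s, η) ↦ (s, η - s)`. This is the convolution theorem
for a kernel that is not a product. -/
theorem integral_Ioi_integral_triangle {Ψ : ℝ → ℝ → ℂ}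
    (hΨ : Integrable (Function.uncurry Ψ) ((volume.restrict (Ioi 0)).prod (volume.restrict (Ioi 0)))) :
    IntegrableOn (fun η => ∫ s in (0 : ℝ)..η, Ψ s (η - s)) (Ioi 0) ∧
    ∫ η in Ioi (0 : ℝ), ∫ s in (0 : ℝ)..η, Ψ s (η - s) =
      ∫ s in Ioi (0 : ℝ), ∫ τ in Ioi (0 : ℝ), Ψ s τ := by
  set S : Set (ℝ × ℝ) := Ioi 0 ×ˢ Ioi 0 with hS
  have hSm : MeasurableSet S := measurableSet_Ioi.prod measurableSet_Ioi
  set H : ℝ × ℝ → ℂ := S.indicator (Function.uncurry Ψ) with hH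
  have hHi : Integrable H := by
    rw [hH, integrable_indicator_iff hSm, IntegrableOn, Measure.volume_eq_prod, hS,
      ← Measure.prod_restrict]
    exact hΨ
  have hmp := measurePreserving_prod_sub (volume : Measure ℝ) (volume : Measure ℝ)
  have hHi' : Integrable (fun p : ℝ × ℝ => H (p.1, p.2 - p.1)) (volume.prod volume) :=
    hmp.integrable_comp_of_integrable hHi
  have h1 : ∀ η, ∫ s, H (s, η - s) = (Ioi (0 : ℝ)).indicator
      (fun η => ∫ s in (0 : ℝ)..η, Ψ s (η - s)) η := by
    intro η
    by_cases hη : 0 < η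
    · rw [indicator_of_mem (mem_Ioi.2 hη), intervalIntegral.integral_of_le hη.le,
        integral_Ioc_eq_integral_Ioo, ← integral_indicator measurableSet_Ioo]
      congr 1; ext s
      by_cases hs : s ∈ Ioo 0 η
      · rw [indicator_of_mem hs, hH, indicator_of_mem (show (s, η - s) ∈ S from
          ⟨hs.1, sub_pos.2 hs.2⟩)]
        rfl
      · rw [indicator_of_notMem hs, hH, indicator_of_notMem]
        exact fun h => hs ⟨h.1, sub_pos.1 h.2⟩
    · rw [indicator_of_notMem (by simpa using hη)]
      have : ∀ s, H (s, η - s) = 0 := fun s => by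
        rw [hH, indicator_of_notMem]
        intro h
        have h1 : 0 < s := h.1
        have h2 : 0 < η - s := h.2
        linarith
      simp [this]
  have h2 : ∀ s, ∫ η, H (s, η - s) = (Ioi (0 : ℝ)).indicator (fun s => ∫ τ in Ioi (0 : ℝ), Ψ s τ) s := by
    intro s
    rw [integral_sub_right_eq_self (fun τ => H (s, τ)) s]
    by_cases hs : 0 < s
    · rw [indicator_of_mem (mem_Ioi.2 hs), ← integral_indicator measurableSet_Ioi]
      congr 1; ext τ
      by_cases hτ : 0 < τ
      · rw [indicator_of_mem (mem_Ioi.2 hτ), hH, indicator_of_mem (show (s, τ) ∈ S from ⟨hs, hτ⟩)]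
        rfl
      · rw [indicator_of_notMem (by simpa using hτ), hH, indicator_of_notMem]
        exact fun h => hτ h.2
    · rw [indicator_of_notMem (by simpa using hs)]
      have : ∀ τ, H (s, τ) = 0 := fun τ => by
        rw [hH, indicator_of_notMem]
        exact fun h => hs h.1
      simp [this]
  constructor
  · rw [← integrable_indicator_iff measurableSet_Ioi]
    refine hHi'.integral_prod_right.congr (ae_of_all _ fun η => ?_)
    exact h1 η
  · rw [← integral_indicator measurableSet_Ioi, ← integral_indicator measurableSet_Ioi]
    simp_rw [← h1, ← h2]
    exact (integral_integral_swap (f := fun s η => H (s, η - s)) hHi').symm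

theorem integrableOn_exp_neg_mul {r : ℝ} (hr : 0 < r) :
    IntegrableOn (fun x : ℝ => Real.exp (-r * x)) (Ioi 0) :=
  integrableOn_exp_mul_Ioi (by linarith) 0

theorem norm_exp_neg_mul (c : ℂ) (x : ℝ) : ‖Complex.exp (-c * x)‖ = Real.exp (-c.re * x) := by
  rw [norm_exp_mul_ofReal, Complex.neg_re]

theorem norm_exp_mul_transKernel_le (hq : Integrable q) (c : ℂ) (x : ℝ) {η : ℝ} (hη : 0 ≤ η) :
    ‖Complex.exp (-c * η) * transKernel q x η‖ ≤
      (∫ t, |q t|) / 2 * Real.exp (-(c.re - ∫ t, |q t|) * η) := by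
  rw [norm_mul, norm_exp_neg_mul, Complex.norm_real, Real.norm_eq_abs]
  have := abs_transKernel_le hq x η
  rw [abs_of_nonneg hη] at this
  calc _ ≤ Real.exp (-c.re * η) * ((∫ t, |q t|) / 2 * Real.exp ((∫ t, |q t|) * η)) := by gcongr
    _ = (∫ t, |q t|) / 2 * (Real.exp (-c.re * η) * Real.exp ((∫ t, |q t|) * η)) := by ring
    _ = _ := by rw [← Real.exp_add]; congr 2; ring

theorem continuous_exp_mul_transKernel (hq : Integrable q) (c : ℂ) :
    Continuous fun p : ℝ × ℝ => Complex.exp (-c * p.2) * transKernel q p.1 p.2 :=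
  (by fun_prop : Continuous fun p : ℝ × ℝ => Complex.exp (-c * p.2)).mul
    (Complex.continuous_ofReal.comp (continuous_transKernel hq))

theorem integrableOn_exp_mul_transKernel (hq : Integrable q) (hc : ∫ t, |q t| < c.re) (x : ℝ) :
    IntegrableOn (fun η : ℝ => Complex.exp (-c * η) * transKernel q x η) (Ioi 0) := by
  refine Integrable.mono' ((integrableOn_exp_neg_mul (sub_pos.2 hc)).const_mul ((∫ t, |q t|) / 2)) ?_ ?_
  · exact ((continuous_exp_mul_transKernel hq c).comp
      (by fun_prop : Continuous fun η : ℝ => (x, η))).aestronglyMeasurable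
  · exact ae_restrict_of_forall_mem measurableSet_Ioi fun η hη =>
      norm_exp_mul_transKernel_le hq c x (le_of_lt hη)

/-- The Jost solution for the spectral parameter `-(c / 2) ^ 2`, divided by `exp (-(c / 2) x)`. -/
def jost (q : ℝ → ℝ) (c : ℂ) (x : ℝ) : ℂ :=
  1 + 2 * ∫ η in Ioi (0 : ℝ), Complex.exp (-c * η) * transKernel q x η

theorem norm_jost_le (hq : Integrable q) (hc : ∫ t, |q t| < c.re) (x : ℝ) :
    ‖jost q c x‖ ≤ 1 + (∫ t, |q t|) / (c.re - ∫ t, |q t|) := by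
  have hpos := sub_pos.2 hc
  refine (norm_add_le _ _).trans ?_
  rw [norm_one, norm_mul, Complex.norm_ofNat]
  have : ‖∫ η in Ioi (0 : ℝ), Complex.exp (-c * η) * transKernel q x η‖ ≤
      ∫ η in Ioi (0 : ℝ), (∫ t, |q t|) / 2 * Real.exp (-(c.re - ∫ t, |q t|) * η) :=
    norm_integral_le_of_norm_le ((integrableOn_exp_neg_mul hpos).const_mul _)
      (ae_restrict_of_forall_mem measurableSet_Ioi fun η hη =>
        norm_exp_mul_transKernel_le hq c x (le_of_lt hη))
  rw [integral_const_mul, integral_exp_mul_Ioi (by linarith)] at this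
  simp only [mul_zero, Real.exp_zero] at this
  have e : (∫ t, |q t|) / 2 * (-1 / -(c.re - ∫ t, |q t|)) =
      (∫ t, |q t|) / (c.re - ∫ t, |q t|) / 2 := by
    rw [neg_div_neg_eq]; ring
  rw [e] at this
  linarith

theorem continuous_jost (hq : Integrable q) (hc : ∫ t, |q t| < c.re) : Continuous (jost q c) := by
  refine continuous_const.add (continuous_const.mul (continuous_of_dominated
    (bound := fun η => (∫ t, |q t|) / 2 * Real.exp (-(c.re - ∫ t, |q t|) * η)) ?_ ?_ ?_ ?_))
  · exact fun x => (integrableOn_exp_mul_transKernel hq hc x).aestronglyMeasurable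
  · exact fun x => ae_restrict_of_forall_mem measurableSet_Ioi fun η hη =>
      norm_exp_mul_transKernel_le hq c x (le_of_lt hη)
  · exact (integrableOn_exp_neg_mul (sub_pos.2 hc)).const_mul _
  · exact ae_of_all _ fun η => (continuous_exp_mul_transKernel hq c).comp
      (by fun_prop : Continuous fun x : ℝ => (x, η))

theorem integrable_mul_exp_mul_transKernel (hq : Integrable q) (hc : ∫ t, |q t| < c.re)
    {μ : Measure ℝ} [SFinite μ] {p : ℝ → ℂ} (hp : Integrable p μ) :
    Integrable (fun w : ℝ × ℝ => p w.1 * (Complex.exp (-c * w.2) * transKernel q w.1 w.2))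
      (μ.prod (volume.restrict (Ioi 0))) := by
  refine Integrable.mono' (hp.norm.mul_prod
    ((integrableOn_exp_neg_mul (sub_pos.2 hc)).const_mul ((∫ t, |q t|) / 2))) ?_ ?_
  · exact hp.aestronglyMeasurable.comp_fst.mul
      (continuous_exp_mul_transKernel hq c).aestronglyMeasurable
  · have hm : ∀ᵐ w ∂(μ.prod (volume.restrict (Ioi (0 : ℝ)))), (w : ℝ × ℝ).2 ∈ Ioi (0 : ℝ) := by
      refine Measure.quasiMeasurePreserving_snd.ae (p := fun y : ℝ => y ∈ Ioi (0 : ℝ)) ?_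
      exact ae_restrict_mem measurableSet_Ioi
    filter_upwards [hm] with w hw
    rw [norm_mul]
    gcongr
    exact norm_exp_mul_transKernel_le hq c w.1 (le_of_lt hw)

theorem integral_exp_mul_integral (hq : Integrable q) (hc : ∫ t, |q t| < c.re) {x y : ℝ}
    (hxy : x ≤ y) :
    ∫ τ in Ioi (0 : ℝ), Complex.exp (-c * τ) * ((∫ t in x..y, q t * transKernel q t τ : ℝ) : ℂ) =
      ∫ t in x..y, (q t : ℂ) * ((jost q c t - 1) / 2) := by
  have hqc : Integrable (fun t => (q t : ℂ)) (volume.restrict (Ioc x y)) := hq.ofReal.restrict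
  have hi := integrable_mul_exp_mul_transKernel hq hc hqc
  have h1 := integral_integral_swap (f := fun t τ : ℝ => (q t : ℂ) *
    (Complex.exp (-c * τ) * transKernel q t τ)) hi
  rw [intervalIntegral.integral_of_le hxy]
  have e1 : ∀ t, (q t : ℂ) * ((jost q c t - 1) / 2) =
      ∫ τ in Ioi (0 : ℝ), (q t : ℂ) * (Complex.exp (-c * τ) * transKernel q t τ) := by
    intro t
    rw [integral_const_mul, jost]; ring
  simp_rw [e1]
  rw [h1]
  refine integral_congr_ae (ae_of_all _ fun τ => ?_)
  simp only
  rw [← intervalIntegral.integral_ofReal, intervalIntegral.integral_of_le hxy, ← integral_const_mul]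
  refine integral_congr_ae (ae_of_all _ fun t => ?_)
  simp only
  push_cast
  ring

/-- The integral equation for the Jost solution. -/
theorem jost_eq (hq : Integrable q) (hc : ∫ t, |q t| < c.re) {x : ℝ} (hx : 0 ≤ x) :
    jost q c x = 1 - ∫ s in Ioi (0 : ℝ), Complex.exp (-c * s) *
      ∫ y in s..(x + s), (q y : ℂ) * jost q c y := by
  have hQ : 0 ≤ ∫ t, |q t| := integral_nonneg fun _ => abs_nonneg _
  have hc0 : 0 < c.re := hQ.trans_lt hc
  set Q := ∫ t, |q t| with hQdef
  have hqc : Integrable (fun t => (q t : ℂ)) := hq.ofReal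
  -- the contribution of the first term of the series
  have i1 : IntegrableOn (fun η : ℝ => Complex.exp (-c * η) * ∫ y in η..(x + η), (q y : ℂ)) (Ioi 0) := by
    refine Integrable.mono' ((integrableOn_exp_neg_mul hc0).mul_const Q) ?_ (ae_of_all _ fun η => ?_)
    · have h1 := continuous_integral_mul (X := ℝ) hq (Φ := fun _ _ => 1) continuous_const
        (l := fun η => η) (r := fun η => x + η) (by fun_prop) (by fun_prop)
      simp only [mul_one] at h1
      have h2 : Continuous fun η : ℝ => Complex.exp (-c * η) * ∫ y in η..(x + η), (q y : ℂ) := by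
        simp_rw [intervalIntegral.integral_ofReal]
        exact (by fun_prop : Continuous fun η : ℝ => Complex.exp (-c * η)).mul
          (Complex.continuous_ofReal.comp h1)
      exact h2.aestronglyMeasurable
    · rw [norm_mul, norm_exp_neg_mul]
      gcongr
      have := abs_integral_mul_le hq (g := fun _ => 1) (x := η) (y := x + η) zero_le_one
        (fun t _ => by simp)
      simp only [mul_one] at this
      rw [intervalIntegral.integral_ofReal, Complex.norm_real]
      exact this
  set J : ℝ → ℝ → ℝ := fun s τ => ∫ y in s..(x + s), q y * transKernel q y τ with hJ
  have hJc : Continuous (Function.uncurry J) :=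
    continuous_integral_mul (X := ℝ × ℝ) hq (Φ := fun w y => transKernel q y w.2)
      ((continuous_transKernel hq).comp (by fun_prop : Continuous fun p : (ℝ × ℝ) × ℝ => (p.2, p.1.2)))
      (by fun_prop) (by fun_prop)
  have hJb : ∀ s τ, 0 ≤ τ → |J s τ| ≤ Q * (Q / 2 * Real.exp (Q * τ)) := fun s τ hτ =>
    abs_integral_mul_le hq (by positivity) fun y _ => by
      simpa [abs_of_nonneg hτ] using abs_transKernel_le hq y τ
  set Ψ : ℝ → ℝ → ℂ := fun s τ => Complex.exp (-c * s) * (Complex.exp (-c * τ) * J s τ) with hΨ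
  have hΨi : Integrable (Function.uncurry Ψ)
      ((volume.restrict (Ioi 0)).prod (volume.restrict (Ioi 0))) := by
    refine Integrable.mono' ((integrableOn_exp_neg_mul hc0).mul_prod
      ((integrableOn_exp_neg_mul (sub_pos.2 hc)).const_mul (Q * (Q / 2)))) ?_ ?_
    · have : Continuous (Function.uncurry Ψ) :=
        (by fun_prop : Continuous fun p : ℝ × ℝ => Complex.exp (-c * p.1)).mul
          ((by fun_prop : Continuous fun p : ℝ × ℝ => Complex.exp (-c * p.2)).mul
            (Complex.continuous_ofReal.comp hJc))
      exact this.aestronglyMeasurable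
    · have hm : ∀ᵐ w ∂((volume.restrict (Ioi (0 : ℝ))).prod (volume.restrict (Ioi (0 : ℝ)))),
          (w : ℝ × ℝ).2 ∈ Ioi (0 : ℝ) :=
        Measure.quasiMeasurePreserving_snd.ae (p := fun y : ℝ => y ∈ Ioi (0 : ℝ))
          (ae_restrict_mem measurableSet_Ioi)
      filter_upwards [hm] with w hw
      simp only [Function.uncurry, hΨ]
      rw [norm_mul, norm_mul, norm_exp_neg_mul, norm_exp_neg_mul, Complex.norm_real]
      refine mul_le_mul_of_nonneg_left ?_ (Real.exp_pos _).le
      calc Real.exp (-c.re * w.2) * ‖J w.1 w.2‖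
          ≤ Real.exp (-c.re * w.2) * (Q * (Q / 2 * Real.exp (Q * w.2))) := by
            gcongr; exact hJb _ _ (le_of_lt hw)
        _ = Q * (Q / 2) * (Real.exp (-c.re * w.2) * Real.exp (Q * w.2)) := by ring
        _ = _ := by rw [← Real.exp_add]; congr 2; ring
  obtain ⟨i2, htri⟩ := integral_Ioi_integral_triangle hΨi
  have hinner : ∀ s, ∫ τ in Ioi (0 : ℝ), Ψ s τ = Complex.exp (-c * s) *
      ∫ y in s..(x + s), (q y : ℂ) * ((jost q c y - 1) / 2) := by
    intro s
    simp only [hΨ, hJ]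
    rw [integral_const_mul, integral_exp_mul_integral hq hc (by linarith)]
  -- Splitting `exp (-c η) = exp (-c s) exp (-c (η - s))` turns the Volterra equation into the
  -- convolution form of `htri`.
  have hV : ∀ η : ℝ, Complex.exp (-c * η) * (transKernel q x η : ℂ) =
      -(1 / 2) * (Complex.exp (-c * η) * ∫ y in η..(x + η), (q y : ℂ)) -
        ∫ s in (0 : ℝ)..η, Ψ s (η - s) := by
    intro η
    have e1 : ∫ s in (0 : ℝ)..η, Ψ s (η - s) = Complex.exp (-c * η) *
        ((∫ s in (0 : ℝ)..η, J s (η - s) : ℝ) : ℂ) := by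
      rw [← intervalIntegral.integral_ofReal, ← intervalIntegral.integral_const_mul]
      refine intervalIntegral.integral_congr fun s _ => ?_
      simp only [hΨ]
      rw [← mul_assoc, ← Complex.exp_add]
      congr 2
      push_cast; ring
    rw [e1, transKernel_eq hq x η, intervalIntegral.integral_ofReal]
    push_cast
    ring
  have i3 : IntegrableOn (fun s : ℝ => Complex.exp (-c * s) *
      ∫ y in s..(x + s), (q y : ℂ) * ((jost q c y - 1) / 2)) (Ioi 0) := by
    refine hΨi.integral_prod_left.congr (ae_of_all _ fun s => ?_)
    exact hinner s
  rw [jost]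
  simp_rw [hV]
  rw [integral_sub (i1.const_mul _) i2, htri, integral_const_mul]
  simp_rw [hinner]
  have hsplit : ∀ s : ℝ, Complex.exp (-c * s) * ∫ y in s..(x + s), (q y : ℂ) * jost q c y =
      (Complex.exp (-c * s) * ∫ y in s..(x + s), (q y : ℂ)) + 2 * (Complex.exp (-c * s) *
        ∫ y in s..(x + s), (q y : ℂ) * ((jost q c y - 1) / 2)) := by
    intro s
    have i4 : IntervalIntegrable (fun y => (q y : ℂ) * ((jost q c y - 1) / 2)) volume s (x + s) :=
      hqc.intervalIntegrable.mul_continuousOn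
        (((continuous_jost hq hc).sub continuous_const).div_const 2).continuousOn
    have : ∫ y in s..(x + s), (q y : ℂ) * jost q c y = (∫ y in s..(x + s), (q y : ℂ)) +
        2 * ∫ y in s..(x + s), (q y : ℂ) * ((jost q c y - 1) / 2) := by
      rw [← intervalIntegral.integral_const_mul, ← intervalIntegral.integral_add
        hqc.intervalIntegrable (i4.const_mul 2)]
      refine intervalIntegral.integral_congr fun y _ => ?_
      ring
    rw [this]; ring
  simp_rw [hsplit]
  rw [integral_add i1 (i3.const_mul 2), integral_const_mul]
  ring

/-- The Laplace transform of the `A`-function. -/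
theorem integral_exp_mul_amplitude (hq : Integrable q) (hc : ∫ t, |q t| < c.re) :
    IntegrableOn (fun α : ℝ => Complex.exp (-c * α) * amplitude q α) (Ioi 0) ∧
    ∫ α in Ioi (0 : ℝ), Complex.exp (-c * α) * amplitude q α =
      ∫ s in Ioi (0 : ℝ), Complex.exp (-c * s) * (q s * jost q c s) := by
  have hQ : 0 ≤ ∫ t, |q t| := integral_nonneg fun _ => abs_nonneg _
  have hc0 : 0 < c.re := hQ.trans_lt hc
  have hec : Continuous fun s : ℝ => Complex.exp (-c * s) := by fun_prop
  have hp : Integrable (fun s : ℝ => Complex.exp (-c * s) * (q s : ℂ)) (volume.restrict (Ioi 0)) := by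
    refine Integrable.mono' hq.abs.restrict
      (hec.aestronglyMeasurable.mul hq.ofReal.aestronglyMeasurable.restrict)
      (ae_restrict_of_forall_mem measurableSet_Ioi fun s hs => ?_)
    rw [norm_mul, norm_exp_neg_mul, Complex.norm_real, Real.norm_eq_abs]
    refine mul_le_of_le_one_left (abs_nonneg _) (Real.exp_le_one_iff.2 ?_)
    have : (0 : ℝ) < s := hs
    nlinarith
  have hi := integrable_mul_exp_mul_transKernel hq hc hp
  obtain ⟨i2, htri⟩ := integral_Ioi_integral_triangle (Ψ := fun s τ =>
    Complex.exp (-c * s) * (q s : ℂ) * (Complex.exp (-c * τ) * transKernel q s τ)) hi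
  have hA : ∀ α : ℝ, Complex.exp (-c * α) * (amplitude q α : ℂ) = Complex.exp (-c * α) * q α +
      2 * ∫ s in (0 : ℝ)..α, Complex.exp (-c * s) * (q s : ℂ) *
        (Complex.exp (-c * ((α - s : ℝ) : ℂ)) * transKernel q s (α - s)) := by
    intro α
    have e1 : ∫ s in (0 : ℝ)..α, Complex.exp (-c * s) * (q s : ℂ) *
        (Complex.exp (-c * ((α - s : ℝ) : ℂ)) * transKernel q s (α - s)) = Complex.exp (-c * α) *
        ((∫ s in (0 : ℝ)..α, q s * transKernel q s (α - s) : ℝ) : ℂ) := by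
      rw [← intervalIntegral.integral_ofReal, ← intervalIntegral.integral_const_mul]
      refine intervalIntegral.integral_congr fun s _ => ?_
      have e2 : Complex.exp (-c * α) = Complex.exp (-c * s) * Complex.exp (-c * ((α - s : ℝ) : ℂ)) := by
        rw [← Complex.exp_add]; congr 1; push_cast; ring
      simp only [e2]
      push_cast
      ring
    rw [e1, amplitude]
    push_cast
    ring
  simp_rw [hA]
  refine ⟨hp.add (i2.const_mul 2), ?_⟩
  rw [integral_add hp (i2.const_mul 2), integral_const_mul, htri]
  have i3 : IntegrableOn (fun s : ℝ => ∫ τ in Ioi (0 : ℝ), Complex.exp (-c * s) * (q s : ℂ) *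
      (Complex.exp (-c * τ) * transKernel q s τ)) (Ioi 0) := hi.integral_prod_left
  rw [← integral_const_mul, ← integral_add hp (i3.const_mul 2)]
  refine integral_congr_ae (ae_of_all _ fun s => ?_)
  simp only
  rw [integral_const_mul, jost]
  ring

end Laplace
end HalfLine

end

/-! ### The Jost solution and comparison of Weyl functions -/

noncomputable section

namespace HalfLine

section Jost

variable {q : ℝ → ℝ} {κ : ℂ}

theorem IsPrimitiveOn.congr_left {F G f : ℝ → ℂ} {X : ℝ} (h : IsPrimitiveOn F f X)
    (hFG : ∀ x ∈ Icc 0 X, F x = G x) : IsPrimitiveOn G f X := by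
  refine ⟨h.intervalIntegrable, fun x hx => ?_⟩
  rw [← hFG x hx, ← hFG 0 ⟨le_rfl, hx.1.trans hx.2⟩]
  exact h.eq_add x hx

theorem integral_Ioi_comp_const_add (g : ℝ → ℂ) (x : ℝ) :
    ∫ s in Ioi (0 : ℝ), g (x + s) = ∫ t in Ioi x, g t := by
  have := (measurePreserving_add_left volume x).setIntegral_preimage_emb
    (measurableEmbedding_addLeft x) g (Ioi x)
  rw [preimage_const_add_Ioi, sub_self] at this
  exact this

/-- The Jost solution of a potential that is supported in `[0, a]`. -/
theorem exists_jost_solution (hq : Integrable q) (hκ : ∫ t, |q t| < (2 * κ).re) {a : ℝ}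
    (ha : 0 ≤ a) (hsupp : ∀ y, a < y → q y = 0) :
    ∃ ψ ψ' : ℝ → ℂ, IsSolution q ⊤ (-κ ^ 2) ψ ψ' ∧ ψ 0 = 1 ∧
      ψ' 0 = -κ - ∫ α in Ioi (0 : ℝ), Complex.exp (-(2 * κ) * α) * amplitude q α ∧
      ψ' a = -κ * ψ a ∧
      ‖ψ a‖ ≤ Real.exp (-κ.re * a) * (1 + (∫ t, |q t|) / ((2 * κ).re - ∫ t, |q t|)) := by
  have hQ : 0 ≤ ∫ t, |q t| := integral_nonneg fun _ => abs_nonneg _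
  set Q := ∫ t, |q t| with hQdef
  set c := 2 * κ with hcdef
  have hc0 : 0 < c.re := hQ.trans_lt hκ
  have hcne : c ≠ 0 := by rintro h; rw [h] at hc0; simp at hc0
  set f := jost q c with hfdef
  have hfc : Continuous f := continuous_jost hq hκ
  set B := 1 + Q / (c.re - Q) with hB
  have hfB : ∀ x, ‖f x‖ ≤ B := norm_jost_le hq hκ
  have hB0 : 0 ≤ B := (norm_nonneg _).trans (hfB 0)
  have hqf : Integrable fun t => (q t : ℂ) * f t := by
    refine Integrable.mono' (hq.abs.mul_const B)
      (hq.ofReal.aestronglyMeasurable.mul hfc.aestronglyMeasurable) (ae_of_all _ fun t => ?_)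
    rw [norm_mul, Complex.norm_real, Real.norm_eq_abs]
    gcongr
    exact hfB t
  set Φ : ℝ → ℂ := fun x => ∫ t in (0 : ℝ)..x, (q t : ℂ) * f t with hΦ
  have hΦ0 : Φ 0 = 0 := by simp [hΦ]
  have hΦp : ∀ X, IsPrimitiveOn Φ (fun t => (q t : ℂ) * f t) X := fun X =>
    ⟨hqf.intervalIntegrable, fun x _ => by rw [hΦ0, zero_add]⟩
  have hΦc : Continuous Φ :=
    intervalIntegral.continuous_primitive (fun _ _ => hqf.intervalIntegrable) 0
  have hΦb : ∀ x, ‖Φ x‖ ≤ ∫ t, ‖(q t : ℂ) * f t‖ := fun x =>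
    intervalIntegral.norm_integral_le_integral_norm_uIoc.trans
      (setIntegral_le_integral hqf.norm (ae_of_all _ fun _ => norm_nonneg _))
  have hec : Continuous fun t : ℝ => Complex.exp (-c * t) := by fun_prop
  have hΛi : IntegrableOn (fun t : ℝ => Complex.exp (-c * t) * Φ t) (Ioi 0) := by
    refine Integrable.mono' ((integrableOn_exp_neg_mul hc0).mul_const (∫ t, ‖(q t : ℂ) * f t‖))
      (hec.mul hΦc).aestronglyMeasurable (ae_of_all _ fun t => ?_)
    rw [norm_mul, norm_exp_neg_mul]
    gcongr
    exact hΦb t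
  set Λ₀ := ∫ t in Ioi (0 : ℝ), Complex.exp (-c * t) * Φ t with hΛ₀
  set Λ : ℝ → ℂ := fun x => Λ₀ - ∫ t in (0 : ℝ)..x, Complex.exp (-c * t) * Φ t with hΛ
  have hΛ0 : Λ 0 = Λ₀ := by simp [hΛ]
  have hΛc : Continuous Λ := continuous_const.sub
    (intervalIntegral.continuous_primitive (fun _ _ => (hec.mul hΦc).intervalIntegrable _ _) 0)
  have hΛp : ∀ X, IsPrimitiveOn Λ (fun t => -(Complex.exp (-c * t) * Φ t)) X := fun X =>
    ⟨(hec.mul hΦc).neg.intervalIntegrable _ _, fun x _ => by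
      rw [hΛ0, intervalIntegral.integral_neg, ← sub_eq_add_neg]⟩
  have hΛIoi : ∀ x : ℝ, 0 ≤ x → ∫ t in Ioi x, Complex.exp (-c * t) * Φ t = Λ x := by
    intro x hx
    have := intervalIntegral.integral_interval_add_Ioi (a := 0) (b := x) hΛi
      (hΛi.mono_set (Ioi_subset_Ioi hx))
    simp only [hΛ, hΛ₀]
    rw [← this]; ring
  have hexp : ∀ x : ℝ, Complex.exp (c * x) * Complex.exp (-c * x) = 1 := fun x => by
    rw [← Complex.exp_add]; simp
  -- Substituting `t = x + s` in the integral equation moves the `x` dependence into `exp (c x)` and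
  -- the tail `Λ x = ∫_x^∞ exp (-c t) Φ t dt`, so that `f` can be differentiated twice although `q`
  -- is only integrable.
  have hf : ∀ x : ℝ, 0 ≤ x → f x = 1 + Λ₀ - Complex.exp (c * x) * Λ x := by
    intro x hx
    rw [hfdef, jost_eq hq hκ hx]
    have hd : ∀ s : ℝ, ∫ y in s..(x + s), (q y : ℂ) * jost q c y = Φ (x + s) - Φ s := fun s => by
      rw [hΦ]
      exact (intervalIntegral.integral_interval_sub_left hqf.intervalIntegrable
        hqf.intervalIntegrable).symm
    simp_rw [hd, mul_sub]
    have e1 : ∀ s : ℝ, Complex.exp (-c * s) * Φ (x + s) = Complex.exp (c * x) *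
        (Complex.exp (-c * ((x + s : ℝ) : ℂ)) * Φ (x + s)) := by
      intro s
      rw [← mul_assoc, ← Complex.exp_add]
      congr 2; push_cast; ring
    have i1 : IntegrableOn (fun s : ℝ => Complex.exp (-c * s) * Φ (x + s)) (Ioi 0) := by
      refine Integrable.mono' ((integrableOn_exp_neg_mul hc0).mul_const (∫ t, ‖(q t : ℂ) * f t‖))
        (hec.mul (hΦc.comp (by fun_prop))).aestronglyMeasurable (ae_of_all _ fun t => ?_)
      rw [norm_mul, norm_exp_neg_mul]
      gcongr
      exact hΦb _
    rw [integral_sub i1 hΛi, ← hΛ₀]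
    simp_rw [e1]
    rw [integral_const_mul, integral_Ioi_comp_const_add
      (fun t : ℝ => Complex.exp (-c * t) * Φ t) x, hΛIoi x hx]
    ring
  set g : ℝ → ℂ := fun x => Φ x - c * (Complex.exp (c * x) * Λ x) with hg
  have hgc : Continuous g := hΦc.sub (continuous_const.mul
    ((by fun_prop : Continuous fun x : ℝ => Complex.exp (c * x)).mul hΛc))
  have hEΛ : ∀ X, 0 ≤ X → IsPrimitiveOn (fun x => Complex.exp (c * x) * Λ x) (fun x => -g x) X := by
    intro X hX
    refine ((hΛp X).exp_mul hX c).congr_right hX fun x _ => ?_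
    simp only [hg]
    linear_combination (-Φ x) * hexp x
  have hfp : ∀ X, 0 ≤ X → IsPrimitiveOn f g X := by
    intro X hX
    have h1 : IsPrimitiveOn (fun _ => 1 + Λ₀) (fun _ => 0) X :=
      ⟨intervalIntegrable_const, fun x _ => by simp⟩
    refine ((h1.sub (hEΛ X hX)).congr_right hX fun x _ => ?_).congr_left fun x hx =>
      (hf x hx.1).symm
    ring
  have hgp : ∀ X, 0 ≤ X → IsPrimitiveOn g (fun x => (q x : ℂ) * f x + c * g x) X := by
    intro X hX
    refine ((hΦp X).sub ((hEΛ X hX).const_mul c)).congr_right hX fun x _ => ?_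
    ring
  have hψ : ∀ X, 0 ≤ X → IsPrimitiveOn (fun x => Complex.exp (-κ * x) * f x)
      (fun x => Complex.exp (-κ * x) * (g x - κ * f x)) X := by
    intro X hX
    refine ((hfp X hX).exp_mul hX (-κ)).congr_right hX fun x _ => ?_
    ring
  have hψ' : ∀ X, 0 ≤ X → IsPrimitiveOn (fun x => Complex.exp (-κ * x) * (g x - κ * f x))
      (fun x => ((q x : ℂ) - -κ ^ 2) * (Complex.exp (-κ * x) * f x)) X := by
    intro X hX
    refine (((hgp X hX).sub ((hfp X hX).const_mul κ)).exp_mul hX (-κ)).congr_right hX fun x _ => ?_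
    rw [hcdef]
    ring
  have hκc : Continuous fun x : ℝ => Complex.exp (-κ * x) := by fun_prop
  have hf0 : f 0 = 1 := by rw [hf 0 le_rfl, hΛ0]; simp
  -- Integration by parts for `exp (-c t) Φ t`, which vanishes at `0` and at infinity.
  have hLap : ∫ α in Ioi (0 : ℝ), Complex.exp (-c * α) * amplitude q α = c * Λ₀ := by
    rw [(integral_exp_mul_amplitude hq hκ).2]
    have i1 : IntegrableOn (fun t : ℝ => Complex.exp (-c * t) * ((q t : ℂ) * f t)) (Ioi 0) := by
      refine Integrable.mono' hqf.norm.restrict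
        (hec.aestronglyMeasurable.mul hqf.aestronglyMeasurable.restrict)
        (ae_restrict_of_forall_mem measurableSet_Ioi fun s hs => ?_)
      rw [norm_mul, norm_exp_neg_mul]
      refine mul_le_of_le_one_left (norm_nonneg _) (Real.exp_le_one_iff.2 ?_)
      have : (0 : ℝ) < s := hs
      nlinarith
    have i2 := (hΛi.const_mul (-c)).add i1
    have hlim1 := intervalIntegral_tendsto_integral_Ioi 0 i2 tendsto_id
    have hlim2 : Tendsto (fun X : ℝ => Complex.exp (-c * X) * Φ X) atTop (𝓝 0) := by
      rw [tendsto_zero_iff_norm_tendsto_zero]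
      have hb : Tendsto (fun X : ℝ => Real.exp (-c.re * X) * ∫ t, ‖(q t : ℂ) * f t‖) atTop (𝓝 0) := by
        have h1 : Tendsto (fun X : ℝ => Real.exp (-c.re * X)) atTop (𝓝 0) :=
          Real.tendsto_exp_atBot.comp (tendsto_id.const_mul_atTop_of_neg (by linarith))
        simpa using h1.mul_const (∫ t, ‖(q t : ℂ) * f t‖)
      refine squeeze_zero (fun _ => norm_nonneg _) (fun X => ?_) hb
      rw [norm_mul, norm_exp_neg_mul]
      gcongr
      exact hΦb X
    have hz : ∫ t in Ioi (0 : ℝ), ((fun t : ℝ => -c * (Complex.exp (-c * t) * Φ t)) +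
        fun t : ℝ => Complex.exp (-c * t) * ((q t : ℂ) * f t)) t = 0 := by
      refine tendsto_nhds_unique hlim1 (hlim2.congr' ?_)
      filter_upwards [eventually_ge_atTop 0] with X hX
      rw [((hΦp X).exp_mul hX (-c)).eq_add X ⟨hX, le_rfl⟩, hΦ0, mul_zero, zero_add]
      refine intervalIntegral.integral_congr fun t _ => ?_
      simp only [Pi.add_apply]
      ring
    simp only [Pi.add_apply] at hz
    rw [integral_add (hΛi.const_mul (-c)) i1, integral_const_mul] at hz
    linear_combination hz
  -- Beyond the support `Φ` is constant, so `c Λ a = exp (-c a) Φ a`. Past `a` the solution is a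
  -- pure exponential.
  have hga : g a = 0 := by
    have hΦa : ∀ t ∈ Ioi a, Complex.exp (-c * t) * Φ t = Complex.exp (-c * t) * Φ a := by
      intro t ht
      congr 1
      have h1 := (hΦp t).sub_eq (x := a) (y := t) ⟨ha, le_of_lt ht⟩ ⟨ha.trans (le_of_lt ht), le_rfl⟩
      have h2 : ∫ t in a..t, (q t : ℂ) * f t = 0 := by
        rw [intervalIntegral.integral_of_le (le_of_lt ht)]
        refine setIntegral_eq_zero_of_forall_eq_zero fun y hy => ?_
        rw [hsupp y hy.1]; simp
      rw [h2] at h1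
      exact sub_eq_zero.1 h1
    have h3 := hΛIoi a ha
    rw [setIntegral_congr_fun measurableSet_Ioi hΦa, integral_mul_const,
      integral_exp_mul_complex_Ioi (by simpa using hc0)] at h3
    have h4 : c * Λ a = Complex.exp (-c * a) * Φ a := by
      rw [← h3, neg_div_neg_eq, ← mul_assoc, mul_div_cancel₀ _ hcne]
    simp only [hg]
    linear_combination (-Complex.exp (c * a)) * h4 - Φ a * hexp a
  refine ⟨fun x => Complex.exp (-κ * x) * f x, fun x => Complex.exp (-κ * x) * (g x - κ * f x),
    ⟨(hκc.mul hfc).continuousOn, (hκc.mul (hgc.sub (continuous_const.mul hfc))).continuousOn,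
    fun x hx _ => (hψ x hx).eq_add x ⟨hx, le_rfl⟩,
    fun x hx _ => (hψ' x hx).eq_add x ⟨hx, le_rfl⟩⟩, ?_, ?_, ?_, ?_⟩
  · simp [hf0]
  · simp only [hLap, hf0, hg, hΦ0, hΛ0, Complex.ofReal_zero, mul_zero, Complex.exp_zero]
    ring
  · simp only [hga]
    ring
  · rw [norm_mul, norm_exp_neg_mul]
    gcongr
    exact hfB a

end Jost

section Comparison

variable {q : ℝ → ℝ} {b : EReal} {κ : ℂ} {u v : ℝ → ℂ}

/-- The restriction of a potential to `[0, a]`. -/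
def truncation (q : ℝ → ℝ) (a : ℝ) : ℝ → ℝ := (Icc 0 a).indicator q

theorem integrable_truncation {a : ℝ} (ha : 0 ≤ a) (hq : IntervalIntegrable q volume 0 a) :
    Integrable (truncation q a) := by
  rw [truncation, integrable_indicator_iff measurableSet_Icc, integrableOn_Icc_iff_integrableOn_Ioc]
  exact (intervalIntegrable_iff_integrableOn_Ioc_of_le ha).1 hq

theorem truncation_of_mem {a x : ℝ} (hx : x ∈ Icc 0 a) : truncation q a x = q x :=
  indicator_of_mem hx q

theorem integral_abs_truncation {a : ℝ} (ha : 0 ≤ a) :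
    ∫ t, |truncation q a t| = ∫ t in (0 : ℝ)..a, |q t| := by
  have : ∀ t, |truncation q a t| = (Icc 0 a).indicator (fun t => |q t|) t := fun t => by
    by_cases ht : t ∈ Icc 0 a
    · rw [truncation, indicator_of_mem ht, indicator_of_mem ht]
    · rw [truncation, indicator_of_notMem ht, indicator_of_notMem ht, abs_zero]
  simp_rw [this]
  rw [integral_indicator measurableSet_Icc, integral_Icc_eq_integral_Ioc,
    intervalIntegral.integral_of_le ha]

/-- Comparison of `u'(0) / u(0)` with its counterpart for the truncated potential. -/
theorem norm_div_sub_le (hq : IsIntegrableUpTo q b) {a M : ℝ} (ha : 0 ≤ a) (hab : (a : EReal) < b)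
    (h : IsSolution q b (-κ ^ 2) u v) (hu : IsNonzero b u)
    (hM0 : 0 ≤ M) (hM : ∀ x ∈ Icc 0 a, ‖v x + κ * u x‖ ≤ M * ‖u x‖)
    (hκ : (∫ t in (0 : ℝ)..a, |q t|) + 1 ≤ κ.re) :
    ‖v 0 / u 0 - (-κ - ∫ α in (0 : ℝ)..a,
        (amplitude (truncation q a) α : ℂ) * Complex.exp (-2 * (α : ℂ) * κ))‖ ≤
      (2 * M * Real.exp (M * a) + (∫ t in (0 : ℝ)..a, |q t|) ^ 2 *
        Real.exp ((∫ t in (0 : ℝ)..a, |q t|) * a)) * ‖Complex.exp (-2 * (a : ℂ) * κ)‖ := by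
  have hqi := integrable_truncation ha (hq.intervalIntegrable ha hab)
  have hQeq := integral_abs_truncation (q := q) ha
  set Q := ∫ t in (0 : ℝ)..a, |q t| with hQdef
  have hQ : 0 ≤ Q := intervalIntegral.integral_nonneg ha fun _ _ => abs_nonneg _
  have hc : (2 * κ).re = 2 * κ.re := by simp
  have hκ' : ∫ t, |truncation q a t| < (2 * κ).re := by rw [hQeq, hc]; linarith
  obtain ⟨ψ, ψ', hψ, hψ0, hψ0', hψa, hψn⟩ := exists_jost_solution hqi hκ' ha
    (fun y hy => indicator_of_notMem (fun hy' => not_le.2 hy hy'.2) q)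
  -- If `u 0 = 0`, the bound `hM` at `0` also gives `v 0 = 0`, and the solution would be trivial.
  have hu0 : u 0 ≠ 0 := by
    intro h0
    have h1 := hM 0 ⟨le_rfl, ha⟩
    rw [h0] at h1
    have h2 : v 0 = 0 := by simpa using h1
    rcases h.initial_ne_zero hq hu with h3 | h3
    · exact h3 h0
    · exact h3 h2
  have hg := h.norm_le_mul_exp ha hab hM
  have hpa := hM a ⟨ha, le_rfl⟩
  -- the Wronskian is constant on `[0, a]`
  have hW : IsPrimitiveOn (fun x => u x * ψ' x - v x * ψ x) (fun _ => 0) a := by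
    have hqt : IsIntegrableUpTo (truncation q a) ⊤ := fun X => hqi.integrableOn
    refine (((h.primitive_fst ha hab).mul (hψ.primitive_snd hqt ha (EReal.coe_lt_top a)) ha).sub
      ((h.primitive_snd hq ha hab).mul (hψ.primitive_fst ha (EReal.coe_lt_top a)) ha)).congr_right
      ha fun x hx => ?_
    rw [truncation_of_mem hx]
    ring
  have hWa := hW.eq_add a ⟨ha, le_rfl⟩
  rw [intervalIntegral.integral_zero, add_zero, hψ0, hψa] at hWa
  have hdiff : v 0 / u 0 - ψ' 0 = ψ a * (v a + κ * u a) / u 0 := by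
    field_simp
    linear_combination hWa
  have hn1 : ‖v 0 / u 0 - ψ' 0‖ ≤ 2 * M * Real.exp (M * a) * Real.exp (-2 * κ.re * a) := by
    rw [hdiff, norm_div, norm_mul, div_le_iff₀ (norm_pos_iff.2 hu0)]
    have h1 : 1 + (∫ t, |truncation q a t|) / ((2 * κ).re - ∫ t, |truncation q a t|) ≤ 2 := by
      rw [hQeq, hc]
      have : Q / (2 * κ.re - Q) ≤ 1 := by
        rw [div_le_one (by linarith)]; linarith
      linarith
    have h2 : ‖v a + κ * u a‖ ≤ M * (‖u 0‖ * Real.exp ((M - κ.re) * a)) :=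
      hpa.trans (by gcongr)
    calc ‖ψ a‖ * ‖v a + κ * u a‖
        ≤ (Real.exp (-κ.re * a) * 2) * (M * (‖u 0‖ * Real.exp ((M - κ.re) * a))) := by
          gcongr
          exact hψn.trans (by gcongr)
      _ = 2 * M * (Real.exp (-κ.re * a) * Real.exp ((M - κ.re) * a)) * ‖u 0‖ := by ring
      _ = 2 * M * (Real.exp (M * a) * Real.exp (-2 * κ.re * a)) * ‖u 0‖ := by
          rw [← Real.exp_add, ← Real.exp_add]; congr 3; ring
      _ = _ := by ring
  have hAi := (integral_exp_mul_amplitude hqi hκ').1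
  have hsplit := intervalIntegral.integral_interval_add_Ioi (a := 0) (b := a) hAi
    (hAi.mono_set (Ioi_subset_Ioi ha))
  -- For `α > a` the truncated potential is zero, so the bound on `A - q` is a bound on `A` itself.
  -- Here `2 Re κ - Q ≥ 1`, so dividing by it is harmless.
  have hn2 : ‖∫ α in Ioi a, Complex.exp (-(2 * κ) * α) * (amplitude (truncation q a) α : ℂ)‖ ≤
      Q ^ 2 * Real.exp (Q * a) * Real.exp (-2 * κ.re * a) := by
    have hr : -(2 * κ.re - Q) < 0 := by linarith
    calc _ ≤ ∫ α in Ioi a, Q ^ 2 * Real.exp (-(2 * κ.re - Q) * α) := by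
          refine norm_integral_le_of_norm_le ((integrableOn_exp_mul_Ioi hr a).const_mul _)
            (ae_restrict_of_forall_mem measurableSet_Ioi fun α hα => ?_)
          have hα' : a < α := hα
          have h1 := abs_amplitude_sub_le hqi (ha.trans hα'.le)
          have h2 : truncation q a α = 0 :=
            indicator_of_notMem (fun hy' => not_le.2 hα' hy'.2) q
          rw [h2, sub_zero, hQeq] at h1
          rw [norm_mul, norm_exp_neg_mul, hc, Complex.norm_real, Real.norm_eq_abs]
          calc _ ≤ Real.exp (-(2 * κ.re) * α) * (Q ^ 2 * Real.exp (α * Q)) := by gcongr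
            _ = Q ^ 2 * (Real.exp (-(2 * κ.re) * α) * Real.exp (α * Q)) := by ring
            _ = _ := by rw [← Real.exp_add]; congr 2; ring
      _ = Q ^ 2 * (Real.exp (-(2 * κ.re - Q) * a) / (2 * κ.re - Q)) := by
          rw [integral_const_mul, integral_exp_mul_Ioi hr, neg_div_neg_eq]
      _ ≤ Q ^ 2 * Real.exp (-(2 * κ.re - Q) * a) := by
          gcongr
          exact div_le_self (Real.exp_pos _).le (by linarith)
      _ = Q ^ 2 * (Real.exp (Q * a) * Real.exp (-2 * κ.re * a)) := by
          rw [← Real.exp_add]; congr 2; ring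
      _ = _ := by ring
  have hint : ∫ α in (0 : ℝ)..a, (amplitude (truncation q a) α : ℂ) * Complex.exp (-2 * (α : ℂ) * κ) =
      ∫ α in (0 : ℝ)..a, Complex.exp (-(2 * κ) * α) * (amplitude (truncation q a) α : ℂ) := by
    refine intervalIntegral.integral_congr fun α _ => ?_
    rw [mul_comm]
    congr 2; ring
  have hexp : ‖Complex.exp (-2 * (a : ℂ) * κ)‖ = Real.exp (-2 * κ.re * a) := by
    rw [show -2 * (a : ℂ) * κ = -(2 * κ) * a by ring, norm_exp_neg_mul, hc]
    congr 1; ring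
  have hfin : v 0 / u 0 - (-κ - ∫ α in (0 : ℝ)..a,
      (amplitude (truncation q a) α : ℂ) * Complex.exp (-2 * (α : ℂ) * κ)) =
      (v 0 / u 0 - ψ' 0) -
        ∫ α in Ioi a, Complex.exp (-(2 * κ) * α) * (amplitude (truncation q a) α : ℂ) := by
    rw [hint, hψ0', ← hsplit]; ring
  rw [hfin, hexp, add_mul]
  exact (norm_sub_le _ _).trans (add_le_add hn1 hn2)

end Comparison

/-! ### Asymptotics in the sector -/

section Sector

theorem exists_sector_bound {ε : ℝ} (hε : 0 < ε) : ∃ L : ℝ, 0 < L ∧ ∀ κ : ℂ,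
    -(Real.pi / 2) + ε < κ.arg → κ.arg < -ε → ‖κ‖ ≤ L * -κ.im ∧ ‖κ‖ ≤ L * κ.re := by
  by_cases h : ε < Real.pi / 2
  · have hs : 0 < Real.sin ε := Real.sin_pos_of_pos_of_lt_pi hε (by linarith)
    refine ⟨1 / Real.sin ε, by positivity, fun κ h1 h2 => ?_⟩
    have key : ∀ t, Real.sin ε ≤ t → ‖κ‖ ≤ 1 / Real.sin ε * (‖κ‖ * t) := by
      intro t ht
      rw [div_mul_eq_mul_div, le_div_iff₀ hs, one_mul]
      gcongr
    constructor
    · have e : -κ.im = ‖κ‖ * Real.sin (-κ.arg) := by rw [Real.sin_neg, mul_neg, Complex.norm_mul_sin_arg]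
      rw [e]
      exact key _ (Real.sin_le_sin_of_le_of_le_pi_div_two (by linarith) (by linarith) (by linarith))
    · have e : κ.re = ‖κ‖ * Real.cos κ.arg := (Complex.norm_mul_cos_arg κ).symm
      rw [e]
      refine key _ ?_
      rw [← Real.cos_neg, ← Real.sin_pi_div_two_sub]
      exact Real.sin_le_sin_of_le_of_le_pi_div_two (by linarith) (by linarith) (by linarith)
  -- For `ε ≥ π / 2` the sector is empty.
  · exact ⟨1, one_pos, fun κ h1 h2 => absurd (h1.trans h2) (by linarith)⟩

theorem eventually_sectorAtInfinity {ε R : ℝ} {P : ℂ → Prop}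
    (h : ∀ κ : ℂ, -(Real.pi / 2) + ε < κ.arg → κ.arg < -ε → R ≤ ‖κ‖ → P κ) :
    ∀ᶠ κ in sectorAtInfinity ε, P κ := by
  rw [sectorAtInfinity, eventually_inf_principal]
  filter_upwards [(eventually_ge_atTop R).comap (fun κ : ℂ => ‖κ‖)] with κ hκ hκ'
  exact h κ hκ'.1 hκ'.2 hκ

theorem tendsto_exp_sectorAtInfinity {a ε : ℝ} (ha : 0 < a) (hε : 0 < ε) :
    Tendsto (fun κ : ℂ => Complex.exp (-2 * (a : ℂ) * κ)) (sectorAtInfinity ε) (𝓝 0) := by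
  obtain ⟨L, hL, hsec⟩ := exists_sector_bound hε
  rw [tendsto_zero_iff_norm_tendsto_zero]
  have h1 : Tendsto (fun κ : ℂ => Real.exp (-(2 * a / L) * ‖κ‖)) (sectorAtInfinity ε) (𝓝 0) := by
    refine (Real.tendsto_exp_atBot.comp (tendsto_id.const_mul_atTop_of_neg
      (neg_lt_zero.2 (by positivity : 0 < 2 * a / L)))).comp ?_
    exact tendsto_comap.mono_left inf_le_left
  refine squeeze_zero' (Eventually.of_forall fun _ => norm_nonneg _) ?_ h1
  refine eventually_sectorAtInfinity (R := 0) fun κ h2 h3 _ => ?_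
  rw [Complex.norm_exp, Real.exp_le_exp]
  have h4 : ‖κ‖ / L ≤ κ.re := by rw [div_le_iff₀ hL, mul_comm]; exact (hsec κ h2 h3).2
  have e : (-2 * (a : ℂ) * κ).re = -2 * a * κ.re := by simp
  rw [e]
  have : -(2 * a / L) * ‖κ‖ = -2 * a * (‖κ‖ / L) := by ring
  rw [this]
  nlinarith

/-- A genuine `O(g)` bound suffices: the quotient is at most `C |g|^δ`. -/
theorem isOTilde_of_eventually_le {l : Filter ℂ} {f g : ℂ → ℂ} {C : ℝ} (hg : Tendsto g l (𝓝 0))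
    (hg0 : ∀ κ, g κ ≠ 0) (hfg : ∀ᶠ κ in l, ‖f κ‖ ≤ C * ‖g κ‖) : IsOTilde l f g := by
  refine ⟨hg, fun δ hδ => ?_⟩
  rw [tendsto_zero_iff_norm_tendsto_zero]
  have h1 : Tendsto (fun κ => C * ‖g κ‖ ^ δ) l (𝓝 0) := by
    have h2 := (tendsto_zero_iff_norm_tendsto_zero.1 hg).rpow_const (p := δ) (Or.inr hδ.le)
    rw [Real.zero_rpow hδ.ne'] at h2
    simpa using h2.const_mul C
  refine squeeze_zero' (Eventually.of_forall fun _ => norm_nonneg _) ?_ h1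
  filter_upwards [hfg] with κ hκ
  rw [norm_mul, norm_div, Complex.norm_real, Real.norm_of_nonneg (by positivity)]
  gcongr
  rw [div_le_iff₀ (norm_pos_iff.2 (hg0 κ))]
  exact hκ

end Sector

/-- Uniqueness of the Weyl solution is not needed, since the estimates hold for every Weyl solution,
in particular for the chosen one. -/
theorem exists_weylM_eq {q : ℝ → ℝ} {e : EndCondition} {z : ℂ} (he : e.Admissible q)
    (hz : 0 < z.im) : ∃ p, IsWeylSolution q e z p ∧ weylM q e z = p.2 0 / p.1 0 := by
  have h := exists_isWeylSolution he hz
  exact ⟨h.choose, h.choose_spec, dif_pos h⟩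

theorem isOTilde_weylM {q : ℝ → ℝ} {e : EndCondition} (he : e.Admissible q) {a : ℝ} (ha : 0 < a)
    (hab : (a : EReal) < e.endpoint) {ε : ℝ} (hε : 0 < ε) :
    IsOTilde (sectorAtInfinity ε)
      (fun κ : ℂ => weylM q e (-κ ^ 2) - (-κ - ∫ α in (0 : ℝ)..a,
        (amplitude (truncation q a) α : ℂ) * Complex.exp (-2 * (α : ℂ) * κ)))
      (fun κ : ℂ => Complex.exp (-2 * (a : ℂ) * κ)) := by
  have hq := he.isIntegrableUpTo
  obtain ⟨L, hL, hsec⟩ := exists_sector_bound hε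
  -- The strict inequality `a < b` provides the room that the bound on `u' + κ u` requires.
  obtain ⟨c, hac, hcb⟩ := EReal.lt_iff_exists_real_btwn.1 hab
  have hac : a < c := by exact_mod_cast hac
  have hQ : 0 ≤ ∫ t in (0 : ℝ)..c, |q t| :=
    intervalIntegral.integral_nonneg (by linarith) fun _ _ => abs_nonneg _
  set E := (1 + 2 * L) * L / (c - a) + 2 * L * ∫ t in (0 : ℝ)..c, |q t| with hE
  have hE0 : 0 < E := by
    have : 0 < c - a := by linarith
    positivity
  refine isOTilde_of_eventually_le (C := 2 * (4 * E) * Real.exp (4 * E * a) +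
    (∫ t in (0 : ℝ)..a, |q t|) ^ 2 * Real.exp ((∫ t in (0 : ℝ)..a, |q t|) * a))
    (tendsto_exp_sectorAtInfinity ha hε) (fun κ => Complex.exp_ne_zero _) ?_
  -- The first threshold is the size condition on `κ` in `norm_add_le_mul`. The second becomes `Re κ
  -- ≥ ∫₀^a |q| + 1` through `|κ| ≤ L Re κ`.
  refine eventually_sectorAtInfinity
    (R := max (2 * E) (L * ((∫ t in (0 : ℝ)..a, |q t|) + 1))) fun κ h1 h2 hR => ?_
  obtain ⟨hL₁, hL₂⟩ := hsec κ h1 h2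
  have hκ1 : 2 * E ≤ ‖κ‖ := (le_max_left _ _).trans hR
  have hκ2 : (∫ t in (0 : ℝ)..a, |q t|) + 1 ≤ κ.re :=
    le_of_mul_le_mul_left (((le_max_right _ _).trans hR).trans hL₂) hL
  have hκ0 : 0 < ‖κ‖ := by linarith
  have hre : 0 < κ.re := pos_of_mul_pos_right (hκ0.trans_le hL₂) hL.le
  have him : κ.im < 0 := neg_pos.1 (pos_of_mul_pos_right (hκ0.trans_le hL₁) hL.le)
  have hz : 0 < (-κ ^ 2).im := by
    rw [Complex.neg_im, pow_two, Complex.mul_im]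
    nlinarith
  obtain ⟨p, hp, hm⟩ := exists_weylM_eq he hz
  rw [hm]
  refine norm_div_sub_le hq ha.le hab hp.1 hp.2.1 (by positivity) ?_ hκ2
  refine hp.1.norm_add_le_mul hq ha.le hac hcb (fun x hx => ?_) hL hL₁ hL₂ hκ1
  exact hp.im_nonneg he hz hx.1 (lt_of_le_of_lt (by exact_mod_cast hx.2) hcb)

theorem amplitude_truncation {q : ℝ → ℝ} {a α : ℝ} (hα : 0 ≤ α) (hαa : α ≤ a) :
    amplitude (truncation q α) α = amplitude (truncation q a) α :=
  amplitude_congr (a := α) (fun y hy => by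
    rw [truncation_of_mem hy, truncation_of_mem ⟨hy.1, hy.2.trans hαa⟩]) hα le_rfl

end HalfLine

end

theorem theorem1p1 (q : ℝ → ℝ) (e : HalfLine.EndCondition) (he : e.Admissible q) :
    ∃ A : ℝ → ℝ,
      (∀ a : ℝ, 0 < a → (a : EReal) < e.endpoint → IntegrableOn A (Ioo 0 a)) ∧
      (∀ a : ℝ, 0 < a → (a : EReal) < e.endpoint → ∀ ε : ℝ, 0 < ε →
        HalfLine.IsOTilde (HalfLine.sectorAtInfinity ε)
          (fun κ : ℂ => HalfLine.weylM q e (-κ ^ 2) -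
            (-κ - ∫ α in (0 : ℝ)..a, (A α : ℂ) * Complex.exp (-2 * (α : ℂ) * κ)))
          (fun κ : ℂ => Complex.exp (-2 * (a : ℂ) * κ))) ∧
      ContinuousOn (fun α => A α - q α) {α : ℝ | 0 ≤ α ∧ (α : EReal) < e.endpoint} ∧
      (∀ α : ℝ, 0 ≤ α → (α : EReal) < e.endpoint →
        |A α - q α| ≤ (∫ x in (0 : ℝ)..α, |q x|) ^ 2 *
          Real.exp (α * ∫ x in (0 : ℝ)..α, |q x|)) := by
  have hq := he.isIntegrableUpTo
  have hcont : ∀ a : ℝ, 0 ≤ a → (a : EReal) < e.endpoint → ContinuousOn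
      (fun α => HalfLine.amplitude (HalfLine.truncation q α) α - q α) (Icc 0 a) := by
    intro a ha hab
    refine (HalfLine.continuous_amplitude_sub (HalfLine.integrable_truncation ha
      (hq.intervalIntegrable ha hab))).continuousOn.congr fun α hα => ?_
    beta_reduce
    rw [HalfLine.amplitude_truncation hα.1 hα.2, HalfLine.truncation_of_mem hα]
  -- Truncating at `α` itself gives one function on all of `[0, b)` and the sharp `∫₀^α |q|` in the
  -- bound. On each `[0, a]` it agrees with the function for the truncation at `a`.
  refine ⟨fun α => HalfLine.amplitude (HalfLine.truncation q α) α, fun a ha hab => ?_,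
    fun a ha hab ε hε => ?_, fun α hα => ?_, fun α hα hαb => ?_⟩
  · have h1 : IntegrableOn q (Ioo 0 a) :=
      ((intervalIntegrable_iff_integrableOn_Ioo_of_le ha.le).1 (hq.intervalIntegrable ha.le hab))
    have h2 := ((hcont a ha.le hab).integrableOn_Icc (μ := volume)).mono_set Ioo_subset_Icc_self
    refine (h2.add h1).congr_fun (fun α _ => ?_) measurableSet_Ioo
    simp
  · have h := HalfLine.isOTilde_weylM he ha hab hε
    have e1 : ∀ κ : ℂ, ∫ α in (0 : ℝ)..a, ((HalfLine.amplitude (HalfLine.truncation q α) α : ℝ) : ℂ) *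
        Complex.exp (-2 * (α : ℂ) * κ) = ∫ α in (0 : ℝ)..a,
        ((HalfLine.amplitude (HalfLine.truncation q a) α : ℝ) : ℂ) *
        Complex.exp (-2 * (α : ℂ) * κ) := by
      intro κ
      refine intervalIntegral.integral_congr fun α hα => ?_
      rw [uIcc_of_le ha.le] at hα
      rw [HalfLine.amplitude_truncation hα.1 hα.2]
    simp_rw [e1]
    exact h
  · obtain ⟨a, hαa, hab⟩ := EReal.lt_iff_exists_real_btwn.1 hα.2
    have hαa : α < a := by exact_mod_cast hαa
    refine (hcont a (hα.1.trans hαa.le) hab α ⟨hα.1, hαa.le⟩).mono_of_mem_nhdsWithin ?_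
    filter_upwards [self_mem_nhdsWithin, mem_nhdsWithin_of_mem_nhds (Iio_mem_nhds hαa)] with β h1 h2
    exact ⟨h1.1, le_of_lt h2⟩
  · have h := HalfLine.abs_amplitude_sub_le (HalfLine.integrable_truncation hα
      (hq.intervalIntegrable hα hαb)) hα
    rw [HalfLine.integral_abs_truncation hα, HalfLine.truncation_of_mem ⟨hα, le_rfl⟩] at h
    exact h
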